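/- Let $n\ge 1$, let $d\ge 2$ be even, and let $P$ be a homogeneous harmonic polynomial of degree $d$ in $n$ variables with real coefficients. Put $K(x)=P(x)/|x|^{n+d}$ for $x\in\mathbb R^n\setminus\{0\}$. For $f\in L^p(\mathbb R^n)$, $1\le p<\infty$ (real or complex valued), set $$T^{\varepsilon}f(x)=\int_{|y|>\varepsilon} f(x-y)\,K(y)\,dy,\qquad Tf(x)=\lim_{\varepsilon\to 0^+}T^{\varepsilon}f(x),\qquad T^{\star}f(x)=\sup_{\varepsilon>0}|T^{\varepsilon}f(x)|,$$ and let $Mg(x)=\sup_{r>0}\frac1{|B(x,r)|}\int_{B(x,r)}|g|$ be the (centered) Hardy--Littlewood maximal function and $\|g\|_{1,\infty}=\sup_{t>0}t\,|\{x:|g(x)|>t\}|$. Let $B$ be the open unit ball of $\mathbb R^n$ centered at $0$. Then: 1. There is a bounded measurable real-valued function $b$ on $\mathbb R^n$, vanishing outside $B$, such that $T(b)(x)=K(x)\,\chi_{\mathbb R^n\setminus\overline B}(x)$ for almost every $x\in\mathbb R^n$ (in particular the principal value $T(b)(x)$ exists for almost every $x$). 2. There is a finite constant $C$, depending only on $n$,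 $d$ and $P$, such that for every $1\le p<\infty$ and every $f\in L^p(\mathbb R^n)$ the limit defining $Tf(x)$ exists for almost every $x$, and $$T^{\star}f(x)\le C\,M(Tf)(x)\quad\text{for every }x\in\mathbb R^n,\qquad \|T^{\star}f\|_{1,\infty}\le C\,\|Tf\|_{1}.$$ -/

import Mathlib

open MeasureTheory Filter Topology Set
open scoped ENNReal NNReal

noncomputable section

namespace HigherRiesz

/-- A real polynomial in `n` variables is harmonic if `∑ i, ∂²P/∂xᵢ² = 0`. -/
def IsHarmonicPoly {n : ℕ} (P : MvPolynomial (Fin n) ℝ) : Prop :=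
  ∑ i : Fin n, MvPolynomial.pderiv i (MvPolynomial.pderiv i P) = 0

/-- The kernel `K(x) = P(x) / |x|^(n+d)` on `ℝⁿ`. -/
def kernel {n : ℕ} (d : ℕ) (P : MvPolynomial (Fin n) ℝ) (x : EuclideanSpace ℝ (Fin n)) : ℝ :=
  MvPolynomial.eval (fun i => x i) P / ‖x‖ ^ (n + d)

variable {n : ℕ} {F : Type*} [NormedAddCommGroup F] [NormedSpace ℝ F]

/-- The truncated singular integral `T^ε f(x) = ∫_{|y| > ε} f(x - y) K(y) dy`. -/
def truncated (d : ℕ) (P : MvPolynomial (Fin n) ℝ) (ε : ℝ)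
    (f : EuclideanSpace ℝ (Fin n) → F) (x : EuclideanSpace ℝ (Fin n)) : F :=
  ∫ y in {y : EuclideanSpace ℝ (Fin n) | ε < ‖y‖}, kernel d P y • f (x - y)

/-- The principal value `lim_{ε → 0+} T^ε f(x)` exists and equals `v`. -/
def HasPrincipalValue (d : ℕ) (P : MvPolynomial (Fin n) ℝ)
    (f : EuclideanSpace ℝ (Fin n) → F) (x : EuclideanSpace ℝ (Fin n)) (v : F) : Prop :=
  Tendsto (fun ε : ℝ => truncated d P ε f x) (𝓝[>] 0) (𝓝 v)

/-- The singular integral `Tf(x) = P.V. ∫ f(x - y) K(y) dy`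
(with an arbitrary value at the points where the principal value does not exist). -/
def rieszTransform (d : ℕ) (P : MvPolynomial (Fin n) ℝ)
    (f : EuclideanSpace ℝ (Fin n) → F) (x : EuclideanSpace ℝ (Fin n)) : F :=
  limUnder (𝓝[>] (0 : ℝ)) (fun ε : ℝ => truncated d P ε f x)

/-- The maximal singular integral `T*f(x) = sup_{ε > 0} |T^ε f(x)|`. -/
def maximalRiesz (d : ℕ) (P : MvPolynomial (Fin n) ℝ)
    (f : EuclideanSpace ℝ (Fin n) → F) (x : EuclideanSpace ℝ (Fin n)) : ℝ≥0∞ :=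
  ⨆ (ε : ℝ) (_ : 0 < ε), ‖truncated d P ε f x‖ₑ

/-- The (centered) Hardy–Littlewood maximal function
`Mg(x) = sup_{r > 0} |B(x,r)|⁻¹ ∫_{B(x,r)} |g|`. -/
def hardyLittlewood (g : EuclideanSpace ℝ (Fin n) → F) (x : EuclideanSpace ℝ (Fin n)) : ℝ≥0∞ :=
  ⨆ (r : ℝ) (_ : 0 < r),
    (volume (Metric.ball x r))⁻¹ * ∫⁻ y in Metric.ball x r, ‖g y‖ₑ

/-- The weak `L¹` quasi-norm `sup_{t > 0} t |{x : g(x) > t}|` of a nonnegative function. -/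
def weakL1Norm (g : EuclideanSpace ℝ (Fin n) → ℝ≥0∞) : ℝ≥0∞ :=
  ⨆ (t : ℝ≥0) (_ : 0 < t), (t : ℝ≥0∞) * volume {x | (t : ℝ≥0∞) < g x}

end HigherRiesz

end

noncomputable section

namespace HigherRiesz

section

open scoped FourierTransform ContDiff SchwartzMap LineDeriv

/-! ### Polynomials as functions -/

/-! Write `d = 2N`. Off the closed unit ball `K` is `w(|x|²) P(x)` with the profile `w(u) =
u^(-(n/2+N))` for `u > 1`, extended by `0`. For a smooth profile `w`, let `Φ` be its `2N`-fold
primitive vanishing at infinity. Since `P` is harmonic, `P(∂)` applied to `Φ(|x|²)` is `2^(2N)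
w(|x|²) P(x)`, while `Δ^N` of the same function is radial with profile `ladder n N w`. On the
Fourier side the two differ by the symbol `m(ξ) = P(ξ) / (2|ξ|)^(2N)`; this is
`fourier_multiplier_identity`. Each step of the ladder multiplies a power tail by a constant and by
`u`, and the constant of the last step is `4 - 2n/(n/2) = 0`. So for the truncated power the ladder
profile vanishes for `u > 1` (`ladder_cutPower_vanish`), and `K 1_{|x|>1} = S b₀` with `S` the
multiplier of symbol `m` and `b₀` bounded and supported in the ball.

The symbol is real, even and homogeneous of degree `0`, so `S` is self-adjoint and compatible with
translations, dilations and reflection. Hence `T^ε g(x) = ε⁻ⁿ ∫ b₀((x-y)/ε) Sg(y) dy` for `g ∈ L²`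
(`exists_L2_transform`). Lebesgue differentiation then gives `Tg = (∫ b₀) Sg` almost everywhere. The
number `∫ b₀` is not `0`, since otherwise `T` would vanish on `L²`, contradicting
`exists_not_tendsto_zero`. Dividing by it yields the function `b` of the theorem (`exists_bump`),
and no multiplier constant has to be computed.

For general `f` the aim is `|T^ε f(x)| ≤ C ε⁻ⁿ ∫_{B(x,ε)} |Tf|`, which needs no `L^p` theory for
`T`. Near the ball `B(x,ε)`, `f` is integrable, and a Calderón-Zygmund decomposition at a large
height splits it into `g ∈ L²` and a bad part `β` tiny in `L¹`, with an exceptional set `S`. Off `S`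
the principal value of `β` exists and is small in `L¹`. On `S`, Cauchy-Schwarz bounds `∫_S |Tg|` by
a multiple of `(|S| ‖g‖₂²)^(1/2)`. Here `|S|` carries the inverse of the height and `‖g‖₂²` the
height itself; what remains is the mass of `f` on the bad set, which tends to `0`
(`exists_CZ_small`). So the `L²` estimate passes to `f` (`IsTame.exists_approx`,
`IsTame.enorm_truncated_le`), and the same approximation gives existence of `Tf`. The weak type
bound then follows from the one for the Hardy-Littlewood maximal function. -/

/-- The polynomial function on Euclidean space attached to `p`. -/
def polyEval {n : ℕ} (p : MvPolynomial (Fin n) ℝ) (x : EuclideanSpace ℝ (Fin n)) : ℝ :=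
  MvPolynomial.eval (fun i => x i) p

section Poly

variable {n : ℕ}

lemma polyEval_add (p q : MvPolynomial (Fin n) ℝ) (x : EuclideanSpace ℝ (Fin n)) :
    polyEval (p + q) x = polyEval p x + polyEval q x := by simp [polyEval]

lemma polyEval_mul (p q : MvPolynomial (Fin n) ℝ) (x : EuclideanSpace ℝ (Fin n)) :
    polyEval (p * q) x = polyEval p x * polyEval q x := by simp [polyEval]

lemma polyEval_X (i : Fin n) (x : EuclideanSpace ℝ (Fin n)) :
    polyEval (MvPolynomial.X i) x = x i := by simp [polyEval]

lemma polyEval_one (x : EuclideanSpace ℝ (Fin n)) :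
    polyEval (1 : MvPolynomial (Fin n) ℝ) x = 1 := by simp [polyEval]

lemma polyEval_sum {ι : Type*} (s : Finset ι) (p : ι → MvPolynomial (Fin n) ℝ)
    (x : EuclideanSpace ℝ (Fin n)) :
    polyEval (∑ i ∈ s, p i) x = ∑ i ∈ s, polyEval (p i) x := by simp [polyEval]

lemma polyEval_smul {p : MvPolynomial (Fin n) ℝ} {d : ℕ} (hp : p.IsHomogeneous d) (t : ℝ)
    (x : EuclideanSpace ℝ (Fin n)) : polyEval p (t • x) = t ^ d * polyEval p x := by
  simp only [polyEval, PiLp.smul_apply, smul_eq_mul]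
  rw [MvPolynomial.eval_eq, MvPolynomial.eval_eq, Finset.mul_sum]
  refine Finset.sum_congr rfl fun m hm => ?_
  have hdeg := hp (MvPolynomial.mem_support_iff.mp hm)
  have : ∑ i ∈ m.support, m i = d := by
    rw [← hdeg, Finsupp.weight_apply, Finsupp.sum]
    simp
  simp_rw [mul_pow]
  rw [Finset.prod_mul_distrib, Finset.prod_pow_eq_pow_sum, this]
  ring

lemma hasFDerivAt_polyEval (p : MvPolynomial (Fin n) ℝ) (x : EuclideanSpace ℝ (Fin n)) :
    HasFDerivAt (polyEval p)
      (∑ j, polyEval (MvPolynomial.pderiv j p) x • (EuclideanSpace.proj j :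
        EuclideanSpace ℝ (Fin n) →L[ℝ] ℝ)) x := by
  induction p using MvPolynomial.induction_on with
  | C a =>
    have h : HasFDerivAt (fun _ : EuclideanSpace ℝ (Fin n) => a)
        (0 : EuclideanSpace ℝ (Fin n) →L[ℝ] ℝ) x := hasFDerivAt_const a x
    refine (h.congr_of_eventuallyEq
      (Eventually.of_forall fun y => by simp [polyEval])).congr_fderiv ?_
    simp [polyEval]
  | add p q hp hq =>
    have h := hp.add hq
    simp only [map_add, polyEval_add, add_smul, Finset.sum_add_distrib]
    exact h.congr_of_eventuallyEq (Eventually.of_forall fun y => polyEval_add p q y)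
  | mul_X p i hp =>
    have hX : HasFDerivAt (fun y : EuclideanSpace ℝ (Fin n) => y i)
        (EuclideanSpace.proj i : EuclideanSpace ℝ (Fin n) →L[ℝ] ℝ) x :=
      (EuclideanSpace.proj i : EuclideanSpace ℝ (Fin n) →L[ℝ] ℝ).hasFDerivAt
    have h := hp.mul hX
    refine (h.congr_of_eventuallyEq
      (Eventually.of_forall fun y => by simp [polyEval_mul, polyEval_X])).congr_fderiv ?_
    simp only [Derivation.leibniz, polyEval_add, smul_eq_mul, polyEval_mul, polyEval_X,
      MvPolynomial.pderiv_X, add_smul, Finset.sum_add_distrib, Finset.smul_sum, smul_smul]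
    congr 1
    rw [Finset.sum_eq_single i]
    · simp [polyEval]
    · intro j _ hj
      simp [hj.symm, polyEval]
    · simp

lemma contDiff_polyEval (p : MvPolynomial (Fin n) ℝ) {k : ℕ∞ω} : ContDiff ℝ k (polyEval p) := by
  induction p using MvPolynomial.induction_on with
  | C a =>
    rw [show polyEval (MvPolynomial.C a) = fun _ : EuclideanSpace ℝ (Fin n) => a from
      funext fun x => by simp [polyEval]]
    exact contDiff_const
  | add p q hp hq =>
    rw [show polyEval (p + q) = fun x => polyEval p x + polyEval q x from
      funext (polyEval_add p q)]
    exact ContDiff.add hp hq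
  | mul_X p i hp =>
    rw [show polyEval (p * MvPolynomial.X i) = fun x => polyEval p x *
      (EuclideanSpace.proj i : EuclideanSpace ℝ (Fin n) →L[ℝ] ℝ) x from
      funext fun x => by simp [polyEval_mul, polyEval_X]]
    exact ContDiff.mul hp (ContinuousLinearMap.contDiff _)

lemma continuous_polyEval (p : MvPolynomial (Fin n) ℝ) : Continuous (polyEval p) :=
  (contDiff_polyEval p (k := 0)).continuous

end Poly

/-! ### Radial profiles -/

/-- A smooth function on the line vanishing near `+∞`. -/
structure IsProfile (w : ℝ → ℝ) : Prop where
  smooth : ContDiff ℝ ∞ w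
  vanish : ∃ R, ∀ u ≥ R, w u = 0

/-- The primitive vanishing at infinity. -/
def tailPrim (w : ℝ → ℝ) (u : ℝ) : ℝ := -∫ s in Ioi u, w s

/-- The Hardy-type operator `w ↦ 4 u w + 2 ν ∫ w` through which the Laplacian acts on radial
profiles. -/
def hardyStep (ν : ℝ) (w : ℝ → ℝ) (u : ℝ) : ℝ := 4 * u * w u + 2 * ν * tailPrim w u

/-- The composition of `k` Hardy steps that represents the `k`-th power of the Laplacian. -/
def ladder (ν : ℝ) : ℕ → (ℝ → ℝ) → (ℝ → ℝ)
  | 0, w => w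
  | k + 1, w => ladder ν k (hardyStep (ν + 4 * k) w)

lemma tailPrim_eq_interval {w : ℝ → ℝ} {R : ℝ} (hR : ∀ u ≥ R, w u = 0) (u : ℝ) :
    tailPrim w u = ∫ s in R..u, w s := by
  unfold tailPrim
  rcases le_total u R with h | h
  · rw [intervalIntegral.integral_of_ge h]
    congr 1
    refine (setIntegral_eq_of_subset_of_forall_sdiff_eq_zero measurableSet_Ioi
      (fun s hs => hs.1) fun s hs => hR s ?_)
    by_contra hlt
    exact hs.2 ⟨hs.1, (not_le.mp hlt).le⟩
  · rw [intervalIntegral.integral_of_le h, setIntegral_eq_zero_of_forall_eq_zero,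
      setIntegral_eq_zero_of_forall_eq_zero]
    · simp
    · intro s hs; exact hR s hs.1.le
    · intro s hs; exact hR s (h.trans (le_of_lt hs))

namespace IsProfile

variable {w : ℝ → ℝ}

lemma hasDerivAt_tailPrim (hw : IsProfile w) (u : ℝ) : HasDerivAt (tailPrim w) (w u) u := by
  obtain ⟨R, hR⟩ := hw.vanish
  have hc := hw.smooth.continuous
  have : tailPrim w = fun u => ∫ s in R..u, w s := funext fun u => tailPrim_eq_interval hR u
  rw [this]
  exact intervalIntegral.integral_hasDerivAt_right (hc.intervalIntegrable _ _)
    hc.stronglyMeasurable.stronglyMeasurableAtFilter hc.continuousAt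

lemma tailPrim (hw : IsProfile w) : IsProfile (tailPrim w) := by
  refine ⟨?_, ?_⟩
  · rw [contDiff_infty_iff_deriv]
    refine ⟨fun u => (hw.hasDerivAt_tailPrim u).differentiableAt, ?_⟩
    rw [show deriv (HigherRiesz.tailPrim w) = w from
      funext fun u => (hw.hasDerivAt_tailPrim u).deriv]
    exact hw.smooth
  · obtain ⟨R, hR⟩ := hw.vanish
    refine ⟨R, fun u hu => ?_⟩
    rw [HigherRiesz.tailPrim, setIntegral_eq_zero_of_forall_eq_zero]
    · simp
    · intro s hs; exact hR s (hu.trans (le_of_lt hs))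

lemma hardyStep (hw : IsProfile w) (ν : ℝ) : IsProfile (hardyStep ν w) := by
  obtain ⟨R, hR⟩ := hw.vanish
  obtain ⟨R', hR'⟩ := hw.tailPrim.vanish
  refine ⟨?_, max R R', fun u hu => ?_⟩
  · exact ((contDiff_const.mul contDiff_id).mul hw.smooth).add
      (contDiff_const.mul hw.tailPrim.smooth)
  · simp [HigherRiesz.hardyStep, hR u ((le_max_left _ _).trans hu),
      hR' u ((le_max_right _ _).trans hu)]

lemma iterate_tailPrim (hw : IsProfile w) (k : ℕ) : IsProfile (HigherRiesz.tailPrim^[k] w) := by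
  induction k with
  | zero => simpa using hw
  | succ k ih => rw [Function.iterate_succ_apply']; exact ih.tailPrim

lemma ladder (hw : IsProfile w) (ν : ℝ) (k : ℕ) : IsProfile (ladder ν k w) := by
  induction k generalizing w with
  | zero => exact hw
  | succ k ih => exact ih (hw.hardyStep _)

/-- Vanishing near `+∞` removes the constant of integration, so identities between profiles can be
checked on derivatives. -/
lemma eq_of_hasDerivAt {v w f : ℝ → ℝ} (hv : IsProfile v) (hw : IsProfile w)
    (hdv : ∀ u, HasDerivAt v (f u) u) (hdw : ∀ u, HasDerivAt w (f u) u) : v = w := by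
  obtain ⟨R, hR⟩ := hv.vanish
  obtain ⟨R', hR'⟩ := hw.vanish
  have hd : ∀ u, HasDerivAt (fun u => v u - w u) 0 u := fun u => by
    have h := (hdv u).sub (hdw u)
    rw [sub_self] at h
    exact h
  have hconst := is_const_of_deriv_eq_zero (fun u => (hd u).differentiableAt)
    (fun u => (hd u).deriv)
  funext u
  have h := hconst u (max R R')
  simp only [hR _ (le_max_left R R'), hR' _ (le_max_right R R'), sub_zero] at h
  linarith

/-- The product rule on `4 u · tailPrim w` produces an extra `4 · tailPrim w`, which raises the
parameter `ν` by `2`. Moving past `2k` primitives raises it by `4k`; this is the origin of the shift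
in `ladder`. -/
lemma hardyStep_tailPrim (hw : IsProfile w) (ν : ℝ) :
    HigherRiesz.hardyStep ν (HigherRiesz.tailPrim w) =
      HigherRiesz.tailPrim (HigherRiesz.hardyStep (ν + 2) w) := by
  refine eq_of_hasDerivAt (hw.tailPrim.hardyStep ν) (hw.hardyStep (ν + 2)).tailPrim
    (fun u => ?_) (fun u => (hw.hardyStep (ν + 2)).hasDerivAt_tailPrim u)
  have h1 := (((hasDerivAt_id u).const_mul 4).mul (hw.hasDerivAt_tailPrim u)).add
    ((hw.tailPrim.hasDerivAt_tailPrim u).const_mul (2 * ν))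
  refine h1.congr_deriv ?_
  simp only [HigherRiesz.hardyStep, id]
  ring

lemma hardyStep_iterate_tailPrim (hw : IsProfile w) (ν : ℝ) (k : ℕ) :
    HigherRiesz.hardyStep ν (HigherRiesz.tailPrim^[k] w) =
      HigherRiesz.tailPrim^[k] (HigherRiesz.hardyStep (ν + 2 * k) w) := by
  induction k generalizing w with
  | zero => simp
  | succ k ih =>
    rw [Function.iterate_succ_apply, Function.iterate_succ_apply, ih hw.tailPrim,
      hw.hardyStep_tailPrim]
    push_cast
    ring_nf

end IsProfile

/-! ### Fourier transforms of radial functions times polynomials -/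

section Fourier

variable {n : ℕ}

/-- The function `x ↦ w(|x|²) p(x)`. -/
def radialPoly (w : ℝ → ℝ) (p : MvPolynomial (Fin n) ℝ) (x : EuclideanSpace ℝ (Fin n)) : ℂ :=
  ((w (‖x‖ ^ 2) * polyEval p x : ℝ) : ℂ)

lemma contDiff_radialPoly {w : ℝ → ℝ} (hw : IsProfile w) (p : MvPolynomial (Fin n) ℝ) :
    ContDiff ℝ ∞ (radialPoly w p) :=
  Complex.ofRealCLM.contDiff.comp
    ((hw.smooth.comp (contDiff_norm_sq ℝ)).mul (contDiff_polyEval p))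

lemma hasCompactSupport_radialPoly {w : ℝ → ℝ} (hw : IsProfile w) (p : MvPolynomial (Fin n) ℝ) :
    HasCompactSupport (radialPoly w p) := by
  obtain ⟨R, hR⟩ := hw.vanish
  refine HasCompactSupport.intro (isCompact_closedBall 0 (|R| + 1)) fun x hx => ?_
  have hx' : |R| + 1 < ‖x‖ := by simpa using hx
  have : R ≤ ‖x‖ ^ 2 := by nlinarith [le_abs_self R, abs_nonneg R]
  simp [radialPoly, hR _ this]

/-- The Schwartz function `x ↦ w(|x|²) p(x)`. -/
def radialSchwartz {w : ℝ → ℝ} (hw : IsProfile w) (p : MvPolynomial (Fin n) ℝ) :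
    𝓢(EuclideanSpace ℝ (Fin n), ℂ) :=
  (hasCompactSupport_radialPoly hw p).toSchwartzMap (contDiff_radialPoly hw p)

lemma integrable_radialPoly {w : ℝ → ℝ} (hw : IsProfile w) (p : MvPolynomial (Fin n) ℝ) :
    Integrable (radialPoly w p) := (radialSchwartz hw p).integrable

lemma fderiv_radialPoly_tailPrim {w : ℝ → ℝ} (hw : IsProfile w) (p : MvPolynomial (Fin n) ℝ)
    (i : Fin n) (x : EuclideanSpace ℝ (Fin n)) :
    fderiv ℝ (radialPoly (tailPrim w) p) x (EuclideanSpace.single i 1) =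
      2 * radialPoly w (MvPolynomial.X i * p) x +
        radialPoly (tailPrim w) (MvPolynomial.pderiv i p) x := by
  have h1 : HasFDerivAt (fun y : EuclideanSpace ℝ (Fin n) => tailPrim w (‖y‖ ^ 2))
      (w (‖x‖ ^ 2) • (2 • innerSL ℝ x)) x :=
    (hw.hasDerivAt_tailPrim _).comp_hasFDerivAt x (hasStrictFDerivAt_norm_sq x).hasFDerivAt
  have h2 := Complex.ofRealCLM.hasFDerivAt.comp x (h1.mul (hasFDerivAt_polyEval p x))
  have h3 : fderiv ℝ (radialPoly (tailPrim w) p) x = _ := h2.fderiv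
  rw [h3]
  simp only [radialPoly, polyEval_mul, polyEval_X]
  simp [EuclideanSpace.inner_single_right]
  ring

lemma fourier_partial {f : EuclideanSpace ℝ (Fin n) → ℂ} (hf : ContDiff ℝ ∞ f)
    (hc : HasCompactSupport f) (i : Fin n) (ξ : EuclideanSpace ℝ (Fin n)) :
    𝓕 (fun x => fderiv ℝ f x (EuclideanSpace.single i 1)) ξ =
      2 * Real.pi * Complex.I * ξ i * 𝓕 f ξ := by
  have h := SchwartzMap.fourier_lineDerivOp_eq (hc.toSchwartzMap hf) (EuclideanSpace.single i 1)
  have h2 := congrArg (fun F : 𝓢(EuclideanSpace ℝ (Fin n), ℂ) => F ξ) h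
  have htg : (fun y : EuclideanSpace ℝ (Fin n) =>
      inner ℝ y (EuclideanSpace.single i 1)).HasTemperateGrowth :=
    ((innerSL ℝ).flip (EuclideanSpace.single i 1)).hasTemperateGrowth
  simp only [_root_.smul_apply, SchwartzMap.smulLeftCLM_apply_apply htg] at h2
  simp only [SchwartzMap.fourier_coe] at h2
  have e : ⇑(∂_{EuclideanSpace.single i (1 : ℝ)} (hc.toSchwartzMap hf) :
      𝓢(EuclideanSpace ℝ (Fin n), ℂ)) =
      fun x => fderiv ℝ f x (EuclideanSpace.single i 1) := by
    ext x
    rw [SchwartzMap.lineDerivOp_apply_eq_fderiv]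
    rfl
  rw [e] at h2
  rw [h2]
  simp [EuclideanSpace.inner_single_right]
  simp only [mul_assoc]
  rfl

lemma fourier_add_apply {f g : EuclideanSpace ℝ (Fin n) → ℂ} (hf : Integrable f)
    (hg : Integrable g) (a b : ℂ) (ξ : EuclideanSpace ℝ (Fin n)) :
    𝓕 (fun x => a * f x + b * g x) ξ = a * 𝓕 f ξ + b * 𝓕 g ξ := by
  simp only [Real.fourier_eq]
  have hf' := (Real.fourierIntegral_convergent_iff ξ).2 hf
  have hg' := (Real.fourierIntegral_convergent_iff ξ).2 hg
  rw [← integral_const_mul, ← integral_const_mul,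
    ← integral_add (hf'.const_mul a) (hg'.const_mul b)]
  congr 1
  ext v
  simp only [Circle.smul_def, smul_eq_mul]
  ring

/-- The Fourier form of `∂ᵢ(W(|x|²) p) = 2 xᵢ W'(|x|²) p + W(|x|²) ∂ᵢp` with `W' = w`. The
Hecke-Bochner identity and the ladder are both obtained by summing it over `i`. -/
lemma fourier_partial_radialPoly {w : ℝ → ℝ} (hw : IsProfile w) (p : MvPolynomial (Fin n) ℝ)
    (i : Fin n) (ξ : EuclideanSpace ℝ (Fin n)) :
    2 * 𝓕 (radialPoly w (MvPolynomial.X i * p)) ξ +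
        𝓕 (radialPoly (tailPrim w) (MvPolynomial.pderiv i p)) ξ =
      2 * Real.pi * Complex.I * ξ i * 𝓕 (radialPoly (tailPrim w) p) ξ := by
  rw [← fourier_partial (contDiff_radialPoly hw.tailPrim p)
    (hasCompactSupport_radialPoly hw.tailPrim p)]
  simp_rw [fderiv_radialPoly_tailPrim hw]
  have h := fourier_add_apply (integrable_radialPoly hw (MvPolynomial.X i * p))
    (integrable_radialPoly hw.tailPrim (MvPolynomial.pderiv i p)) 2 1 ξ
  simp only [one_mul] at h
  exact h.symm

/-- The Fourier transform of `w(|x|²) p(x)`, as a linear map in `p`. -/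
def fourierRadial {w : ℝ → ℝ} (hw : IsProfile w) (ξ : EuclideanSpace ℝ (Fin n)) :
    MvPolynomial (Fin n) ℝ →ₗ[ℝ] ℂ where
  toFun p := 𝓕 (radialPoly w p) ξ
  map_add' p q := by
    have h := fourier_add_apply (integrable_radialPoly hw p) (integrable_radialPoly hw q) 1 1 ξ
    simp only [one_mul] at h
    rw [← h]
    refine congrArg (fun F : EuclideanSpace ℝ (Fin n) → ℂ => 𝓕 F ξ) (funext fun x => ?_)
    simp [radialPoly, polyEval_add, mul_add]
  map_smul' a p := by
    have h := fourier_add_apply (integrable_radialPoly hw p) (integrable_radialPoly hw p) a 0 ξ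
    simp only [zero_mul, add_zero] at h
    simp only [RingHom.id_apply, Complex.real_smul]
    rw [← h]
    refine congrArg (fun F : EuclideanSpace ℝ (Fin n) → ℂ => 𝓕 F ξ) (funext fun x => ?_)
    simp only [radialPoly, polyEval, MvPolynomial.smul_eval]
    push_cast
    ring

lemma fourierRadial_apply {w : ℝ → ℝ} (hw : IsProfile w) (ξ : EuclideanSpace ℝ (Fin n))
    (p : MvPolynomial (Fin n) ℝ) : fourierRadial hw ξ p = 𝓕 (radialPoly w p) ξ := rfl

/-- The Laplacian commutes with `∂ᵢ`; commutation of partial derivatives is verified by induction on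
the polynomial. -/
lemma IsHarmonicPoly.pderiv {p : MvPolynomial (Fin n) ℝ} (hp : IsHarmonicPoly p) (i : Fin n) :
    IsHarmonicPoly (MvPolynomial.pderiv i p) := by
  unfold IsHarmonicPoly at *
  have h := congrArg (MvPolynomial.pderiv i) hp
  rw [map_sum, map_zero] at h
  rw [← h]
  refine Finset.sum_congr rfl fun j _ => ?_
  have hc : ∀ q : MvPolynomial (Fin n) ℝ, MvPolynomial.pderiv j (MvPolynomial.pderiv i q) =
      MvPolynomial.pderiv i (MvPolynomial.pderiv j q) := fun q => by
    have hX : ∀ k l m : Fin n, MvPolynomial.pderiv l (MvPolynomial.pderiv m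
        (MvPolynomial.X k : MvPolynomial (Fin n) ℝ)) = 0 := fun k l m => by
      rw [MvPolynomial.pderiv_X]
      by_cases hkm : m = k
      · subst hkm; simp
      · simp [Ne.symm hkm]
    induction q using MvPolynomial.induction_on with
    | C a => simp
    | add p q hp hq => simp only [map_add, hp, hq]
    | mul_X p k hp =>
      simp only [Derivation.leibniz, map_add, smul_eq_mul, hX, hp, mul_zero]
      ring
  rw [hc, hc]

/-- Hecke-Bochner type identity for harmonic polynomials. -/
lemma fourier_radialPoly_harmonic {k : ℕ} {p : MvPolynomial (Fin n) ℝ} (hp : p.IsHomogeneous k)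
    (hharm : IsHarmonicPoly p) {w : ℝ → ℝ} (hw : IsProfile w) (ξ : EuclideanSpace ℝ (Fin n)) :
    2 ^ k * 𝓕 (radialPoly w p) ξ =
      (2 * Real.pi * Complex.I) ^ k * polyEval p ξ *
        𝓕 (radialPoly (tailPrim^[k] w) (1 : MvPolynomial (Fin n) ℝ)) ξ := by
  induction k generalizing p w with
  | zero =>
    rw [← MvPolynomial.totalDegree_zero_iff_isHomogeneous,
      MvPolynomial.totalDegree_eq_zero_iff_eq_C] at hp
    have h := (fourierRadial hw ξ).map_smul (MvPolynomial.coeff 0 p) 1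
    rw [MvPolynomial.smul_eq_C_mul, mul_one, ← hp] at h
    have hv : polyEval p ξ = MvPolynomial.coeff 0 p := by
      conv_lhs => rw [hp]
      simp [polyEval]
    simpa [fourierRadial_apply, hv] using h
  | succ k ih =>
    -- Euler's identity recovers `(k+1) p` from the products `xᵢ ∂ᵢp`. Each `∂ᵢp` is harmonic of
    -- degree `k`, so the induction hypothesis applies to it.
    have hE := hp.sum_X_mul_pderiv
    have hstep : ∀ i : Fin n,
        2 ^ (k + 1) * 𝓕 (radialPoly w (MvPolynomial.X i * MvPolynomial.pderiv i p)) ξ +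
        2 ^ k * 𝓕 (radialPoly (tailPrim w)
          (MvPolynomial.pderiv i (MvPolynomial.pderiv i p))) ξ =
        (2 * Real.pi * Complex.I) ^ (k + 1) *
          (polyEval (MvPolynomial.X i * MvPolynomial.pderiv i p) ξ : ℝ) *
        𝓕 (radialPoly (tailPrim^[k + 1] w) (1 : MvPolynomial (Fin n) ℝ)) ξ := fun i => by
      have h1 := ih (p := MvPolynomial.pderiv i p) (by simpa using hp.pderiv (i := i))
        (hharm.pderiv i) hw.tailPrim
      have h2 := fourier_partial_radialPoly hw (MvPolynomial.pderiv i p) i ξ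
      rw [Function.iterate_succ_apply, polyEval_mul, polyEval_X]
      push_cast
      linear_combination (2 * Real.pi * Complex.I * ξ i) * h1 + 2 ^ k * h2
    have hsum := Finset.sum_congr (rfl : (Finset.univ : Finset (Fin n)) = _)
      (fun i _ => hstep i)
    simp only [← fourierRadial_apply hw, ← fourierRadial_apply hw.tailPrim,
      Finset.sum_add_distrib, ← Finset.mul_sum, ← Finset.sum_mul, ← map_sum,
      ← Complex.ofReal_sum, ← polyEval_sum] at hsum
    -- The second-order terms add up to the transform of the Laplacian of `p`, which is zero.
    rw [hE, show ∑ i, MvPolynomial.pderiv i (MvPolynomial.pderiv i p) = 0 from hharm,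
      map_zero, mul_zero, add_zero, map_nsmul, fourierRadial_apply] at hsum
    have hpe : polyEval ((k + 1) • p) ξ = (k + 1) * polyEval p ξ := by simp [polyEval]
    rw [hpe] at hsum
    have hk : ((k : ℂ) + 1) ≠ 0 := by exact_mod_cast Nat.succ_ne_zero k
    apply mul_left_cancel₀ hk
    simp only [nsmul_eq_mul] at hsum
    push_cast at hsum
    linear_combination hsum

/-- With `W'' = w`, the Laplacian of `W(|x|²)` is `4|x|² w(|x|²) + 2n W'(|x|²)`, that is, `hardyStep
n w` at `|x|²`. -/
lemma fourier_hardyStep {w : ℝ → ℝ} (hw : IsProfile w) (ξ : EuclideanSpace ℝ (Fin n)) :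
    𝓕 (radialPoly (hardyStep n w) (1 : MvPolynomial (Fin n) ℝ)) ξ =
      (2 * Real.pi * Complex.I * ‖ξ‖) ^ 2 *
        𝓕 (radialPoly (tailPrim (tailPrim w)) (1 : MvPolynomial (Fin n) ℝ)) ξ := by
  have hstep : ∀ i : Fin n,
      4 * fourierRadial hw ξ (MvPolynomial.X i * MvPolynomial.X i) +
        2 * 𝓕 (radialPoly (tailPrim w) (1 : MvPolynomial (Fin n) ℝ)) ξ =
      (2 * Real.pi * Complex.I) ^ 2 * ((ξ i ^ 2 : ℝ) : ℂ) *
        𝓕 (radialPoly (tailPrim (tailPrim w)) (1 : MvPolynomial (Fin n) ℝ)) ξ := fun i => by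
    have h1 := fourier_partial_radialPoly hw (MvPolynomial.X i) i ξ
    have h2 := fourier_partial_radialPoly hw.tailPrim 1 i ξ
    have h0 : 𝓕 (radialPoly (tailPrim (tailPrim w))
        (0 : MvPolynomial (Fin n) ℝ)) ξ = 0 := by
      rw [← fourierRadial_apply hw.tailPrim.tailPrim, map_zero]
    simp only [mul_one, MvPolynomial.pderiv_one, MvPolynomial.pderiv_X_self, h0, add_zero] at h1 h2
    rw [fourierRadial_apply]
    push_cast
    linear_combination 2 * h1 + (2 * Real.pi * Complex.I * ξ i) * h2
  have hsum := Finset.sum_congr (rfl : (Finset.univ : Finset (Fin n)) = _)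
    (fun i _ => hstep i)
  simp only [Finset.sum_add_distrib, ← Finset.mul_sum, ← Finset.sum_mul, ← map_sum,
      ← Complex.ofReal_sum, ← EuclideanSpace.real_norm_sq_eq, Finset.sum_const,
      Finset.card_univ, Fintype.card_fin, nsmul_eq_mul] at hsum
  rw [fourierRadial_apply] at hsum
  have h := fourier_add_apply
    (integrable_radialPoly hw (∑ i : Fin n, MvPolynomial.X i * MvPolynomial.X i))
    (integrable_radialPoly hw.tailPrim (1 : MvPolynomial (Fin n) ℝ)) 4 (2 * n) ξ
  have e : radialPoly (hardyStep n w) (1 : MvPolynomial (Fin n) ℝ) = fun x =>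
      4 * radialPoly w (∑ i : Fin n, MvPolynomial.X i * MvPolynomial.X i) x +
        2 * n * radialPoly (tailPrim w) (1 : MvPolynomial (Fin n) ℝ) x := by
    ext x
    simp only [radialPoly, hardyStep, polyEval_sum, polyEval_mul, polyEval_X, polyEval_one,
      EuclideanSpace.real_norm_sq_eq]
    push_cast
    simp only [← pow_two]
    ring
  rw [e, h]
  push_cast at hsum
  linear_combination hsum

/-- Iterates `fourier_hardyStep`: one Laplacian consumes two primitives, and the Hardy step it
leaves is pushed inside the remaining `2k` primitives at the cost of `ν ↦ ν + 4k`. -/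
lemma fourier_ladder (k : ℕ) {w : ℝ → ℝ} (hw : IsProfile w) (ξ : EuclideanSpace ℝ (Fin n)) :
    𝓕 (radialPoly (ladder n k w) (1 : MvPolynomial (Fin n) ℝ)) ξ =
      (2 * Real.pi * Complex.I * ‖ξ‖) ^ (2 * k) *
        𝓕 (radialPoly (tailPrim^[2 * k] w) (1 : MvPolynomial (Fin n) ℝ)) ξ := by
  induction k generalizing w with
  | zero => simp [ladder]
  | succ k ih =>
    have h := hw.hardyStep_iterate_tailPrim n (2 * k)
    have e : (n : ℝ) + 2 * ((2 * k : ℕ) : ℝ) = n + 4 * k := by push_cast; ring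
    rw [e] at h
    rw [ladder, ih (hw.hardyStep _), ← h, fourier_hardyStep (hw.iterate_tailPrim _),
      ← Function.iterate_succ_apply' tailPrim, ← Function.iterate_succ_apply' tailPrim,
      show 2 * (k + 1) = 2 * k + 1 + 1 by ring]
    simp only [Nat.succ_eq_add_one]
    ring

/-- `fourier_radialPoly_harmonic` and `fourier_ladder` express both transforms through that of the
same `2N`-fold primitive, which is eliminated here. -/
lemma fourier_multiplier_identity {N : ℕ} {P : MvPolynomial (Fin n) ℝ}
    (hP : P.IsHomogeneous (2 * N)) (hharm : IsHarmonicPoly P) {w : ℝ → ℝ} (hw : IsProfile w)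
    (ξ : EuclideanSpace ℝ (Fin n)) :
    2 ^ (2 * N) * ‖ξ‖ ^ (2 * N) * 𝓕 (radialPoly w P) ξ =
      polyEval P ξ * 𝓕 (radialPoly (ladder n N w) (1 : MvPolynomial (Fin n) ℝ)) ξ := by
  rw [fourier_ladder N hw]
  have h := fourier_radialPoly_harmonic hP hharm hw ξ
  have e : (2 * Real.pi * Complex.I * ‖ξ‖ : ℂ) ^ (2 * N) =
      (2 * Real.pi * Complex.I) ^ (2 * N) * (‖ξ‖ : ℂ) ^ (2 * N) := mul_pow _ _ _
  rw [e]
  linear_combination ((‖ξ‖ : ℂ) ^ (2 * N)) * h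

end Fourier

end

section

open scoped FourierTransform ContDiff SchwartzMap LineDeriv

/-! ### Dominated convergence along the ladder -/

/-- Pointwise convergence on the half line, dominated by `C max(u,1)^(-α)`. -/
structure DomConv (α C : ℝ) (f : ℕ → ℝ → ℝ) (g : ℝ → ℝ) : Prop where
  meas : ∀ k, Measurable (f k)
  meas_lim : Measurable g
  bound : ∀ k, ∀ u, 0 ≤ u → |f k u| ≤ C * max u 1 ^ (-α)
  bound_lim : ∀ u, 0 ≤ u → |g u| ≤ C * max u 1 ^ (-α)
  tendsto : ∀ u, 0 ≤ u → Tendsto (fun k => f k u) atTop (𝓝 (g u))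

lemma integrableOn_max_rpow {α : ℝ} (hα : 1 < α) :
    IntegrableOn (fun s : ℝ => max s 1 ^ (-α)) (Ioi 0) := by
  rw [← Ioc_union_Ioi_eq_Ioi (zero_le_one : (0 : ℝ) ≤ 1)]
  refine IntegrableOn.union ?_ ?_
  · refine (integrableOn_const (C := (1 : ℝ)) (by simp)).congr_fun (fun s hs => ?_)
      measurableSet_Ioc
    simp [max_eq_right hs.2]
  · refine (integrableOn_Ioi_rpow_of_lt (a := -α) (by linarith) one_pos).congr_fun
      (fun s hs => ?_) measurableSet_Ioi
    simp [max_eq_left (le_of_lt (mem_Ioi.mp hs))]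

lemma setIntegral_max_rpow_le {α : ℝ} (hα : 1 < α) {u : ℝ} (hu : 0 ≤ u) :
    ∫ s in Ioi u, max s 1 ^ (-α) ≤ (1 + 1 / (α - 1)) * max u 1 ^ (1 - α) := by
  have hα' : 0 < α - 1 := by linarith
  have hIoi : ∀ v : ℝ, 1 ≤ v → ∫ s in Ioi v, max s 1 ^ (-α) = v ^ (1 - α) / (α - 1) := by
    intro v hv
    rw [setIntegral_congr_fun (g := fun s => s ^ (-α)) measurableSet_Ioi,
      integral_Ioi_rpow_of_lt (by linarith) (by linarith)]
    · rw [show -α + 1 = 1 - α by ring, show 1 - α = -(α - 1) by ring, div_neg, neg_div, neg_neg]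
    · intro s hs
      simp [max_eq_left (hv.trans (le_of_lt (mem_Ioi.mp hs)))]
  rcases le_total 1 u with h | h
  · rw [hIoi u h, max_eq_left h]
    have : 0 ≤ u ^ (1 - α) := Real.rpow_nonneg hu _
    rw [add_mul, one_mul, one_div, div_eq_inv_mul]
    linarith
  · rw [max_eq_right h, Real.one_rpow, mul_one]
    have hint := integrableOn_max_rpow hα
    calc ∫ s in Ioi u, max s 1 ^ (-α) ≤ ∫ s in Ioi (0 : ℝ), max s 1 ^ (-α) :=
          setIntegral_mono_set hint (Eventually.of_forall fun s => by positivity)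
            (Ioi_subset_Ioi hu).eventuallyLE
      _ = (∫ s in Ioc (0 : ℝ) 1, max s 1 ^ (-α)) + ∫ s in Ioi (1 : ℝ), max s 1 ^ (-α) := by
          rw [← setIntegral_union Ioc_disjoint_Ioi_same measurableSet_Ioi
            (hint.mono_set Ioc_subset_Ioi_self) (hint.mono_set (Ioi_subset_Ioi zero_le_one)),
            Ioc_union_Ioi_eq_Ioi zero_le_one]
      _ = 1 + 1 / (α - 1) := by
          rw [hIoi 1 le_rfl, Real.one_rpow,
            setIntegral_congr_fun (g := fun _ => (1 : ℝ)) measurableSet_Ioc]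
          · simp
          · intro s hs
            simp [max_eq_right hs.2]

/-- Measurability of a parametric integral: the tail is the section of the set `{u < s}`, and the
limit profiles are not smooth. -/
lemma measurable_tailPrim {f : ℝ → ℝ} (hf : Measurable f) : Measurable (tailPrim f) := by
  unfold tailPrim
  refine Measurable.neg ?_
  have h : (fun u => ∫ s in Ioi u, f s) =
      fun u => ∫ s, {p : ℝ × ℝ | p.1 < p.2}.indicator (fun p => f p.2) (u, s) := by
    funext u
    rw [← integral_indicator measurableSet_Ioi]
    rfl
  rw [h]
  refine StronglyMeasurable.measurable (StronglyMeasurable.integral_prod_right ?_)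
  exact ((hf.comp measurable_snd).indicator
    (measurableSet_lt measurable_fst measurable_snd)).stronglyMeasurable

lemma abs_tailPrim_le {α C : ℝ} (hα : 1 < α) {f : ℝ → ℝ}
    (hb : ∀ u, 0 ≤ u → |f u| ≤ C * max u 1 ^ (-α)) {u : ℝ} (hu : 0 ≤ u) :
    |tailPrim f u| ≤ C * ((1 + 1 / (α - 1)) * max u 1 ^ (1 - α)) := by
  have hC : 0 ≤ C := by
    have := (abs_nonneg _).trans (hb 0 le_rfl)
    simpa using this
  unfold tailPrim
  rw [abs_neg]
  calc |∫ s in Ioi u, f s| ≤ ∫ s in Ioi u, C * max s 1 ^ (-α) := by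
        rw [← Real.norm_eq_abs]
        refine norm_integral_le_of_norm_le
          (((integrableOn_max_rpow hα).mono_set (Ioi_subset_Ioi hu)).const_mul C) ?_
        filter_upwards [ae_restrict_mem measurableSet_Ioi] with s hs
        exact hb s (hu.trans (le_of_lt hs))
    _ = C * ∫ s in Ioi u, max s 1 ^ (-α) := integral_const_mul _ _
    _ ≤ _ := mul_le_mul_of_nonneg_left (setIntegral_max_rpow_le hα hu) hC

lemma mul_max_rpow_le (α u : ℝ) : u * max u 1 ^ (-α) ≤ max u 1 ^ (1 - α) := by
  have hm : 0 < max u 1 := lt_max_of_lt_right one_pos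
  calc u * max u 1 ^ (-α) ≤ max u 1 * max u 1 ^ (-α) :=
        mul_le_mul_of_nonneg_right (le_max_left _ _) (Real.rpow_nonneg hm.le _)
    _ = max u 1 ^ (1 - α) := by
        rw [show 1 - α = 1 + -α by ring, Real.rpow_add hm, Real.rpow_one]

/-- Both multiplication by `u` and integration of the tail cost exactly one power of decay; `α > 1`
makes the tail integrable. -/
lemma abs_hardyStep_le {α C : ℝ} (hα : 1 < α) (ν : ℝ) {f : ℝ → ℝ}
    (hb : ∀ u, 0 ≤ u → |f u| ≤ C * max u 1 ^ (-α)) {u : ℝ} (hu : 0 ≤ u) :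
    |hardyStep ν f u| ≤ (4 * C + 2 * |ν| * (C * (1 + 1 / (α - 1)))) * max u 1 ^ (-(α - 1)) := by
  have hC : 0 ≤ C := by
    have := (abs_nonneg _).trans (hb 0 le_rfl)
    simpa using this
  have h1 : |4 * u * f u| ≤ 4 * (C * max u 1 ^ (1 - α)) := by
    rw [abs_mul, abs_of_nonneg (by positivity)]
    calc 4 * u * |f u| ≤ 4 * u * (C * max u 1 ^ (-α)) := by gcongr; exact hb u hu
      _ = 4 * (C * (u * max u 1 ^ (-α))) := by ring
      _ ≤ _ := by gcongr; exact mul_max_rpow_le α u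
  have h2 : |2 * ν * tailPrim f u| ≤
      2 * |ν| * (C * ((1 + 1 / (α - 1)) * max u 1 ^ (1 - α))) := by
    rw [abs_mul, abs_mul, abs_two]
    gcongr
    exact abs_tailPrim_le hα hb hu
  rw [show -(α - 1) = 1 - α by ring]
  calc |hardyStep ν f u| ≤ |4 * u * f u| + |2 * ν * tailPrim f u| := abs_add_le _ _
    _ ≤ _ := add_le_add h1 h2
    _ = _ := by ring

lemma DomConv.hardyStep {α C : ℝ} (hα : 1 < α) (ν : ℝ) {f : ℕ → ℝ → ℝ} {g : ℝ → ℝ}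
    (h : DomConv α C f g) :
    DomConv (α - 1) (4 * C + 2 * |ν| * (C * (1 + 1 / (α - 1))))
      (fun k => hardyStep ν (f k)) (hardyStep ν g) where
  meas k := ((measurable_const.mul measurable_id).mul (h.meas k)).add
    (measurable_const.mul (measurable_tailPrim (h.meas k)))
  meas_lim := ((measurable_const.mul measurable_id).mul h.meas_lim).add
    (measurable_const.mul (measurable_tailPrim h.meas_lim))
  bound k u hu := abs_hardyStep_le hα ν (h.bound k) hu
  bound_lim u hu := abs_hardyStep_le hα ν h.bound_lim hu
  tendsto u hu := by
    refine ((h.tendsto u hu).const_mul (4 * u)).add (Tendsto.const_mul (2 * ν) ?_)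
    refine Tendsto.neg (tendsto_integral_of_dominated_convergence
      (fun s => C * max s 1 ^ (-α)) (fun k => (h.meas k).aestronglyMeasurable)
      (((integrableOn_max_rpow hα).mono_set (Ioi_subset_Ioi hu)).const_mul C) (fun k => ?_) ?_)
    · filter_upwards [ae_restrict_mem measurableSet_Ioi] with s hs
      exact h.bound k s (hu.trans (le_of_lt hs))
    · filter_upwards [ae_restrict_mem measurableSet_Ioi] with s hs
      exact h.tendsto s (hu.trans (le_of_lt hs))

/-- `k` steps lower the exponent from `ν/2 + k` to `ν/2`. With `u = |x|²` and `ν = n` the surviving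
majorant is comparable to `(1+|x|)⁻ⁿ`, which is still square integrable. -/
lemma DomConv.ladder {ν : ℝ} (hν : 0 < ν) (k : ℕ) {C : ℝ} {f : ℕ → ℝ → ℝ} {g : ℝ → ℝ}
    (h : DomConv (ν / 2 + k) C f g) :
    ∃ C', DomConv (ν / 2) C' (fun j => ladder ν k (f j)) (ladder ν k g) := by
  induction k generalizing C f g with
  | zero => exact ⟨C, by simpa [HigherRiesz.ladder] using h⟩
  | succ k ih =>
    push_cast at h
    have h' := h.hardyStep (by have : (0 : ℝ) ≤ k := k.cast_nonneg
                               linarith) (ν + 4 * k)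
    rw [show ν / 2 + (k + 1) - 1 = ν / 2 + k by ring] at h'
    exact ih h'

/-! ### Power tails and the vanishing of the ladder beyond `u = 1` -/

lemma hardyStep_rpow {α c ν : ℝ} (hα : 1 < α) {g : ℝ → ℝ} (hg : ∀ u, 1 < u → g u = c * u ^ (-α))
    {u : ℝ} (hu : 1 < u) :
    hardyStep ν g u = c * (4 - 2 * ν / (α - 1)) * u ^ (-(α - 1)) := by
  have hα' : α - 1 ≠ 0 := by linarith
  have hu0 : 0 < u := one_pos.trans hu
  have hint : ∫ s in Ioi u, g s = c * (u ^ (-(α - 1)) / (α - 1)) := by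
    rw [setIntegral_congr_fun (g := fun s => c * s ^ (-α)) measurableSet_Ioi
      (fun s hs => hg s (hu.trans hs)), integral_const_mul,
      integral_Ioi_rpow_of_lt (by linarith) hu0,
      show -α + 1 = -(α - 1) by ring, div_neg, neg_div, neg_neg]
  have hpow : u ^ (-(α - 1)) = u * u ^ (-α) := by
    rw [show -(α - 1) = 1 + -α by ring, Real.rpow_add hu0, Real.rpow_one]
  rw [hardyStep, tailPrim, hint, hg u hu, hpow]
  field_simp
  ring

/-- Power tails are preserved by every step up to a factor. The last step acts with parameter `ν` on
the exponent `ν/2 + 1`, and its factor `4 - 2ν/(ν/2)` is zero; the earlier factors are irrelevant.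
-/
lemma ladder_vanish {ν : ℝ} (hν : 0 < ν) (k : ℕ) {c : ℝ} {g : ℝ → ℝ}
    (hg : ∀ u, 1 < u → g u = c * u ^ (-(ν / 2 + (k + 1)))) {u : ℝ} (hu : 1 < u) :
    ladder ν (k + 1) g u = 0 := by
  induction k generalizing c g with
  | zero =>
    have h := hardyStep_rpow (ν := ν) (by push_cast; linarith) hg hu
    simp only [ladder, CharP.cast_eq_zero, mul_zero, add_zero]
    rw [h]
    have : (4 : ℝ) - 2 * ν / (ν / 2 + ((0 : ℕ) + 1) - 1) = 0 := by
      have := hν.ne'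
      push_cast
      rw [zero_add, add_sub_cancel_right]
      field_simp
      ring
    rw [this]; ring
  | succ k ih =>
    have hk : (0 : ℝ) ≤ k := k.cast_nonneg
    rw [ladder]
    refine ih (c := c * (4 - 2 * (ν + 4 * ((k + 1 : ℕ) : ℝ)) /
      (ν / 2 + (((k + 1 : ℕ) : ℝ) + 1) - 1))) fun v hv => ?_
    rw [hardyStep_rpow (by push_cast; linarith) hg hv]
    push_cast
    congr 2
    ring

/-! ### The truncated power and its smooth approximations -/

/-- The radial profile of the truncated kernel. -/
def cutPower (α : ℝ) (u : ℝ) : ℝ := if 1 < u then u ^ (-α) else 0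

/-- Smooth approximations of `cutPower`. -/
def smoothCutPower (α : ℝ) (k : ℕ) (u : ℝ) : ℝ :=
  Real.smoothTransition ((k + 1) * (u - 1)) * Real.smoothTransition (k + 2 - u) * u ^ (-α)

lemma smoothCutPower_of_le (α : ℝ) (k : ℕ) {u : ℝ} (hu : u ≤ 1) : smoothCutPower α k u = 0 := by
  rw [smoothCutPower, Real.smoothTransition.zero_of_nonpos, zero_mul, zero_mul]
  have : (0 : ℝ) ≤ k + 1 := by positivity
  nlinarith

lemma isProfile_smoothCutPower (α : ℝ) (k : ℕ) : IsProfile (smoothCutPower α k) := by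
  -- The power is not smooth at `0`, but the cutoff vanishes identically for `u ≤ 1`, so it matters
  -- only for `u ≥ 1`.
  refine ⟨contDiff_iff_contDiffAt.2 fun u => ?_, k + 2, fun u hu => ?_⟩
  · rcases lt_or_ge u 1 with h | h
    · refine (contDiffAt_const (c := (0 : ℝ))).congr_of_eventuallyEq ?_
      filter_upwards [Iio_mem_nhds h] with v hv
      exact smoothCutPower_of_le α k (le_of_lt hv)
    · refine ContDiffAt.mul (ContDiff.contDiffAt ?_)
        (Real.contDiffAt_rpow_const_of_ne (by linarith))
      exact (Real.smoothTransition.contDiff.comp (by fun_prop)).mul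
        (Real.smoothTransition.contDiff.comp (by fun_prop))
  · rw [smoothCutPower, Real.smoothTransition.zero_of_nonpos (x := (k : ℝ) + 2 - u) (by linarith)]
    simp

lemma domConv_smoothCutPower (α : ℝ) :
    DomConv α 1 (smoothCutPower α) (cutPower α) where
  meas k := (isProfile_smoothCutPower α k).smooth.continuous.measurable
  meas_lim := Measurable.ite measurableSet_Ioi (by fun_prop) measurable_const
  bound k u hu := by
    rcases le_or_gt u 1 with h | h
    · rw [smoothCutPower_of_le α k h, abs_zero]; positivity
    · rw [max_eq_left h.le, smoothCutPower, abs_mul, abs_mul,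
        abs_of_nonneg (Real.smoothTransition.nonneg _),
        abs_of_nonneg (Real.smoothTransition.nonneg _), abs_of_nonneg (Real.rpow_nonneg hu _)]
      refine mul_le_mul_of_nonneg_right ?_ (Real.rpow_nonneg hu _)
      exact mul_le_one₀ (Real.smoothTransition.le_one _) (Real.smoothTransition.nonneg _)
        (Real.smoothTransition.le_one _)
  bound_lim u hu := by
    unfold cutPower
    split_ifs with h
    · rw [max_eq_left h.le, abs_of_nonneg (Real.rpow_nonneg hu _), one_mul]
    · rw [abs_zero]; positivity
  tendsto u hu := by
    unfold cutPower
    split_ifs with h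
    · refine tendsto_const_nhds.congr' ?_
      -- For `k` past this threshold both cutoffs equal `1` at `u`, so the sequence is eventually
      -- constant there.
      obtain ⟨K, hK⟩ := exists_nat_gt (max u (1 / (u - 1)))
      filter_upwards [eventually_ge_atTop K] with k hk
      have hk' : (K : ℝ) ≤ k := by exact_mod_cast hk
      have h1 : u ≤ k := ((le_max_left _ _).trans hK.le).trans hk'
      have h2 : 1 / (u - 1) ≤ k := ((le_max_right _ _).trans hK.le).trans hk'
      have hu1 : 0 < u - 1 := by linarith
      rw [div_le_iff₀ hu1] at h2
      rw [smoothCutPower, Real.smoothTransition.one_of_one_le (by nlinarith),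
        Real.smoothTransition.one_of_one_le (by linarith), one_mul, one_mul]
    · simp_rw [smoothCutPower_of_le α _ (not_lt.mp h)]
      exact tendsto_const_nhds

lemma ladder_cutPower_vanish {ν : ℝ} (hν : 0 < ν) {N : ℕ} (hN : 1 ≤ N) {u : ℝ} (hu : 1 < u) :
    ladder ν N (cutPower (ν / 2 + N)) u = 0 := by
  obtain ⟨k, rfl⟩ := Nat.exists_eq_add_of_le' hN
  refine ladder_vanish hν k (c := 1) (fun v hv => ?_) hu
  rw [cutPower, if_pos hv, one_mul]
  push_cast
  rfl

end

section

open scoped FourierTransform ContDiff SchwartzMap LineDeriv ComplexConjugate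

/-! ### Fourier multipliers on `L²` -/

section Multiplier

variable {E : Type*} [NormedAddCommGroup E] [InnerProductSpace ℝ E] [FiniteDimensional ℝ E]
  [MeasurableSpace E] [BorelSpace E]

lemma memLp_bounded_mul {m : E → ℝ} (hm : Measurable m) {A : ℝ} (hA : ∀ ξ, |m ξ| ≤ A)
    (f : Lp (α := E) ℂ 2) : MemLp (fun ξ => (m ξ : ℂ) * f ξ) 2 := by
  refine (Lp.memLp f).of_le_mul (c := A) ?_ (Eventually.of_forall fun ξ => ?_)
  · exact (Complex.measurable_ofReal.comp hm).aestronglyMeasurable.mul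
      (Lp.aestronglyMeasurable f)
  · rw [norm_mul, Complex.norm_real]
    exact mul_le_mul_of_nonneg_right (hA ξ) (norm_nonneg _)

/-- A real bounded measurable symbol defines a bounded self-adjoint Fourier multiplier. -/
theorem exists_multiplier_operator {m : E → ℝ} (hm : Measurable m) {A : ℝ}
    (hA : ∀ ξ, |m ξ| ≤ A) :
    ∃ S : Lp (α := E) ℂ 2 → Lp (α := E) ℂ 2,
      (∀ a g, inner ℂ (S a) g = inner ℂ a (S g)) ∧ (∀ g, ‖S g‖ ≤ A * ‖g‖) ∧
      ∀ u v : 𝓢(E, ℂ), (∀ᵐ ξ, 𝓕 (u : E → ℂ) ξ = m ξ * 𝓕 (v : E → ℂ) ξ) →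
        u.toLp 2 = S (v.toLp 2) := by
  let M : Lp (α := E) ℂ 2 → Lp (α := E) ℂ 2 := fun f => (memLp_bounded_mul hm hA f).toLp _
  have hM : ∀ f, M f =ᵐ[volume] fun ξ => (m ξ : ℂ) * f ξ := fun f => MemLp.coeFn_toLp _
  refine ⟨fun g => 𝓕⁻ (M (𝓕 g)), fun a g => ?_, fun g => ?_, fun u v huv => ?_⟩
  · rw [← Lp.inner_fourier_eq, ← Lp.inner_fourier_eq a, FourierTransform.fourier_fourierInv_eq,
      FourierTransform.fourier_fourierInv_eq, L2.inner_def, L2.inner_def]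
    refine integral_congr_ae ?_
    filter_upwards [hM (𝓕 a), hM (𝓕 g)] with ξ h1 h2
    rw [h1, h2]
    simp only [RCLike.inner_apply, map_mul, Complex.conj_ofReal]
    ring
  · rw [← Lp.norm_fourier_eq, FourierTransform.fourier_fourierInv_eq, ← Lp.norm_fourier_eq g]
    refine Lp.norm_le_mul_norm_of_ae_le_mul ?_
    filter_upwards [hM (𝓕 g)] with ξ h
    rw [h, norm_mul, Complex.norm_real]
    exact mul_le_mul_of_nonneg_right (hA ξ) (norm_nonneg _)
  · have h : 𝓕 (u.toLp 2) = M (𝓕 (v.toLp 2)) := by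
      refine Lp.ext ?_
      have hu : ((𝓕 (u.toLp 2) : Lp (α := E) ℂ 2) : E → ℂ) =ᵐ[volume] 𝓕 (u : E → ℂ) := by
        rw [SchwartzMap.toLp_fourier_eq]
        exact (SchwartzMap.coeFn_toLp (𝓕 u) 2).trans (by rw [SchwartzMap.fourier_coe])
      have hv : ((𝓕 (v.toLp 2) : Lp (α := E) ℂ 2) : E → ℂ) =ᵐ[volume] 𝓕 (v : E → ℂ) := by
        rw [SchwartzMap.toLp_fourier_eq]
        exact (SchwartzMap.coeFn_toLp (𝓕 v) 2).trans (by rw [SchwartzMap.fourier_coe])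
      filter_upwards [hu, hv, hM (𝓕 (v.toLp 2)), huv] with ξ h1 h2 h3 h4
      rw [h1, h3, h4, h2]
    have h2 : (𝓕⁻ (𝓕 (u.toLp 2) : Lp (α := E) ℂ 2) : Lp (α := E) ℂ 2) = u.toLp 2 :=
      FourierTransform.fourierInv_fourier_eq _
    exact h2.symm.trans (congrArg (fun f : Lp (α := E) ℂ 2 => (𝓕⁻ f : Lp (α := E) ℂ 2)) h)

/-- The prefactor does not depend on `f`; hence a multiplier relation between two functions survives
the same affine change of variables, up to evaluating the symbol at `-εξ`. -/
lemma fourier_comp_affine (f : E → ℂ) (x : E) {ε : ℝ} (hε : 0 < ε) (ξ : E) :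
    𝓕 (fun y => f (ε⁻¹ • (x - y))) ξ =
      (ε ^ Module.finrank ℝ E * ((Real.fourierChar (-(inner ℝ x ξ)) : Circle) : ℂ)) * 𝓕 f (-(ε • ξ)) := by
  simp only [Real.fourier_eq]
  have h0 : ∫ y, Real.fourierChar (-inner ℝ y ξ) • f (ε⁻¹ • (x - y)) =
      ∫ z, Real.fourierChar (-inner ℝ (x - z) ξ) • f (ε⁻¹ • (x - (x - z))) :=
    (integral_sub_left_eq_self (fun v : E => Real.fourierChar (-inner ℝ v ξ) •
      f (ε⁻¹ • (x - v))) (volume : Measure E) x).symm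
  have h : ∀ z : E, Real.fourierChar (-inner ℝ (x - z) ξ) • f (ε⁻¹ • (x - (x - z))) =
      (fun y : E => Real.fourierChar (-inner ℝ (x - ε • y) ξ) • f y) (ε⁻¹ • z) := fun z => by
    simp [smul_inv_smul₀ hε.ne']
  refine h0.trans ?_
  refine (integral_congr_ae (Eventually.of_forall h)).trans ?_
  refine (Measure.integral_comp_inv_smul_of_nonneg (volume : Measure E)
    (fun y : E => Real.fourierChar (-inner ℝ (x - ε • y) ξ) • f y) hε.le).trans ?_
  rw [Complex.real_smul, mul_assoc]
  push_cast
  congr 1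
  rw [← integral_const_mul]
  refine integral_congr_ae (Eventually.of_forall fun y => ?_)
  simp only [Circle.smul_def, smul_eq_mul]
  rw [← mul_assoc, ← Circle.coe_mul, ← AddChar.map_add_eq_mul]
  congr 4
  rw [inner_sub_left, inner_smul_left, inner_neg_right, inner_smul_right]
  simp
  ring

end Multiplier

/-! ### Size estimates -/

section Size

variable {n : ℕ}

/-- The weight `(1 + |x|)^(-n)`. -/
def weight (x : EuclideanSpace ℝ (Fin n)) : ℝ := ((1 + ‖x‖) ^ n)⁻¹

lemma weight_pos (x : EuclideanSpace ℝ (Fin n)) : 0 < weight x := by unfold weight; positivity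

lemma measurable_weight : Measurable (weight (n := n)) := by unfold weight; fun_prop

lemma weight_le_one (x : EuclideanSpace ℝ (Fin n)) : weight x ≤ 1 :=
  inv_le_one_of_one_le₀ (one_le_pow₀ (by linarith [norm_nonneg x]))

lemma memLp_weight (hn : 1 ≤ n) {q : ℝ≥0∞} (hq : 1 < q) :
    MemLp (weight (n := n)) q := by
  rcases eq_or_ne q ∞ with rfl | hq'
  · exact memLp_top_of_bound measurable_weight.aestronglyMeasurable 1
      (Eventually.of_forall fun x => by
        rw [Real.norm_eq_abs, abs_of_pos (weight_pos x)]; exact weight_le_one x)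
  · rw [← integrable_norm_rpow_iff measurable_weight.aestronglyMeasurable
      (zero_lt_one.trans hq).ne' hq']
    have hq1 : 1 < q.toReal := by
      rw [← ENNReal.toReal_one]
      exact (ENNReal.toReal_lt_toReal ENNReal.one_ne_top hq').2 hq
    have hr : (Module.finrank ℝ (EuclideanSpace ℝ (Fin n)) : ℝ) < n * q.toReal := by
      rw [finrank_euclideanSpace_fin]
      have : (1 : ℝ) ≤ n := by exact_mod_cast hn
      nlinarith
    refine (integrable_one_add_norm hr).congr (Eventually.of_forall fun x => ?_)
    have h0 : (0 : ℝ) < 1 + ‖x‖ := by positivity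
    simp only [Real.norm_eq_abs, abs_of_pos (weight_pos x)]
    rw [weight, ← Real.rpow_natCast, ← Real.rpow_neg h0.le, ← Real.rpow_mul h0.le, neg_mul]

/-- Decay like `weight` is stable under `y ↦ ε⁻¹(x - y)`, so one fixed weight dominates all the
translated and dilated kernels, with a constant depending on `x` and `ε`. -/
lemma weight_affine_le (x y : EuclideanSpace ℝ (Fin n)) {ε : ℝ} (hε : 0 < ε) :
    weight (ε⁻¹ • (x - y)) ≤ (1 + ‖x‖ + ε) ^ n * weight y := by
  unfold weight
  have h1 : 0 < (1 + ‖ε⁻¹ • (x - y)‖) ^ n := by positivity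
  have h2 : 0 < (1 + ‖y‖) ^ n := by positivity
  rw [inv_le_iff_one_le_mul₀ h1, mul_assoc, mul_comm, mul_assoc, inv_mul_eq_div,
    one_le_div h2, ← mul_pow]
  refine pow_le_pow_left₀ (by positivity) ?_ n
  have h3 : ‖y‖ ≤ ‖x‖ + ε * ‖ε⁻¹ • (x - y)‖ := by
    rw [norm_smul, norm_inv, Real.norm_of_nonneg hε.le, mul_inv_cancel_left₀ hε.ne']
    have := norm_sub_norm_le y x
    rw [norm_sub_rev] at this
    linarith
  nlinarith [norm_nonneg x, norm_nonneg (ε⁻¹ • (x - y)),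
    mul_nonneg (norm_nonneg x) (norm_nonneg (ε⁻¹ • (x - y)))]

/-- Compactness of the unit ball together with homogeneity. -/
lemma exists_polyEval_bound {p : MvPolynomial (Fin n) ℝ} {d : ℕ} (hp : p.IsHomogeneous d) :
    ∃ A, 0 ≤ A ∧ ∀ x : EuclideanSpace ℝ (Fin n), |polyEval p x| ≤ A * ‖x‖ ^ d := by
  obtain ⟨A, hA⟩ := (isCompact_closedBall (0 : EuclideanSpace ℝ (Fin n)) 1).exists_bound_of_continuousOn
    (continuous_polyEval p).continuousOn
  refine ⟨A, (norm_nonneg _).trans (hA 0 (by simp)), fun x => ?_⟩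
  have hx : x = ‖x‖ • (‖x‖⁻¹ • x) := by
    rcases eq_or_ne x 0 with rfl | h
    · simp
    · rw [smul_inv_smul₀ (norm_ne_zero_iff.2 h)]
  conv_lhs => rw [hx]
  rw [polyEval_smul hp, abs_mul, abs_pow, abs_norm, mul_comm]
  refine mul_le_mul_of_nonneg_right (hA _ ?_) (by positivity)
  rw [mem_closedBall_zero_iff, norm_smul, norm_inv, norm_norm]
  exact inv_mul_le_one

lemma max_sq_rpow_le (r : ℝ) (hr : 0 ≤ r) :
    max (r ^ 2) 1 ^ (-((n : ℝ) / 2)) ≤ 2 ^ n * ((1 + r) ^ n)⁻¹ := by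
  have hM : 0 < max r 1 := lt_max_of_lt_right one_pos
  have h1 : max (r ^ 2) 1 = max r 1 ^ (2 : ℝ) := by
    rw [Real.rpow_two]
    rcases le_total r 1 with h | h
    · rw [max_eq_right h, max_eq_right (by nlinarith), one_pow]
    · rw [max_eq_left h, max_eq_left (by nlinarith)]
  rw [h1, ← Real.rpow_mul hM.le, show (2 : ℝ) * -((n : ℝ) / 2) = -n by ring,
    Real.rpow_neg hM.le, Real.rpow_natCast]
  have h2 : (1 + r) ^ n ≤ 2 ^ n * max r 1 ^ n := by
    rw [← mul_pow]
    refine pow_le_pow_left₀ (by linarith) ?_ n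
    linarith [le_max_left r 1, le_max_right r 1]
  rw [← div_eq_mul_inv, le_div_iff₀ (by positivity), inv_mul_le_iff₀ (by positivity), mul_comm]
  exact h2

end Size

/-! ### The truncated kernel -/

section Cut

variable {n : ℕ} {F : Type*} [NormedAddCommGroup F] [NormedSpace ℝ F]

/-- The kernel restricted to the complement of the closed ball of radius `ε`. -/
def cutKernel (d : ℕ) (P : MvPolynomial (Fin n) ℝ) (ε : ℝ) (w : EuclideanSpace ℝ (Fin n)) : ℝ :=
  if ε < ‖w‖ then kernel d P w else 0

lemma truncated_eq (d : ℕ) (P : MvPolynomial (Fin n) ℝ) (ε : ℝ)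
    (f : EuclideanSpace ℝ (Fin n) → F) (x : EuclideanSpace ℝ (Fin n)) :
    truncated d P ε f x = ∫ y, cutKernel d P ε (x - y) • f y := by
  rw [truncated, ← integral_indicator (measurableSet_lt measurable_const measurable_norm),
    ← integral_sub_left_eq_self _ volume x]
  congr 1
  ext y
  simp only [indicator, mem_ofPred_eq, cutKernel, sub_sub_cancel]
  split_ifs <;> simp

lemma kernel_eq (d : ℕ) (P : MvPolynomial (Fin n) ℝ) (x : EuclideanSpace ℝ (Fin n)) :
    kernel d P x = polyEval P x / ‖x‖ ^ (n + d) := rfl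

lemma kernel_smul {d : ℕ} {P : MvPolynomial (Fin n) ℝ} (hP : P.IsHomogeneous d) {t : ℝ}
    (ht : 0 < t) (x : EuclideanSpace ℝ (Fin n)) :
    kernel d P (t • x) = (t ^ n)⁻¹ * kernel d P x := by
  rw [kernel_eq, kernel_eq, polyEval_smul hP, norm_smul, Real.norm_of_nonneg ht.le, mul_pow,
    pow_add t]
  field_simp

lemma cutKernel_scale {d : ℕ} {P : MvPolynomial (Fin n) ℝ} (hP : P.IsHomogeneous d) {ε : ℝ}
    (hε : 0 < ε) (w : EuclideanSpace ℝ (Fin n)) :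
    cutKernel d P ε w = (ε ^ n)⁻¹ * cutKernel d P 1 (ε⁻¹ • w) := by
  unfold cutKernel
  have h : 1 < ‖ε⁻¹ • w‖ ↔ ε < ‖w‖ := by
    rw [norm_smul, norm_inv, Real.norm_of_nonneg hε.le, inv_mul_eq_div, one_lt_div hε]
  rw [kernel_smul hP (inv_pos.2 hε)]
  simp only [h]
  split_ifs
  · rw [inv_pow, inv_inv, inv_mul_cancel_left₀ (pow_pos hε _).ne']
  · simp

lemma measurable_kernel (d : ℕ) (P : MvPolynomial (Fin n) ℝ) : Measurable (kernel d P) :=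
  (continuous_polyEval P).measurable.div (measurable_norm.pow_const _)

lemma measurable_cutKernel (d : ℕ) (P : MvPolynomial (Fin n) ℝ) (ε : ℝ) :
    Measurable (cutKernel d P ε) :=
  Measurable.ite (measurableSet_lt measurable_const measurable_norm) (measurable_kernel d P)
    measurable_const

lemma exists_kernel_bound {d : ℕ} {P : MvPolynomial (Fin n) ℝ} (hP : P.IsHomogeneous d) :
    ∃ A, 0 ≤ A ∧ ∀ x, |kernel d P x| ≤ A * (‖x‖ ^ n)⁻¹ := by
  obtain ⟨A, hA0, hA⟩ := exists_polyEval_bound hP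
  refine ⟨A, hA0, fun x => ?_⟩
  rcases (norm_nonneg x).eq_or_lt with h | h
  -- At the origin, division by zero makes the kernel `0`, except when `n + d = 0`, where it is the
  -- constant polynomial.
  · rcases Nat.eq_zero_or_pos (n + d) with h0 | h0
    · have hx := hA x
      have hn0 : n = 0 := by omega
      have hd0 : d = 0 := by omega
      rw [kernel_eq, h0]
      rw [hd0] at hx
      subst hn0
      simpa using hx
    · rw [kernel_eq, ← h, zero_pow h0.ne', div_zero, abs_zero]
      positivity
  · rw [kernel_eq, abs_div, abs_of_pos (pow_pos h _), div_le_iff₀ (pow_pos h _), pow_add]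
    refine (hA x).trans (le_of_eq ?_)
    field_simp

/-- The exponent `-(n/2 + N)` of `|z|²` is the exponent `-(n + 2N)` of `|z|`. -/
lemma radialPoly_cutPower (N : ℕ) (P : MvPolynomial (Fin n) ℝ) (z : EuclideanSpace ℝ (Fin n)) :
    radialPoly (cutPower ((n : ℝ) / 2 + N)) P z = (cutKernel (2 * N) P 1 z : ℂ) := by
  unfold radialPoly cutPower cutKernel
  have h : 1 < ‖z‖ ^ 2 ↔ 1 < ‖z‖ := one_lt_sq_iff₀ (norm_nonneg z)
  simp only [h]
  split_ifs with h1
  · congr 1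
    have hz : 0 ≤ ‖z‖ := norm_nonneg z
    rw [kernel_eq, div_eq_mul_inv (polyEval P z), mul_comm, ← Real.rpow_natCast ‖z‖ 2, ← Real.rpow_mul hz,
      show ((2 : ℕ) : ℝ) * -((n : ℝ) / 2 + N) = -((n + 2 * N : ℕ) : ℝ) by push_cast; ring,
      Real.rpow_neg hz, Real.rpow_natCast]
  · simp

end Cut

end

section

open scoped FourierTransform ContDiff SchwartzMap LineDeriv ComplexConjugate

/-! ### The transform on `L²` and its reproducing formula -/

section L2

variable {n : ℕ}

lemma memLp_affine (hn : 1 ≤ n) {q : ℝ≥0∞} (hq : 1 < q) {G : Type*} [NormedAddCommGroup G]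
    [MeasurableSpace G] [BorelSpace G] [SecondCountableTopology G]
    {f : EuclideanSpace ℝ (Fin n) → G} (hf : Measurable f) {C : ℝ}
    (hC : ∀ z, ‖f z‖ ≤ C * weight z) (x : EuclideanSpace ℝ (Fin n)) {ε : ℝ} (hε : 0 < ε) :
    MemLp (fun y => f (ε⁻¹ • (x - y))) q := by
  have hC0 : 0 ≤ C := nonneg_of_mul_nonneg_left ((norm_nonneg _).trans (hC 0)) (weight_pos 0)
  refine (memLp_weight hn hq).of_le_mul (c := C * (1 + ‖x‖ + ε) ^ n)
    (hf.comp (by fun_prop)).aestronglyMeasurable (Eventually.of_forall fun y => ?_)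
  rw [Real.norm_of_nonneg (weight_pos y).le, mul_assoc]
  exact (hC _).trans (mul_le_mul_of_nonneg_left (weight_affine_le x y hε) hC0)

/-- Dominated convergence with majorant `weight · |g|`, integrable because `weight` lies in `L²`. It
transfers the pairing identity from smooth profiles to the truncated power. -/
lemma tendsto_integral_affine_mul (hn : 1 ≤ n) {f : ℕ → EuclideanSpace ℝ (Fin n) → ℂ}
    {f' : EuclideanSpace ℝ (Fin n) → ℂ} (hf : ∀ k, Measurable (f k)) {C : ℝ}
    (hC : ∀ k z, ‖f k z‖ ≤ C * weight z)
    (hlim : ∀ z, Tendsto (fun k => f k z) atTop (𝓝 (f' z))) (x : EuclideanSpace ℝ (Fin n))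
    {ε : ℝ} (hε : 0 < ε) {g : EuclideanSpace ℝ (Fin n) → ℂ} (hg : MemLp g 2) :
    Tendsto (fun k => ∫ y, conj (f k (ε⁻¹ • (x - y))) * g y) atTop
      (𝓝 (∫ y, conj (f' (ε⁻¹ • (x - y))) * g y)) := by
  have hw : MemLp (fun y : EuclideanSpace ℝ (Fin n) => C * weight (ε⁻¹ • (x - y))) 2 := by
    refine memLp_affine hn (by norm_num) (f := fun z => C * weight z)
      (measurable_weight.const_mul C) (C := |C|) (fun z => ?_) x hε
    rw [norm_mul, Real.norm_eq_abs, Real.norm_of_nonneg (weight_pos z).le]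
  refine tendsto_integral_of_dominated_convergence
    (fun y => C * weight (ε⁻¹ • (x - y)) * ‖g y‖) (fun k => ?_) ?_ (fun k => ?_) ?_
  · refine AEStronglyMeasurable.mul (Measurable.aestronglyMeasurable ?_) hg.1
    exact Complex.continuous_conj.measurable.comp ((hf k).comp (by fun_prop))
  · exact hw.integrable_mul hg.norm
  · refine Eventually.of_forall fun y => ?_
    rw [norm_mul, RCLike.norm_conj]
    exact mul_le_mul_of_nonneg_right (hC k _) (norm_nonneg _)
  · refine Eventually.of_forall fun y => ?_
    exact ((Complex.continuous_conj.tendsto _).comp (hlim _)).mul_const _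

/-- The symbol of the Fourier multiplier. -/
def symbol (N : ℕ) (P : MvPolynomial (Fin n) ℝ) (ξ : EuclideanSpace ℝ (Fin n)) : ℝ :=
  polyEval P ξ / (2 ^ (2 * N) * ‖ξ‖ ^ (2 * N))

lemma measurable_symbol (N : ℕ) (P : MvPolynomial (Fin n) ℝ) : Measurable (symbol N P) :=
  (continuous_polyEval P).measurable.div ((measurable_norm.pow_const _).const_mul _)

lemma exists_symbol_bound {N : ℕ} {P : MvPolynomial (Fin n) ℝ} (hP : P.IsHomogeneous (2 * N)) :
    ∃ A, 0 ≤ A ∧ ∀ ξ, |symbol N P ξ| ≤ A := by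
  obtain ⟨A, hA0, hA⟩ := exists_polyEval_bound hP
  refine ⟨A, hA0, fun ξ => ?_⟩
  rw [symbol, abs_div, abs_of_nonneg (by positivity : (0 : ℝ) ≤ 2 ^ (2 * N) * ‖ξ‖ ^ (2 * N))]
  refine div_le_of_le_mul₀ (by positivity) hA0 ((hA ξ).trans ?_)
  refine mul_le_mul_of_nonneg_left ?_ hA0
  exact le_mul_of_one_le_left (by positivity) (one_le_pow₀ one_le_two)

/-- Negative `t` is allowed because the degree is even; the reflection in `ε⁻¹(x - y)` requires it.
-/
lemma symbol_smul {N : ℕ} {P : MvPolynomial (Fin n) ℝ} (hP : P.IsHomogeneous (2 * N)) {t : ℝ}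
    (ht : t ≠ 0) (ξ : EuclideanSpace ℝ (Fin n)) : symbol N P (t • ξ) = symbol N P ξ := by
  rw [symbol, symbol, polyEval_smul hP, norm_smul, mul_pow, Real.norm_eq_abs, pow_mul |t|, sq_abs,
    ← pow_mul, mul_left_comm, mul_div_mul_left _ _ (pow_ne_zero _ ht)]

/-- The radial profile of the bump function, evaluated at `|z|²` and cut to the unit ball. -/
def ladderBump (n N : ℕ) : EuclideanSpace ℝ (Fin n) → ℝ :=
  (Metric.ball 0 1).indicator fun z => ladder n N (cutPower ((n : ℝ) / 2 + N)) (‖z‖ ^ 2)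

/-- The affine pull-back of a smooth compactly supported function, as a Schwartz function. -/
def affineSchwartz {f : EuclideanSpace ℝ (Fin n) → ℂ} (hf : ContDiff ℝ ∞ f)
    (hc : HasCompactSupport f) (x : EuclideanSpace ℝ (Fin n)) {ε : ℝ} (hε : 0 < ε) :
    𝓢(EuclideanSpace ℝ (Fin n), ℂ) :=
  HasCompactSupport.toSchwartzMap (f := fun y => f (ε⁻¹ • (x - y)))
    (hc.comp_isClosedEmbedding ((Homeomorph.subLeft x).trans
      (Homeomorph.smulOfNeZero ε⁻¹ (inv_ne_zero hε.ne'))).isClosedEmbedding)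
    (hf.comp (by fun_prop))

lemma coe_affineSchwartz {f : EuclideanSpace ℝ (Fin n) → ℂ} (hf : ContDiff ℝ ∞ f)
    (hc : HasCompactSupport f) (x : EuclideanSpace ℝ (Fin n)) {ε : ℝ} (hε : 0 < ε) :
    ⇑(affineSchwartz hf hc x hε) = fun y => f (ε⁻¹ • (x - y)) := rfl

/-- The symbol is invariant under `ξ ↦ -εξ`, so one symbol serves every centre and scale. The
origin, where the quotient is meaningless, is a null set. -/
lemma fourier_affine_symbol (hn : 1 ≤ n) {N : ℕ} {P : MvPolynomial (Fin n) ℝ}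
    (hP : P.IsHomogeneous (2 * N)) (hharm : IsHarmonicPoly P) {w : ℝ → ℝ} (hw : IsProfile w)
    (x : EuclideanSpace ℝ (Fin n)) {ε : ℝ} (hε : 0 < ε) :
    ∀ᵐ ξ, 𝓕 (fun y => radialPoly w P (ε⁻¹ • (x - y))) ξ = symbol N P ξ *
      𝓕 (fun y => radialPoly (ladder n N w) (1 : MvPolynomial (Fin n) ℝ) (ε⁻¹ • (x - y))) ξ := by
  have : Nontrivial (EuclideanSpace ℝ (Fin n)) :=
    Module.nontrivial_of_finrank_pos (R := ℝ) (by rw [finrank_euclideanSpace_fin]; omega)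
  have h0 : ∀ᵐ ξ : EuclideanSpace ℝ (Fin n), ξ ≠ 0 := by
    simp [ae_iff, measure_singleton]
  filter_upwards [h0] with ξ hξ
  rw [fourier_comp_affine _ x hε, fourier_comp_affine _ x hε]
  have hid := fourier_multiplier_identity hP hharm hw (-(ε • ξ))
  have hs : symbol N P (-(ε • ξ)) = symbol N P ξ := by
    rw [← neg_smul]; exact symbol_smul hP (neg_ne_zero.2 hε.ne') ξ
  have hne : ((2 : ℂ) ^ (2 * N) * (‖-(ε • ξ)‖ : ℂ) ^ (2 * N)) ≠ 0 := by
    have : ‖-(ε • ξ)‖ ≠ 0 := by simpa [hε.ne'] using hξ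
    have : ((‖-(ε • ξ)‖ : ℝ) : ℂ) ≠ 0 := by exact_mod_cast this
    exact mul_ne_zero (pow_ne_zero _ two_ne_zero) (pow_ne_zero _ this)
  have hid2 : 𝓕 (radialPoly w P) (-(ε • ξ)) = symbol N P ξ *
      𝓕 (radialPoly (ladder n N w) (1 : MvPolynomial (Fin n) ℝ)) (-(ε • ξ)) := by
    apply mul_left_cancel₀ hne
    rw [hid, ← hs, symbol]
    push_cast
    rw [div_mul_eq_mul_div, mul_div_cancel₀ _ hne]
  rw [hid2]
  ring

/-- The growth `|z|^(2N)` of the polynomial uses up `N` of the powers of decay. Applied to `P`, and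
with `N = 0` to the constant polynomial `1`. -/
lemma norm_radialPoly_le {w : ℝ → ℝ} {C : ℝ} {N : ℕ}
    (hw : ∀ u, 0 ≤ u → |w u| ≤ C * max u 1 ^ (-((n : ℝ) / 2 + N)))
    {p : MvPolynomial (Fin n) ℝ} {A : ℝ} (hA0 : 0 ≤ A)
    (hA : ∀ x : EuclideanSpace ℝ (Fin n), |polyEval p x| ≤ A * ‖x‖ ^ (2 * N))
    (z : EuclideanSpace ℝ (Fin n)) :
    ‖radialPoly w p z‖ ≤ C * A * 2 ^ n * weight z := by
  have hC : 0 ≤ C := by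
    have := (abs_nonneg _).trans (hw 0 le_rfl)
    simpa using this
  have hM : 0 < max (‖z‖ ^ 2) 1 := lt_max_of_lt_right one_pos
  rw [radialPoly, Complex.norm_real, Real.norm_eq_abs, abs_mul]
  have h1 : ‖z‖ ^ (2 * N) ≤ max (‖z‖ ^ 2) 1 ^ (N : ℝ) := by
    rw [pow_mul, Real.rpow_natCast]
    exact pow_le_pow_left₀ (by positivity) (le_max_left _ _) N
  calc |w (‖z‖ ^ 2)| * |polyEval p z|
      ≤ (C * max (‖z‖ ^ 2) 1 ^ (-((n : ℝ) / 2 + N))) * (A * max (‖z‖ ^ 2) 1 ^ (N : ℝ)) := by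
        refine mul_le_mul (hw _ (by positivity))
          ((hA z).trans (mul_le_mul_of_nonneg_left h1 hA0)) (abs_nonneg _) (by positivity)
    _ = C * A * max (‖z‖ ^ 2) 1 ^ (-((n : ℝ) / 2)) := by
        rw [show -((n : ℝ) / 2) = -((n : ℝ) / 2 + N) + N by ring, Real.rpow_add hM]
        ring
    _ ≤ C * A * (2 ^ n * weight z) :=
        mul_le_mul_of_nonneg_left (max_sq_rpow_le ‖z‖ (norm_nonneg _)) (by positivity)
    _ = _ := by ring

lemma measurable_radialPoly {w : ℝ → ℝ} (hw : Measurable w) (p : MvPolynomial (Fin n) ℝ) :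
    Measurable (radialPoly w p) :=
  Complex.measurable_ofReal.comp
    ((hw.comp (measurable_norm.pow_const 2)).mul (continuous_polyEval p).measurable)

/-- `h` is the transform of `g`, with bump `b` and operator bound `A`. -/
structure IsTransform (N : ℕ) (P : MvPolynomial (Fin n) ℝ)
    (b : EuclideanSpace ℝ (Fin n) → ℝ) (A : ℝ≥0) (g h : EuclideanSpace ℝ (Fin n) → ℝ) : Prop where
  memLp : MemLp h 2
  bound : eLpNorm h 2 ≤ A * eLpNorm g 2
  rep : ∀ x, ∀ ε > 0,
    truncated (2 * N) P ε g x = (ε ^ n)⁻¹ * ∫ y, b (ε⁻¹ • (x - y)) * h y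

/-- The ladder profile is known to vanish only for `|z| > 1`; the unit sphere, where the two sides
may differ, is null. -/
lemma radialPoly_ladder_eq_bump {N : ℕ} (hn : 1 ≤ n) (hN : 1 ≤ N) :
    ∀ᵐ z : EuclideanSpace ℝ (Fin n),
      radialPoly (ladder n N (cutPower ((n : ℝ) / 2 + N))) (1 : MvPolynomial (Fin n) ℝ) z =
        (ladderBump n N z : ℂ) := by
  have : Nontrivial (EuclideanSpace ℝ (Fin n)) :=
    Module.nontrivial_of_finrank_pos (R := ℝ) (by rw [finrank_euclideanSpace_fin]; omega)
  have h0 : ∀ᵐ z : EuclideanSpace ℝ (Fin n), z ∉ Metric.sphere 0 1 :=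
    measure_eq_zero_iff_ae_notMem.1 (Measure.addHaar_sphere volume 0 1)
  filter_upwards [h0] with z hz
  rw [mem_sphere_zero_iff_norm] at hz
  simp only [radialPoly, polyEval_one, mul_one, ladderBump, indicator, mem_ball_zero_iff]
  split_ifs with h
  · rfl
  · rw [ladder_cutPower_vanish (by exact_mod_cast hn) hN]
    exact (one_lt_sq_iff₀ (norm_nonneg z)).2 (lt_of_le_of_ne (not_lt.1 h) (Ne.symm hz))

theorem exists_L2_transform (hn : 1 ≤ n) {N : ℕ} (hN : 1 ≤ N) {P : MvPolynomial (Fin n) ℝ}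
    (hP : P.IsHomogeneous (2 * N)) (hharm : IsHarmonicPoly P) :
    ∃ b : EuclideanSpace ℝ (Fin n) → ℝ, Measurable b ∧ (∃ B, ∀ x, |b x| ≤ B) ∧
      Function.support b ⊆ Metric.ball 0 1 ∧ ∃ A : ℝ≥0,
      (∀ g, MemLp g 2 → ∃ h, IsTransform N P b A g h) ∧
      IsTransform N P b A b (cutKernel (2 * N) P 1) := by
  have hν : (0 : ℝ) < n := by exact_mod_cast hn
  set α : ℝ := (n : ℝ) / 2 + N with hα
  have hd1 : DomConv ((n : ℝ) / 2 + N) 1 (smoothCutPower α) (cutPower α) :=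
    domConv_smoothCutPower α
  obtain ⟨C, hd2⟩ := hd1.ladder hν N
  obtain ⟨A₁, hA₁0, hA₁⟩ := exists_polyEval_bound hP
  obtain ⟨A, hA0, hA⟩ := exists_symbol_bound hP
  have hprof := isProfile_smoothCutPower α
  have hone : ∀ x : EuclideanSpace ℝ (Fin n),
      |polyEval (1 : MvPolynomial (Fin n) ℝ) x| ≤ 1 * ‖x‖ ^ (2 * 0) := by simp [polyEval_one]
  have hd2b : ∀ k, ∀ u, 0 ≤ u → |ladder n N (smoothCutPower α k) u| ≤
      C * max u 1 ^ (-((n : ℝ) / 2 + (0 : ℕ))) := by simpa using hd2.bound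
  have hd2l : ∀ u, 0 ≤ u → |ladder n N (cutPower α) u| ≤
      C * max u 1 ^ (-((n : ℝ) / 2 + (0 : ℕ))) := by simpa using hd2.bound_lim
  -- the limiting functions
  have hcut_le : ∀ z, ‖(cutKernel (2 * N) P 1 z : ℂ)‖ ≤ 1 * A₁ * 2 ^ n * weight z := fun z => by
    rw [← radialPoly_cutPower]
    exact norm_radialPoly_le hd1.bound_lim hA₁0 hA₁ z
  have hbump_le : ∀ z : EuclideanSpace ℝ (Fin n),
      ‖(ladderBump n N z : ℂ)‖ ≤ C * 1 * 2 ^ n * weight z := fun z => by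
    rw [Complex.norm_real]
    unfold ladderBump
    refine (norm_indicator_le_norm_self _ z).trans ?_
    have h := norm_radialPoly_le hd2l zero_le_one hone z
    simpa [radialPoly, polyEval_one, abs_mul] using h
  have hbump_meas : Measurable (ladderBump n N) :=
    (hd2.meas_lim.comp (measurable_norm.pow_const 2)).indicator measurableSet_ball
  obtain ⟨S, hSadj, hSb, hSpair⟩ := exists_multiplier_operator (measurable_symbol N P) hA
  -- the basic pairing identity
  have hpair : ∀ (x : EuclideanSpace ℝ (Fin n)) (ε : ℝ), 0 < ε →
      ∀ g : Lp (α := EuclideanSpace ℝ (Fin n)) ℂ 2,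
      ∫ y, (cutKernel (2 * N) P 1 (ε⁻¹ • (x - y)) : ℂ) * g y =
        ∫ y, (ladderBump n N (ε⁻¹ • (x - y)) : ℂ) * (S g) y := by
    intro x ε hε g
    -- For smooth profiles both functions are Schwartz, and the identity is self-adjointness of `S`.
    -- The limit `k → ∞` follows below.
    have hk : ∀ k, ∫ y, conj (radialPoly (smoothCutPower α k) P (ε⁻¹ • (x - y))) * g y =
        ∫ y, conj (radialPoly (ladder n N (smoothCutPower α k))
          (1 : MvPolynomial (Fin n) ℝ) (ε⁻¹ • (x - y))) * (S g) y := by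
      intro k
      have hl := (hprof k).ladder n N
      have hp := hSpair
        (affineSchwartz (contDiff_radialPoly (hprof k) P)
          (hasCompactSupport_radialPoly (hprof k) P) x hε)
        (affineSchwartz (contDiff_radialPoly hl (1 : MvPolynomial (Fin n) ℝ))
          (hasCompactSupport_radialPoly hl (1 : MvPolynomial (Fin n) ℝ)) x hε)
        (fourier_affine_symbol hn hP hharm (hprof k) x hε)
      have hi := congrArg (fun f => inner ℂ f g) hp
      simp only [hSadj] at hi
      rw [L2.inner_def, L2.inner_def] at hi
      calc _ = _ := integral_congr_ae ?_
        _ = _ := hi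
        _ = _ := integral_congr_ae ?_
      · filter_upwards [SchwartzMap.coeFn_toLp (affineSchwartz (contDiff_radialPoly (hprof k) P)
          (hasCompactSupport_radialPoly (hprof k) P) x hε) 2] with y hy
        rw [hy, coe_affineSchwartz, RCLike.inner_apply, mul_comm]
      · filter_upwards [SchwartzMap.coeFn_toLp (affineSchwartz
          (contDiff_radialPoly hl (1 : MvPolynomial (Fin n) ℝ))
          (hasCompactSupport_radialPoly hl (1 : MvPolynomial (Fin n) ℝ)) x hε) 2] with y hy
        rw [hy, coe_affineSchwartz, RCLike.inner_apply, mul_comm]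
    have hl1 := tendsto_integral_affine_mul hn (f := fun k => radialPoly (smoothCutPower α k) P)
      (f' := radialPoly (cutPower α) P) (fun k => measurable_radialPoly (hd1.meas k) P)
      (fun k z => norm_radialPoly_le (hd1.bound k) hA₁0 hA₁ z)
      (fun z => (Complex.continuous_ofReal.tendsto _).comp
        ((hd1.tendsto _ (by positivity)).mul_const _)) x hε (Lp.memLp g)
    have hl2 := tendsto_integral_affine_mul hn
      (f := fun k => radialPoly (ladder n N (smoothCutPower α k)) (1 : MvPolynomial (Fin n) ℝ))
      (f' := radialPoly (ladder n N (cutPower α)) 1)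
      (fun k => measurable_radialPoly (hd2.meas k) 1)
      (fun k z => norm_radialPoly_le (hd2b k) zero_le_one hone z)
      (fun z => (Complex.continuous_ofReal.tendsto _).comp
        ((hd2.tendsto _ (by positivity)).mul_const _)) x hε (Lp.memLp (S g))
    simp_rw [hk] at hl1
    have he := tendsto_nhds_unique hl1 hl2
    simp_rw [hα, radialPoly_cutPower, Complex.conj_ofReal] at he
    rw [he]
    refine integral_congr_ae ?_
    -- An almost everywhere identity in `z` can be pulled back along `z = ε⁻¹(x - y)`.
    have hq : Measure.QuasiMeasurePreserving
        (fun y : EuclideanSpace ℝ (Fin n) => ε⁻¹ • (x - y)) volume volume := by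
      refine ⟨by fun_prop, ?_⟩
      have h1 : Measure.map (fun y : EuclideanSpace ℝ (Fin n) => ε⁻¹ • (x - y)) volume =
          Measure.map (fun z => ε⁻¹ • z) (Measure.map (fun y => x - y) volume) :=
        (Measure.map_map (by fun_prop) (by fun_prop)).symm
      rw [h1, (Measure.measurePreserving_sub_left volume x).map_eq,
        Measure.map_addHaar_smul volume (inv_ne_zero hε.ne')]
      exact Measure.smul_absolutelyContinuous
    filter_upwards [hq.ae (radialPoly_ladder_eq_bump hn hN)] with y hy
    rw [hy, Complex.conj_ofReal]
  have hcut_mem : ∀ (x : EuclideanSpace ℝ (Fin n)) (ε : ℝ), 0 < ε →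
      MemLp (fun y => (cutKernel (2 * N) P 1 (ε⁻¹ • (x - y)) : ℂ)) 2 := fun x ε hε =>
    memLp_affine hn (by norm_num) (Complex.measurable_ofReal.comp (measurable_cutKernel _ P 1))
      hcut_le x hε
  have hbump_mem : ∀ (x : EuclideanSpace ℝ (Fin n)) (ε : ℝ), 0 < ε →
      MemLp (fun y => (ladderBump n N (ε⁻¹ • (x - y)) : ℂ)) 2 := fun x ε hε =>
    memLp_affine hn (by norm_num) (Complex.measurable_ofReal.comp hbump_meas) hbump_le x hε
  -- the real transform
  have htrans : ∀ g : EuclideanSpace ℝ (Fin n) → ℝ, ∀ hg : MemLp (fun y => (g y : ℂ)) 2,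
      IsTransform N P (ladderBump n N) A.toNNReal g (fun y => (S (hg.toLp _) y).re) := by
    intro g hg
    refine ⟨(Lp.memLp (S (hg.toLp _))).re, ?_, fun x ε hε => ?_⟩
    · calc eLpNorm (fun y => (S (hg.toLp _) y).re) 2 volume
          ≤ eLpNorm (S (hg.toLp _)) 2 volume :=
            eLpNorm_mono fun y => by simpa using Complex.abs_re_le_norm _
        _ = ‖S (hg.toLp _)‖ₑ := (Lp.enorm_def _).symm
        _ ≤ A.toNNReal * ‖hg.toLp _‖ₑ := by
            rw [← ofReal_norm, ← ofReal_norm]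
            refine (ENNReal.ofReal_le_ofReal (hSb _)).trans ?_
            rw [ENNReal.ofReal_mul hA0]
            rfl
        _ = A.toNNReal * eLpNorm g 2 volume := by
            rw [Lp.enorm_toLp]
            congr 1
            exact eLpNorm_congr_norm_ae (Eventually.of_forall fun y => by simp)
    · rw [truncated_eq]
      simp_rw [cutKernel_scale hP hε, smul_eq_mul, mul_assoc, integral_const_mul]
      congr 1
      have h := hpair x ε hε (hg.toLp _)
      have h1 : ∫ y, (cutKernel (2 * N) P 1 (ε⁻¹ • (x - y)) : ℂ) * (hg.toLp _) y =
          ((∫ y, cutKernel (2 * N) P 1 (ε⁻¹ • (x - y)) * g y : ℝ) : ℂ) := by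
        rw [← integral_complex_ofReal]
        refine integral_congr_ae ?_
        filter_upwards [hg.coeFn_toLp] with y hy
        rw [hy]; push_cast; rfl
      rw [h1] at h
      have h2 := congrArg Complex.re h
      rw [Complex.ofReal_re] at h2
      rw [h2]
      have hint : Integrable (fun y => (ladderBump n N (ε⁻¹ • (x - y)) : ℂ) *
          (S (hg.toLp _)) y) := (hbump_mem x ε hε).integrable_mul (Lp.memLp _)
      have h3 := integral_re hint
      simp only [RCLike.re_to_complex] at h3
      rw [← h3]
      refine integral_congr_ae (Eventually.of_forall fun y => ?_)
      simp
  refine ⟨ladderBump n N, hbump_meas, ⟨C * 1 * 2 ^ n, fun x => ?_⟩,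
    support_indicator_subset, A.toNNReal,
    fun g hg => ⟨_, htrans g hg.ofReal⟩, ?_⟩
  · have h := hbump_le x
    rw [Complex.norm_real, Real.norm_eq_abs] at h
    refine h.trans (mul_le_of_le_one_right ?_ (weight_le_one x))
    exact nonneg_of_mul_nonneg_left ((abs_nonneg _).trans h) (weight_pos x)
  · -- the transform of the bump
    have hb0 : MemLp (fun y : EuclideanSpace ℝ (Fin n) => (ladderBump n N y : ℂ)) 2 := by
      refine (memLp_weight hn (by norm_num : (1 : ℝ≥0∞) < 2)).of_le_mul
        (c := C * 1 * 2 ^ n) (Complex.measurable_ofReal.comp hbump_meas).aestronglyMeasurable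
        (Eventually.of_forall fun y => ?_)
      rw [Real.norm_of_nonneg (weight_pos y).le]
      exact hbump_le y
    have hc0 : MemLp (fun y : EuclideanSpace ℝ (Fin n) => (cutKernel (2 * N) P 1 y : ℂ)) 2 := by
      refine (memLp_weight hn (by norm_num : (1 : ℝ≥0∞) < 2)).of_le_mul
        (c := 1 * A₁ * 2 ^ n) (Complex.measurable_ofReal.comp
          (measurable_cutKernel _ P 1)).aestronglyMeasurable (Eventually.of_forall fun y => ?_)
      rw [Real.norm_of_nonneg (weight_pos y).le]
      exact hcut_le y
    have hbsymm : ∀ y : EuclideanSpace ℝ (Fin n), ladderBump n N (-y) = ladderBump n N y :=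
      fun y => by simp [ladderBump, indicator]
    have hcsymm : ∀ y : EuclideanSpace ℝ (Fin n),
        cutKernel (2 * N) P 1 (-y) = cutKernel (2 * N) P 1 y := fun y => by
      have hp := polyEval_smul hP (-1) y
      rw [pow_mul, neg_one_sq, one_pow, one_mul, neg_one_smul] at hp
      simp [cutKernel, kernel_eq, hp]
    -- The pairing identity at `x = 0`, `ε = 1`, tested against every `g`; evenness of the bump and
    -- of the kernel removes the reflection.
    have hS : S (hb0.toLp _) = hc0.toLp _ := by
      refine ext_inner_right ℂ fun g => ?_
      rw [hSadj, L2.inner_def, L2.inner_def]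
      have h := hpair 0 1 one_pos g
      simp only [inv_one, one_smul, zero_sub, hbsymm, hcsymm] at h
      calc _ = _ := integral_congr_ae ?_
        _ = _ := h.symm
        _ = _ := integral_congr_ae ?_
      · filter_upwards [hb0.coeFn_toLp] with y hy
        rw [hy, RCLike.inner_apply, Complex.conj_ofReal, mul_comm]
      · filter_upwards [hc0.coeFn_toLp] with y hy
        rw [hy, RCLike.inner_apply, Complex.conj_ofReal, mul_comm]
    have ht := htrans (ladderBump n N) hb0
    rw [hS] at ht
    have hae : (fun y => (hc0.toLp _ y).re) =ᵐ[volume] cutKernel (2 * N) P 1 := by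
      filter_upwards [hc0.coeFn_toLp] with y hy
      rw [hy, Complex.ofReal_re]
    refine ⟨ht.memLp.ae_eq hae, ?_, fun x ε hε => ?_⟩
    · rw [← eLpNorm_congr_ae hae]; exact ht.bound
    · rw [ht.rep x ε hε]
      congr 1
      refine integral_congr_ae ?_
      filter_upwards [hae] with y hy
      rw [hy]

end L2

end

/-! ### Pointwise convergence for square integrable functions -/

section Pointwise

variable {n : ℕ}

lemma volume_real_closedBall (x : EuclideanSpace ℝ (Fin n)) {r : ℝ} (hr : 0 ≤ r) :
    volume.real (Metric.closedBall x r) =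
      r ^ n * volume.real (Metric.ball (0 : EuclideanSpace ℝ (Fin n)) 1) := by
  rw [measureReal_def, Measure.addHaar_closedBall _ _ hr, finrank_euclideanSpace_fin,
    ENNReal.toReal_mul, ENNReal.toReal_ofReal (by positivity), measureReal_def]

lemma ae_tendsto_scaled_integral {h : EuclideanSpace ℝ (Fin n) → ℝ}
    (hh : LocallyIntegrable h) :
    ∀ᵐ x, Tendsto (fun ε : ℝ => (ε ^ n)⁻¹ * ∫ y in Metric.closedBall x ε, |h y - h x|)
      (𝓝[>] 0) (𝓝 0) := by
  filter_upwards [IsUnifLocDoublingMeasure.ae_tendsto_average_norm_sub volume hh 1] with x hx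
  have h1 := hx (fun _ : ℝ => x) (fun ε => ε) tendsto_id (by
    filter_upwards [self_mem_nhdsWithin] with ε (hε : 0 < ε)
    simp [hε.le])
  have h2 := h1.const_mul (volume.real (Metric.ball (0 : EuclideanSpace ℝ (Fin n)) 1))
  rw [mul_zero] at h2
  refine h2.congr' ?_
  filter_upwards [self_mem_nhdsWithin] with ε (hε : 0 < ε)
  have hv : 0 < volume.real (Metric.ball (0 : EuclideanSpace ℝ (Fin n)) 1) :=
    ENNReal.toReal_pos (Metric.measure_ball_pos volume 0 one_pos).ne' measure_ball_lt_top.ne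
  rw [setAverage_eq, volume_real_closedBall x hε.le, smul_eq_mul]
  simp only [Real.norm_eq_abs]
  field_simp

lemma affine_eq_zero {b : EuclideanSpace ℝ (Fin n) → ℝ} (hsupp : Function.support b ⊆ Metric.ball 0 1)
    (x y : EuclideanSpace ℝ (Fin n)) {ε : ℝ} (hε : 0 < ε) (hy : y ∉ Metric.ball x ε) :
    b (ε⁻¹ • (x - y)) = 0 := by
  by_contra h
  have := hsupp h
  rw [mem_ball_zero_iff, norm_smul, norm_inv, Real.norm_of_nonneg hε.le, inv_mul_eq_div,
    div_lt_one hε, ← dist_eq_norm, dist_comm] at this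
  exact hy this

/-- The dilates of `b` form a bounded, compactly supported approximate identity of mass `∫ b`, so
convergence holds at every Lebesgue point of `h`. -/
lemma ae_tendsto_bump {b : EuclideanSpace ℝ (Fin n) → ℝ} (hb : Measurable b) {B : ℝ}
    (hB : ∀ x, |b x| ≤ B) (hsupp : Function.support b ⊆ Metric.ball 0 1)
    {h : EuclideanSpace ℝ (Fin n) → ℝ} (hh : LocallyIntegrable h) :
    ∀ᵐ x, Tendsto (fun ε : ℝ => (ε ^ n)⁻¹ * ∫ y, b (ε⁻¹ • (x - y)) * h y) (𝓝[>] 0)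
      (𝓝 ((∫ z, b z) * h x)) := by
  filter_upwards [ae_tendsto_scaled_integral hh] with x hx
  rw [tendsto_iff_norm_sub_tendsto_zero]
  have h2 := hx.const_mul B
  rw [mul_zero] at h2
  refine squeeze_zero' (Eventually.of_forall fun _ => norm_nonneg _) ?_ h2
  filter_upwards [self_mem_nhdsWithin] with ε (hε : 0 < ε)
  have hmeas : Measurable fun y => b (ε⁻¹ • (x - y)) := hb.comp (by fun_prop)
  have hloc : IntegrableOn h (Metric.closedBall x ε) :=
    hh.integrableOn_isCompact (isCompact_closedBall x ε)
  have hconst : IntegrableOn (fun _ => h x) (Metric.closedBall x ε) :=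
    integrableOn_const (isCompact_closedBall x ε).measure_lt_top.ne
  have hset : ∀ g : EuclideanSpace ℝ (Fin n) → ℝ,
      ∫ y, b (ε⁻¹ • (x - y)) * g y =
        ∫ y in Metric.closedBall x ε, b (ε⁻¹ • (x - y)) * g y := fun g => by
    rw [setIntegral_eq_integral_of_forall_compl_eq_zero]
    intro y hy
    rw [affine_eq_zero hsupp x y hε fun h => hy (Metric.ball_subset_closedBall h), zero_mul]
  have hmul : ∀ g : EuclideanSpace ℝ (Fin n) → ℝ, IntegrableOn g (Metric.closedBall x ε) →
      IntegrableOn (fun y => b (ε⁻¹ • (x - y)) * g y) (Metric.closedBall x ε) := fun g hg =>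
    Integrable.bdd_mul (c := B) hg hmeas.aestronglyMeasurable
      (Eventually.of_forall fun y => hB _)
  have hmass : (∫ z, b z) * h x = (ε ^ n)⁻¹ * ∫ y, b (ε⁻¹ • (x - y)) * h x := by
    rw [integral_mul_const]
    have h3 := integral_sub_left_eq_self (fun y => b (ε⁻¹ • y)) volume x
    rw [h3, Measure.integral_comp_inv_smul_of_nonneg volume b hε.le, finrank_euclideanSpace_fin,
      smul_eq_mul]
    field_simp
  rw [hmass, hset h, hset fun _ => h x, ← mul_sub, ← integral_sub (hmul h hloc) (hmul _ hconst),
    norm_mul, Real.norm_of_nonneg (by positivity), mul_left_comm]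
  refine mul_le_mul_of_nonneg_left ?_ (by positivity)
  rw [← integral_const_mul]
  refine norm_integral_le_of_norm_le ((hloc.sub hconst).abs.const_mul B)
    (Eventually.of_forall fun y => ?_)
  rw [← mul_sub, norm_mul]
  exact mul_le_mul_of_nonneg_right (hB _) (norm_nonneg _)

lemma continuousAt_kernel (d : ℕ) (P : MvPolynomial (Fin n) ℝ) {x : EuclideanSpace ℝ (Fin n)}
    (hx : x ≠ 0) : ContinuousAt (kernel d P) x :=
  (continuous_polyEval P).continuousAt.div (by fun_prop)
    (pow_ne_zero _ (norm_ne_zero_iff.2 hx))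

/-- A function all of whose truncated transforms tend to zero cannot exist for a nonzero kernel:
there is a square integrable `g` with `T^ε g` not tending to zero almost everywhere. -/
lemma exists_not_tendsto_zero {d : ℕ} (hd : 1 ≤ d) {P : MvPolynomial (Fin n) ℝ}
    (hP : P.IsHomogeneous d) {x₀ : EuclideanSpace ℝ (Fin n)} (hx₀ : polyEval P x₀ ≠ 0) :
    ∃ g : EuclideanSpace ℝ (Fin n) → ℝ, MemLp g 2 ∧
      ¬ ∀ᵐ x, Tendsto (fun ε => truncated d P ε g x) (𝓝[>] 0) (𝓝 0) := by
  obtain ⟨A, hA0, hA⟩ := exists_kernel_bound hP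
  set U : Set (EuclideanSpace ℝ (Fin n)) := {y | 1 < ‖y‖ ∧ ‖y‖ < 2} with hU
  have hUo : IsOpen U := (isOpen_lt continuous_const continuous_norm).inter
    (isOpen_lt continuous_norm continuous_const)
  have hUfin : volume U ≠ ∞ := by
    refine ((measure_mono fun y hy => ?_).trans_lt
      (measure_ball_lt_top (x := (0 : EuclideanSpace ℝ (Fin n))) (r := 2))).ne
    rw [mem_ball_zero_iff]; exact hy.2
  -- The reflected kernel cut to an annulus: near the origin the truncations stabilise to a
  -- continuous function `G`, and `G 0 = ∫ g²`.
  set g : EuclideanSpace ℝ (Fin n) → ℝ := U.indicator fun y => kernel d P (-y) with hg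
  have hgm : Measurable g :=
    ((measurable_kernel d P).comp measurable_neg).indicator hUo.measurableSet
  have hgb : ∀ y, ‖g y‖ ≤ U.indicator (fun _ => A) y := fun y => by
    simp only [hg, indicator]
    split_ifs with h
    · refine (hA _).trans (mul_le_of_le_one_right hA0 ?_)
      rw [norm_neg]
      exact inv_le_one_of_one_le₀ (one_le_pow₀ h.1.le)
    · simp
  have hgL : ∀ p, MemLp g p := fun p => by
    refine (memLp_indicator_const p hUo.measurableSet A (Or.inr hUfin)).of_le
      hgm.aestronglyMeasurable (Eventually.of_forall fun y => (hgb y).trans (le_abs_self _))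
  refine ⟨g, hgL 2, fun hcon => ?_⟩
  set G : EuclideanSpace ℝ (Fin n) → ℝ := fun x => ∫ y, kernel d P (x - y) * g y with hG
  have hfar : ∀ x ∈ Metric.ball (0 : EuclideanSpace ℝ (Fin n)) (1 / 2), ∀ y ∈ U,
      1 / 2 < ‖x - y‖ := fun x hx y hy => by
    rw [mem_ball_zero_iff] at hx
    have := norm_sub_norm_le y x
    rw [norm_sub_rev] at this
    linarith [hy.1]
  have hGT : ∀ x ∈ Metric.ball (0 : EuclideanSpace ℝ (Fin n)) (1 / 2), ∀ ε, ε < 1 / 2 →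
      truncated d P ε g x = G x := fun x hx ε hε => by
    rw [truncated_eq]
    refine integral_congr_ae (Eventually.of_forall fun y => ?_)
    by_cases hy : y ∈ U
    · simp only [cutKernel, if_pos (hε.trans (hfar x hx y hy)), smul_eq_mul]
    · simp [hg, hy]
  have hGzero : ∀ᵐ x, x ∈ Metric.ball (0 : EuclideanSpace ℝ (Fin n)) (1 / 2) → G x = 0 := by
    filter_upwards [hcon] with x hx hxb
    refine tendsto_nhds_unique ?_ hx
    refine tendsto_const_nhds.congr' ?_
    filter_upwards [Ioo_mem_nhdsGT (show (0 : ℝ) < 1 / 2 by norm_num)] with ε hε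
    exact (hGT x hxb ε hε.2).symm
  have hGc : ContinuousAt G 0 := by
    refine continuousAt_of_dominated (bound := fun y => A * 2 ^ n * |g y|) ?_ ?_
      ((memLp_one_iff_integrable.1 (hgL 1)).abs.const_mul _) ?_
    · refine Eventually.of_forall fun x => Measurable.aestronglyMeasurable ?_
      exact ((measurable_kernel d P).comp (measurable_const.sub measurable_id)).mul hgm
    · filter_upwards [Metric.ball_mem_nhds (0 : EuclideanSpace ℝ (Fin n))
        (show (0 : ℝ) < 1 / 2 by norm_num)] with x hx
      refine Eventually.of_forall fun y => ?_
      rw [norm_mul]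
      by_cases hy : y ∈ U
      · refine mul_le_mul_of_nonneg_right ((hA _).trans ?_) (abs_nonneg _)
        refine mul_le_mul_of_nonneg_left ?_ hA0
        rw [← inv_pow]
        refine pow_le_pow_left₀ (by positivity) ?_ n
        refine inv_le_of_inv_le₀ two_pos ?_
        rw [← one_div]
        exact (hfar x hx y hy).le
      · simp [hg, hy]
    · refine Eventually.of_forall fun y => ?_
      by_cases hy : y ∈ U
      · refine ContinuousAt.mul ?_ continuousAt_const
        refine ContinuousAt.comp (f := fun x => x - y) (g := kernel d P)
          (continuousAt_kernel d P ?_) (by fun_prop)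
        have := hfar 0 (by simp) y hy
        intro h0
        rw [h0, norm_zero] at this
        linarith
      · simp only [hg, hy, not_false_eq_true, indicator_of_notMem, mul_zero]
        exact continuousAt_const
  -- A continuous function vanishing almost everywhere near `0` vanishes at `0`.
  have hG0 : G 0 = 0 := by
    by_contra hne
    have hev := (hGc.eventually_ne hne).and (Metric.ball_mem_nhds (0 : EuclideanSpace ℝ (Fin n))
        (show (0 : ℝ) < 1 / 2 by norm_num))
    have hpos := Measure.measure_pos_of_mem_nhds volume hev
    refine hpos.ne' (measure_mono_null (fun x hx => ?_) hGzero)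
    exact fun h => hx.1 (h hx.2)
  have hint : Integrable fun y => g y * g y := (hgL 2).integrable_mul (hgL 2)
  have hG0' : G 0 = ∫ y, g y * g y := by
    refine integral_congr_ae (Eventually.of_forall fun y => ?_)
    by_cases hy : y ∈ U
    · simp [hg, hy]
    · simp [hg, hy]
  have hpos : 0 < ∫ y, g y * g y := by
    rw [integral_pos_iff_support_of_nonneg (fun y => mul_self_nonneg _) hint]
    have hx0 : x₀ ≠ 0 := fun h => hx₀ (by
      have := polyEval_smul hP 0 x₀
      rw [zero_smul, zero_pow (by omega), zero_mul] at this
      rw [h, this])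
    have hnx : 0 < ‖x₀‖ := norm_pos_iff.2 hx0
    -- Chosen so that `-y₀` is a positive multiple of `x₀` of norm `3/2`: it lies in the annulus
    -- and, by homogeneity, the kernel is nonzero there.
    set y₀ : EuclideanSpace ℝ (Fin n) := (-(3 / 2) * ‖x₀‖⁻¹) • x₀ with hy₀
    have hn : ‖y₀‖ = 3 / 2 := by
      rw [hy₀, norm_smul, norm_mul, norm_inv, norm_norm, mul_assoc, inv_mul_cancel₀ hnx.ne']
      norm_num
    have hyU : y₀ ∈ U := by constructor <;> rw [hn] <;> norm_num
    have hk : kernel d P (-y₀) ≠ 0 := by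
      have : -y₀ = ((3 / 2) * ‖x₀‖⁻¹) • x₀ := by rw [hy₀, ← neg_smul]; ring_nf
      rw [this, kernel_smul hP (by positivity)]
      have h1 : kernel d P x₀ ≠ 0 := div_ne_zero hx₀ (pow_ne_zero _ hnx.ne')
      positivity
    have hy0 : -y₀ ≠ 0 := by rw [← norm_ne_zero_iff, norm_neg, hn]; norm_num
    have hc : ContinuousAt (fun y => kernel d P (-y)) y₀ :=
      ContinuousAt.comp (f := fun y => -y) (g := kernel d P) (continuousAt_kernel d P hy0)
        (by fun_prop)
    refine Measure.measure_pos_of_mem_nhds volume (x := y₀) ?_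
    filter_upwards [hc.eventually_ne hk, hUo.mem_nhds hyU] with y h1 h2
    rw [Function.mem_support]
    simp only [hg, indicator_of_mem h2]
    exact mul_ne_zero h1 h1
  rw [← hG0', hG0] at hpos
  exact lt_irrefl _ hpos

lemma truncated_const_mul (d : ℕ) (P : MvPolynomial (Fin n) ℝ) (ε c : ℝ)
    (f : EuclideanSpace ℝ (Fin n) → ℝ) (x : EuclideanSpace ℝ (Fin n)) :
    truncated d P ε (fun y => c * f y) x = c * truncated d P ε f x := by
  simp only [truncated, smul_eq_mul]
  rw [← integral_const_mul]
  congr 1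
  ext y
  ring

/-- The bump `b` with `T b = K 1_{|x|>1}`, and the reproducing formula for `T^ε` on `L²`. -/
theorem exists_bump (hn : 1 ≤ n) {N : ℕ} (hN : 1 ≤ N) {P : MvPolynomial (Fin n) ℝ}
    (hP : P.IsHomogeneous (2 * N)) (hharm : IsHarmonicPoly P)
    {x₀ : EuclideanSpace ℝ (Fin n)} (hx₀ : polyEval P x₀ ≠ 0) :
    ∃ b : EuclideanSpace ℝ (Fin n) → ℝ, Measurable b ∧ (∃ B, ∀ x, |b x| ≤ B) ∧
      Function.support b ⊆ Metric.ball 0 1 ∧ ∃ A : ℝ≥0,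
      (∀ g, MemLp g 2 → ∃ h, IsTransform N P b A g h ∧
        ∀ᵐ x, HasPrincipalValue (2 * N) P g x (h x)) ∧
      ∀ᵐ x, HasPrincipalValue (2 * N) P b x (cutKernel (2 * N) P 1 x) := by
  obtain ⟨b, hbm, ⟨B, hB⟩, hsupp, A, hT, hTb⟩ := exists_L2_transform hn hN hP hharm
  have hlim : ∀ g h, IsTransform N P b A g h → ∀ᵐ x,
      Tendsto (fun ε => truncated (2 * N) P ε g x) (𝓝[>] 0) (𝓝 ((∫ z, b z) * h x)) := by
    intro g h hgh
    filter_upwards [ae_tendsto_bump hbm hB hsupp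
      (hgh.memLp.locallyIntegrable (by norm_num))] with x hx
    refine hx.congr' ?_
    filter_upwards [self_mem_nhdsWithin] with ε hε
    exact (hgh.rep x ε hε).symm
  set c := ∫ z, b z with hc
  have hc0 : c ≠ 0 := by
    intro h0
    obtain ⟨g, hg, hnot⟩ := exists_not_tendsto_zero (by omega) hP hx₀
    obtain ⟨h, hgh⟩ := hT g hg
    refine hnot ?_
    simpa [h0] using hlim g h hgh
  -- The bump is divided by its mass and the transform multiplied by it, so that the reproducing
  -- formula is unchanged and the transform becomes the principal value.
  refine ⟨fun x => c⁻¹ * b x, hbm.const_mul _, ⟨|c⁻¹| * B, fun x => ?_⟩, ?_, ‖c‖₊ * A,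
    fun g hg => ?_, ?_⟩
  · rw [abs_mul]; exact mul_le_mul_of_nonneg_left (hB x) (abs_nonneg _)
  · exact (Function.support_mul_subset_right _ _).trans hsupp
  · obtain ⟨h, hgh⟩ := hT g hg
    refine ⟨fun x => c * h x, ⟨hgh.memLp.const_mul c, ?_, fun x ε hε => ?_⟩, hlim g h hgh⟩
    · rw [show (fun x => c * h x) = c • h from rfl, eLpNorm_const_smul, ENNReal.coe_mul, mul_assoc]
      exact mul_le_mul_right hgh.bound _
    · rw [hgh.rep x ε hε]
      congr 1
      refine integral_congr_ae (Eventually.of_forall fun y => ?_)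
      simp only
      field_simp
  · filter_upwards [hlim _ _ hTb] with x hx
    have h1 := hx.const_mul c⁻¹
    rw [inv_mul_cancel_left₀ hc0] at h1
    unfold HasPrincipalValue
    simp_rw [truncated_const_mul]
    exact h1

end Pointwise

/-! ### Smoothness of the kernel -/

section Smooth

variable {n : ℕ}

lemma contDiffAt_kernel (d : ℕ) (P : MvPolynomial (Fin n) ℝ) {x : EuclideanSpace ℝ (Fin n)}
    (hx : x ≠ 0) : ContDiffAt ℝ 1 (kernel d P) x :=
  (contDiff_polyEval P).contDiffAt.div ((contDiffAt_norm ℝ hx).pow _)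
    (pow_ne_zero _ (norm_ne_zero_iff.2 hx))

/-- The mean value inequality on balls of radius `1/2` about unit vectors, inside a compact annulus
avoiding the origin, then rescaled by homogeneity. -/
lemma exists_kernel_lipschitz {d : ℕ} {P : MvPolynomial (Fin n) ℝ} (hP : P.IsHomogeneous d) :
    ∃ A, 0 ≤ A ∧ ∀ u v, 2 * ‖u - v‖ ≤ ‖v‖ →
      |kernel d P u - kernel d P v| ≤ A * (‖u - v‖ / ‖v‖ ^ (n + 1)) := by
  set W : Set (EuclideanSpace ℝ (Fin n)) := {z | 1 / 2 ≤ ‖z‖ ∧ ‖z‖ ≤ 3 / 2} with hW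
  have hWc : IsCompact W := by
    refine (isCompact_closedBall (0 : EuclideanSpace ℝ (Fin n)) (3 / 2)).of_isClosed_subset
      ((isClosed_le continuous_const continuous_norm).inter
        (isClosed_le continuous_norm continuous_const)) fun z hz => ?_
    rw [mem_closedBall_zero_iff]; exact hz.2
  have hW0 : ∀ z ∈ W, z ≠ 0 := fun z hz h => by
    have := hz.1
    rw [h, norm_zero] at this
    norm_num at this
  have hcont : ContinuousOn (fderiv ℝ (kernel d P)) W := by
    have hopen : IsOpen {z : EuclideanSpace ℝ (Fin n) | z ≠ 0} := isOpen_ne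
    have : ContDiffOn ℝ 1 (kernel d P) {z | z ≠ 0} := fun z hz =>
      (contDiffAt_kernel d P hz).contDiffWithinAt
    exact (this.continuousOn_fderiv_of_isOpen hopen le_rfl).mono hW0
  obtain ⟨A, hA⟩ := hWc.exists_bound_of_continuousOn hcont
  have hunit : ∀ u v : EuclideanSpace ℝ (Fin n), ‖v‖ = 1 → ‖u - v‖ ≤ 1 / 2 →
      |kernel d P u - kernel d P v| ≤ |A| * ‖u - v‖ := by
    intro u v hv huv
    have hball : Metric.closedBall v (1 / 2) ⊆ W := fun z hz => by
      rw [mem_closedBall_iff_norm] at hz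
      have h1 := norm_sub_norm_le z v
      have h2 := norm_sub_norm_le v z
      rw [norm_sub_rev] at h2
      constructor <;> linarith
    refine (convex_closedBall v (1 / 2)).norm_image_sub_le_of_norm_fderiv_le (𝕜 := ℝ)
      (fun z hz => (contDiffAt_kernel d P (hW0 z (hball hz))).differentiableAt one_ne_zero)
      (fun z hz => (hA z (hball hz)).trans (le_abs_self A)) (by simp) ?_
    rwa [mem_closedBall_iff_norm]
  refine ⟨|A|, abs_nonneg _, fun u v huv => ?_⟩
  rcases (norm_nonneg v).eq_or_lt with h0 | hv
  · rw [← h0] at huv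
    have : u - v = 0 := norm_eq_zero.1 (le_antisymm (by linarith) (norm_nonneg _))
    rw [sub_eq_zero.1 this]
    simp
  · have h := hunit (‖v‖⁻¹ • u) (‖v‖⁻¹ • v)
      (by rw [norm_smul, norm_inv, norm_norm, inv_mul_cancel₀ hv.ne'])
      (by rw [← smul_sub, norm_smul, norm_inv, norm_norm, inv_mul_le_iff₀ hv]; linarith)
    rw [kernel_smul hP (inv_pos.2 hv), kernel_smul hP (inv_pos.2 hv), ← mul_sub, abs_mul,
      ← smul_sub, norm_smul, norm_inv, norm_norm, inv_pow, inv_inv,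
      abs_of_pos (pow_pos hv n)] at h
    rw [pow_succ]
    have hpn := pow_pos hv n
    calc |kernel d P u - kernel d P v|
        = (‖v‖ ^ n)⁻¹ * (‖v‖ ^ n * |kernel d P u - kernel d P v|) := by
          rw [inv_mul_cancel_left₀ hpn.ne']
      _ ≤ (‖v‖ ^ n)⁻¹ * (|A| * (‖v‖⁻¹ * ‖u - v‖)) := by gcongr
      _ = _ := by field_simp

/-- The majorant of the smoothness of a standard kernel. -/
def tailKernel (s : ℝ) (z : EuclideanSpace ℝ (Fin n)) : ℝ :=
  if 2 * s ≤ ‖z‖ then s / ‖z‖ ^ (n + 1) else 0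

lemma tailKernel_nonneg {s : ℝ} (hs : 0 ≤ s) (z : EuclideanSpace ℝ (Fin n)) :
    0 ≤ tailKernel s z := by
  unfold tailKernel; split_ifs <;> positivity

lemma measurable_tailKernel : Measurable fun p : ℝ × EuclideanSpace ℝ (Fin n) =>
    tailKernel p.1 p.2 :=
  Measurable.ite (measurableSet_le (by fun_prop) (by fun_prop))
    (measurable_fst.div (measurable_snd.norm.pow_const _)) measurable_const

lemma integrable_tailKernel_one : Integrable (tailKernel (n := n) 1) := by
  have hr : (Module.finrank ℝ (EuclideanSpace ℝ (Fin n)) : ℝ) < ((n + 1 : ℕ) : ℝ) := by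
    rw [finrank_euclideanSpace_fin]; push_cast; linarith
  refine ((integrable_one_add_norm hr).const_mul (2 ^ (n + 1))).mono'
    (measurable_tailKernel.comp (measurable_const.prodMk measurable_id)).aestronglyMeasurable
    (Eventually.of_forall fun z => ?_)
  rw [Real.norm_of_nonneg (tailKernel_nonneg zero_le_one z),
    Real.rpow_neg (by positivity), Real.rpow_natCast]
  unfold tailKernel
  split_ifs with h
  · rw [← div_eq_mul_inv, div_le_div_iff₀ (pow_pos (by linarith) _) (by positivity), one_mul,
      ← mul_pow]
    exact pow_le_pow_left₀ (by positivity) (by linarith) _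
  · positivity

/-- `tailKernel s` is the `L¹`-normalised dilate of `tailKernel 1`, so its integral is the same for
all `s > 0`. -/
lemma lintegral_tailKernel_le :
    ∃ C : ℝ≥0, ∀ s : ℝ, 0 ≤ s →
      ∫⁻ z : EuclideanSpace ℝ (Fin n), ENNReal.ofReal (tailKernel s z) ≤ C := by
  refine ⟨(∫ z, tailKernel (n := n) 1 z).toNNReal, fun s hs => ?_⟩
  rcases hs.eq_or_lt with rfl | hs
  · simp [tailKernel]
  · have hscale : tailKernel (n := n) s = fun z => (s ^ n)⁻¹ * tailKernel 1 (s⁻¹ • z) := by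
      ext z
      unfold tailKernel
      have h : 2 * 1 ≤ ‖s⁻¹ • z‖ ↔ 2 * s ≤ ‖z‖ := by
        rw [norm_smul, norm_inv, Real.norm_of_nonneg hs.le, inv_mul_eq_div, le_div_iff₀ hs,
          mul_one]
      simp only [h]
      split_ifs
      · rw [norm_smul, norm_inv, Real.norm_of_nonneg hs.le, mul_pow, inv_pow, pow_succ s]
        field_simp
      · simp
    have hint : Integrable (tailKernel (n := n) s) := by
      rw [hscale]
      exact (integrable_tailKernel_one.comp_smul (inv_ne_zero hs.ne')).const_mul _
    rw [← ofReal_integral_eq_lintegral_ofReal hint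
      (Eventually.of_forall fun z => tailKernel_nonneg hs.le z)]
    refine ENNReal.ofReal_le_ofReal (le_of_eq ?_)
    rw [hscale, integral_const_mul, Measure.integral_comp_inv_smul_of_nonneg volume _ hs.le,
      finrank_euclideanSpace_fin, smul_eq_mul, inv_mul_cancel_left₀ (pow_pos hs n).ne']

end Smooth

/-! ### Selection of balls -/

section Balls

variable {n : ℕ}

lemma volume_closedBall_mul (x : EuclideanSpace ℝ (Fin n)) {r t : ℝ} (hr : 0 ≤ r) (ht : 0 ≤ t) :
    volume (Metric.closedBall x (t * r)) =
      ENNReal.ofReal (t ^ n) * volume (Metric.closedBall x r) := by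
  rw [Measure.addHaar_closedBall _ _ hr, Measure.addHaar_closedBall _ _ (mul_nonneg ht hr),
    finrank_euclideanSpace_fin, mul_pow, ENNReal.ofReal_mul (by positivity), mul_assoc]

/-- Vitali selection of disjoint balls on which the density of `ν` exceeds `l`. -/
lemma exists_vitali_balls (hn : 1 ≤ n) (ν : Measure (EuclideanSpace ℝ (Fin n)))
    (hν : ν univ ≠ ∞) {l : ℝ≥0∞} (hl : l ≠ 0) :
    ∃ (u : Set (EuclideanSpace ℝ (Fin n))) (r : EuclideanSpace ℝ (Fin n) → ℝ),
      u.Countable ∧ (∀ c ∈ u, 0 < r c) ∧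
      (u.PairwiseDisjoint fun c => Metric.closedBall c (r c)) ∧
      (∀ c ∈ u, l * volume (Metric.closedBall c (r c)) ≤ ν (Metric.closedBall c (r c))) ∧
      (∀ c ∈ u, ν (Metric.closedBall c (5 * r c)) ≤
        l * volume (Metric.closedBall c (5 * r c))) ∧
      ∀ x, (∀ c ∈ u, x ∉ Metric.closedBall c (5 * r c)) → ∀ s > 0,
        ν (Metric.closedBall x s) ≤ l * volume (Metric.closedBall x s) := by
  set R : EuclideanSpace ℝ (Fin n) → Set ℝ := fun x =>
    {r | 0 < r ∧ l * volume (Metric.closedBall x r) < ν (Metric.closedBall x r)} with hR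
  set V := volume (Metric.ball (0 : EuclideanSpace ℝ (Fin n)) 1) with hV
  have hV0 : V ≠ 0 := (Metric.measure_ball_pos volume 0 one_pos).ne'
  set M : ℝ := (ν univ / (l * V)).toReal with hM
  have hMtop : ν univ / (l * V) ≠ ∞ := ENNReal.div_ne_top hν (mul_ne_zero hl hV0)
  -- A ball of density above `l` has volume less than `ν univ / l`, which is finite; for `r ≥ 1` one
  -- also has `r ≤ rⁿ`.
  have hbdd : ∀ x, ∀ r ∈ R x, r ≤ max 1 M := by
    rintro x r ⟨hr0, hr⟩
    rcases le_total r 1 with h1 | h1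
    · exact h1.trans (le_max_left _ _)
    · refine le_trans ?_ (le_max_right _ _)
      have h2 : ENNReal.ofReal (r ^ n) ≤ ν univ / (l * V) := by
        have hlt := hr.trans_le (measure_mono (subset_univ _))
        rw [Measure.addHaar_closedBall _ _ hr0.le, finrank_euclideanSpace_fin] at hlt
        have hl' : l ≠ ∞ := by
          rintro rfl
          rw [ENNReal.top_mul (mul_ne_zero (ENNReal.ofReal_pos.2 (by positivity)).ne' hV0)] at hlt
          exact not_top_lt hlt
        rw [ENNReal.le_div_iff_mul_le (Or.inl (mul_ne_zero hl hV0))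
          (Or.inl (ENNReal.mul_ne_top hl' measure_ball_lt_top.ne)), mul_left_comm]
        exact hlt.le
      have h3 : r ^ n ≤ M := by
        rw [hM, ← ENNReal.ofReal_le_iff_le_toReal hMtop]
        exact h2
      exact (le_self_pow₀ h1 (by omega)).trans h3
  have hchoice : ∀ x, ∃ r, (R x).Nonempty → r ∈ R x ∧ 5 * r ∉ R x := by
    intro x
    by_cases hx : (R x).Nonempty
    · have hb : BddAbove (R x) := ⟨_, hbdd x⟩
      have hpos : 0 < sSup (R x) := by
        obtain ⟨r, hr⟩ := hx
        exact hr.1.trans_le (le_csSup hb hr)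
      -- A radius above a fifth of the supremum: the fivefold ball is past the supremum, so its
      -- density is already at most `l`.
      obtain ⟨r, hr, hlt⟩ := exists_lt_of_lt_csSup hx (by linarith : sSup (R x) / 5 < sSup (R x))
      refine ⟨r, fun _ => ⟨hr, fun h5 => ?_⟩⟩
      have := le_csSup hb h5
      linarith
    · exact ⟨0, fun h => absurd h hx⟩
  choose r hr using hchoice
  obtain ⟨u, hut, hdisj, hcov⟩ := Vitali.exists_disjoint_subfamily_covering_enlargement_closedBall
    {x | (R x).Nonempty} (fun x => x) r (max 1 M) (fun x hx => hbdd x _ (hr x hx).1) 5 (by norm_num)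
  have hpos : ∀ c ∈ u, 0 < r c := fun c hc => (hr c (hut hc)).1.1
  refine ⟨u, r, ?_, hpos, hdisj, fun c hc => (hr c (hut hc)).1.2.le, fun c hc => ?_,
    fun x hx s hs => ?_⟩
  · refine hdisj.countable_of_nonempty_interior fun c hc => ?_
    exact (Metric.nonempty_ball.2 (hpos c hc)).mono Metric.ball_subset_interior_closedBall
  · by_contra h
    exact (hr c (hut hc)).2 ⟨by linarith [hpos c hc], not_le.1 h⟩
  · by_contra h
    have hx' : x ∈ {x | (R x).Nonempty} := ⟨s, hs, not_le.1 h⟩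
    obtain ⟨c, hc, hsub⟩ := hcov x hx'
    exact hx c hc (hsub (Metric.mem_closedBall_self (hr x hx').1.1.le))

end Balls

/-! ### The Calderón-Zygmund decomposition -/

section Decomposition

variable {n : ℕ}

/-- Disjoint measurable sets between given disjoint sets and their enlargements, with the same
union as the enlargements. -/
lemma exists_disjoint_between {α ι : Type*} [MeasurableSpace α] [Countable ι] {B B' : ι → Set α}
    (hB : ∀ i, MeasurableSet (B i)) (hB' : ∀ i, MeasurableSet (B' i)) (hsub : ∀ i, B i ⊆ B' i)
    (hdisj : Pairwise (Function.onFun Disjoint B)) :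
    ∃ E : ι → Set α, (∀ i, MeasurableSet (E i)) ∧ (∀ i, B i ⊆ E i) ∧ (∀ i, E i ⊆ B' i) ∧
      Pairwise (Function.onFun Disjoint E) ∧ ⋃ i, E i = ⋃ i, B' i := by
  obtain ⟨φ, hφ⟩ := exists_injective_nat ι
  -- Each piece keeps its small ball and takes from its large ball only what lies in no small ball
  -- and in no large ball of smaller index.
  refine ⟨fun i => B i ∪ (B' i \ ((⋃ j, B j) ∪ ⋃ j, ⋃ (_ : φ j < φ i), B' j)), fun i => ?_,
    fun i => subset_union_left, fun i => union_subset (hsub i) sdiff_subset, ?_, ?_⟩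
  · exact (hB i).union ((hB' i).diff ((MeasurableSet.iUnion hB).union
      (MeasurableSet.iUnion fun j => MeasurableSet.iUnion fun _ => hB' j)))
  · have key : ∀ i j, φ i < φ j → Disjoint
        (B i ∪ (B' i \ ((⋃ j, B j) ∪ ⋃ k, ⋃ (_ : φ k < φ i), B' k)))
        (B j ∪ (B' j \ ((⋃ j, B j) ∪ ⋃ k, ⋃ (_ : φ k < φ j), B' k))) := by
      intro i j hij
      have hne : i ≠ j := fun h => by rw [h] at hij; exact lt_irrefl _ hij
      rw [disjoint_left]
      rintro y (hy | hy) (hy' | hy')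
      · exact disjoint_left.1 (hdisj hne) hy hy'
      · exact hy'.2 (Or.inl (mem_iUnion.2 ⟨i, hy⟩))
      · exact hy.2 (Or.inl (mem_iUnion.2 ⟨j, hy'⟩))
      · exact hy'.2 (Or.inr (mem_iUnion₂.2 ⟨i, hij, hy.1⟩))
    intro i j hij
    rcases lt_or_gt_of_ne (hφ.ne hij) with h | h
    · exact key i j h
    · exact (key j i h).symm
  · refine subset_antisymm (iUnion_mono fun i => union_subset (hsub i) sdiff_subset) ?_
    intro y hy
    by_cases hyB : y ∈ ⋃ j, B j
    · obtain ⟨j, hj⟩ := mem_iUnion.1 hyB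
      exact mem_iUnion.2 ⟨j, Or.inl hj⟩
    · have hne : {i | y ∈ B' i}.Nonempty := mem_iUnion.1 hy
      obtain ⟨i, hi, hmin⟩ := exists_minimalFor_of_wellFoundedLT (fun i => y ∈ B' i) φ hne
      refine mem_iUnion.2 ⟨i, Or.inr ⟨hi, ?_⟩⟩
      rintro (h | h)
      · exact hyB h
      · obtain ⟨j, hj, hyj⟩ := mem_iUnion₂.1 h
        exact absurd (hmin hyj hj.le) (not_le.2 hj)

/-- The Calderón-Zygmund decomposition at height `l`; `β` is the bad part and `cen y` is the
centre of the ball to which `y` is attached. -/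
lemma exists_CZ_at_height (hn : 1 ≤ n) {f : EuclideanSpace ℝ (Fin n) → ℝ} (hf : Integrable f)
    {l : ℝ} (hl : 0 < l) :
    ∃ (β : EuclideanSpace ℝ (Fin n) → ℝ) (cen : EuclideanSpace ℝ (Fin n) → EuclideanSpace ℝ (Fin n))
      (Ω Ω' : Set (EuclideanSpace ℝ (Fin n))),
      MeasurableSet Ω ∧ MeasurableSet Ω' ∧ Ω ⊆ Ω' ∧ Integrable β ∧ Measurable cen ∧
      (∀ y ∉ Ω, β y = 0) ∧
      (∀ z ∉ Ω', ∀ y ∈ Ω, 2 * ‖y - cen y‖ ≤ ‖z - cen y‖ ∧ z ≠ cen y) ∧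
      (∀ ψ : EuclideanSpace ℝ (Fin n) → ℝ, Measurable ψ → (∃ D, ∀ c, |ψ c| ≤ D) →
        ∫ y, ψ (cen y) * β y = 0) ∧
      ∫⁻ y, ‖β y‖ₑ ≤ 2 * ∫⁻ y in Ω, ‖f y‖ₑ ∧
      volume Ω' ≤ ENNReal.ofReal (10 ^ n) * (ENNReal.ofReal l)⁻¹ * ∫⁻ y in Ω, ‖f y‖ₑ ∧
      ∀ᵐ y, |f y - β y| ≤ 5 ^ n * l := by
  set ν : Measure (EuclideanSpace ℝ (Fin n)) := volume.withDensity fun y => ‖f y‖ₑ with hν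
  have hνS : ∀ S, MeasurableSet S → ν S = ∫⁻ y in S, ‖f y‖ₑ := fun S hS => withDensity_apply _ hS
  have hνtop : ν univ ≠ ∞ := by
    rw [hνS _ MeasurableSet.univ, Measure.restrict_univ]
    exact hf.2.ne
  have hl' : ENNReal.ofReal l ≠ 0 := (ENNReal.ofReal_pos.2 hl).ne'
  obtain ⟨u, r, hucount, hrpos, hdisj, hlow, hupp, hout⟩ := exists_vitali_balls hn ν hνtop hl'
  have : Countable u := hucount
  obtain ⟨E, hEm, hBE, hEB, hEd, hEU⟩ := exists_disjoint_between (ι := u)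
    (B := fun c => Metric.closedBall c.1 (r c.1)) (B' := fun c => Metric.closedBall c.1 (5 * r c.1))
    (fun c => Metric.isClosed_closedBall.measurableSet)
    (fun c => Metric.isClosed_closedBall.measurableSet)
    (fun c => Metric.closedBall_subset_closedBall (by linarith [hrpos c.1 c.2]))
    (fun c c' hcc => hdisj c.2 c'.2 fun h => hcc (Subtype.ext h))
  set Ω : Set (EuclideanSpace ℝ (Fin n)) := ⋃ c, E c with hΩ
  have hΩm : MeasurableSet Ω := MeasurableSet.iUnion hEm
  -- Pieces lie within `5r` of their centres, so points outside radius `10r` are at least twice as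
  -- far from the centre as the piece.
  set Ω' : Set (EuclideanSpace ℝ (Fin n)) := ⋃ c : u, Metric.closedBall c.1 (10 * r c.1) with hΩ'
  have hΩ'm : MeasurableSet Ω' :=
    MeasurableSet.iUnion fun c => Metric.isClosed_closedBall.measurableSet
  -- volumes of the pieces
  have hEfin : ∀ c, volume (E c) ≠ ∞ := fun c =>
    ((measure_mono (hEB c)).trans_lt measure_closedBall_lt_top).ne
  have hEpos : ∀ c, volume (E c) ≠ 0 := fun c =>
    ((Metric.measure_closedBall_pos volume c.1 (hrpos c.1 c.2)).trans_le
      (measure_mono (hBE c))).ne'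
  have hErpos : ∀ c, 0 < volume.real (E c) := fun c => ENNReal.toReal_pos (hEpos c) (hEfin c)
  -- the averages
  set avg : u → ℝ := fun c => (volume.real (E c))⁻¹ * ∫ y in E c, f y with havg
  have havg_mul : ∀ c, avg c * volume.real (E c) = ∫ y in E c, f y := fun c => by
    rw [havg]
    simp only
    rw [mul_comm, mul_inv_cancel_left₀ (hErpos c).ne']
  have havg_bound : ∀ c, |avg c| ≤ 5 ^ n * l := fun c => by
    have h1 : ‖∫ y in E c, f y‖ₑ ≤ ENNReal.ofReal (5 ^ n * l) * volume (E c) := by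
      calc ‖∫ y in E c, f y‖ₑ ≤ ∫⁻ y in E c, ‖f y‖ₑ := enorm_integral_le_lintegral_enorm _
        _ ≤ ∫⁻ y in Metric.closedBall c.1 (5 * r c.1), ‖f y‖ₑ := lintegral_mono_set (hEB c)
        _ = ν (Metric.closedBall c.1 (5 * r c.1)) :=
            (hνS _ Metric.isClosed_closedBall.measurableSet).symm
        _ ≤ ENNReal.ofReal l * volume (Metric.closedBall c.1 (5 * r c.1)) := hupp c.1 c.2
        _ = ENNReal.ofReal (5 ^ n * l) * volume (Metric.closedBall c.1 (r c.1)) := by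
            rw [volume_closedBall_mul _ (hrpos c.1 c.2).le (by norm_num),
              ENNReal.ofReal_mul (by positivity), ← mul_assoc, mul_comm (ENNReal.ofReal l)]
        _ ≤ _ := by gcongr; exact hBE c
    have h2 : |∫ y in E c, f y| ≤ 5 ^ n * l * volume.real (E c) := by
      have := ENNReal.toReal_mono (ENNReal.mul_ne_top ENNReal.ofReal_ne_top (hEfin c)) h1
      rwa [toReal_enorm, ENNReal.toReal_mul, ENNReal.toReal_ofReal (by positivity),
        Real.norm_eq_abs] at this
    rw [havg]
    simp only
    rw [abs_mul, abs_inv, abs_of_pos (hErpos c), inv_mul_le_iff₀ (hErpos c), mul_comm]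
    exact h2
  -- the index function
  classical
  -- Centre and average factor through a countable discrete index; measurability then reduces to
  -- that of the pieces.
  let _ : MeasurableSpace (Option u) := ⊤
  set idx : EuclideanSpace ℝ (Fin n) → Option u := fun y =>
    if h : ∃ c, y ∈ E c then some h.choose else none with hidx
  have hidx_mem : ∀ c, ∀ y ∈ E c, idx y = some c := fun c y hy => by
    have h : ∃ c, y ∈ E c := ⟨c, hy⟩
    simp only [hidx, dif_pos h, Option.some.injEq]
    by_contra hne
    exact disjoint_left.1 (hEd hne) h.choose_spec hy
  have hidx_none : ∀ y ∉ Ω, idx y = none := fun y hy => by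
    have h : ¬ ∃ c, y ∈ E c := fun h => hy (mem_iUnion.2 h)
    simp only [hidx, dif_neg h]
  have hidx_meas : Measurable idx := by
    refine measurable_to_countable' fun o => ?_
    cases o with
    | none =>
      have : idx ⁻¹' {none} = Ωᶜ := by
        ext y
        simp only [mem_preimage, mem_singleton_iff, mem_compl_iff]
        refine ⟨fun h hy => ?_, hidx_none y⟩
        obtain ⟨c, hc⟩ := mem_iUnion.1 hy
        rw [hidx_mem c y hc] at h
        exact Option.some_ne_none _ h
      rw [this]; exact hΩm.compl
    | some c =>
      have : idx ⁻¹' {some c} = E c := by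
        ext y
        simp only [mem_preimage, mem_singleton_iff]
        refine ⟨fun h => ?_, hidx_mem c y⟩
        by_cases hy : y ∈ Ω
        · obtain ⟨c', hc'⟩ := mem_iUnion.1 hy
          rw [hidx_mem c' y hc', Option.some.injEq] at h
          exact h ▸ hc'
        · rw [hidx_none y hy] at h
          exact absurd h.symm (Option.some_ne_none _)
      rw [this]; exact hEm c
  set cen : EuclideanSpace ℝ (Fin n) → EuclideanSpace ℝ (Fin n) := fun y =>
    (idx y).elim 0 fun c => c.1 with hcen
  have hcen_meas : Measurable cen :=
    (measurable_from_top (f := fun o : Option u => o.elim 0 fun c => c.1)).comp hidx_meas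
  have hcenE : ∀ c, ∀ y ∈ E c, cen y = c.1 := fun c y hy => by
    simp only [hcen, hidx_mem c y hy, Option.elim_some]
  set a : EuclideanSpace ℝ (Fin n) → ℝ := fun y => (idx y).elim 0 avg with ha
  have ha_meas : Measurable a :=
    (measurable_from_top (f := fun o : Option u => o.elim 0 avg)).comp hidx_meas
  have haE : ∀ c, ∀ y ∈ E c, a y = avg c := fun c y hy => by
    simp only [ha, hidx_mem c y hy, Option.elim_some]
  set β : EuclideanSpace ℝ (Fin n) → ℝ := Ω.indicator fun y => f y - a y with hβ
  have hβ_meas : AEStronglyMeasurable β :=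
    (hf.1.sub ha_meas.aestronglyMeasurable).indicator hΩm
  have hβE : ∀ c, ∀ y ∈ E c, β y = f y - avg c := fun c y hy => by
    rw [hβ, indicator_of_mem (mem_iUnion.2 ⟨c, hy⟩), haE c y hy]
  have hβ0 : ∀ y ∉ Ω, β y = 0 := fun y hy => indicator_of_notMem hy _
  have hβL1 : ∫⁻ y, ‖β y‖ₑ ≤ 2 * ∫⁻ y in Ω, ‖f y‖ₑ := by
    have h1 : ∫⁻ y, ‖β y‖ₑ = ∫⁻ y in Ω, ‖β y‖ₑ := by
      rw [← lintegral_indicator hΩm]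
      refine lintegral_congr fun y => ?_
      by_cases hy : y ∈ Ω
      · rw [indicator_of_mem hy]
      · rw [indicator_of_notMem hy, hβ0 y hy, enorm_zero]
    rw [h1, hΩ, lintegral_iUnion hEm hEd, lintegral_iUnion hEm hEd, ← ENNReal.tsum_mul_left]
    refine ENNReal.tsum_le_tsum fun c => ?_
    have h2 : ‖avg c‖ₑ * volume (E c) = ‖∫ y in E c, f y‖ₑ := by
      have h3 : ‖volume.real (E c)‖ₑ = volume (E c) := by
        rw [measureReal_def, Real.enorm_eq_ofReal ENNReal.toReal_nonneg,
          ENNReal.ofReal_toReal (hEfin c)]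
      have h4 := congrArg enorm (havg_mul c)
      rwa [enorm_mul, h3] at h4
    calc ∫⁻ y in E c, ‖β y‖ₑ ≤ ∫⁻ y in E c, (‖f y‖ₑ + ‖avg c‖ₑ) := by
          refine setLIntegral_mono_ae' (hEm c) (Eventually.of_forall fun y hy => ?_)
          rw [hβE c y hy]; exact enorm_sub_le
      _ = (∫⁻ y in E c, ‖f y‖ₑ) + ‖avg c‖ₑ * volume (E c) := by
          rw [lintegral_add_right _ measurable_const, setLIntegral_const]
      _ ≤ (∫⁻ y in E c, ‖f y‖ₑ) + ∫⁻ y in E c, ‖f y‖ₑ := by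
          rw [h2]; gcongr; exact enorm_integral_le_lintegral_enorm _
      _ = _ := (two_mul _).symm
  have hβint : Integrable β := ⟨hβ_meas, hβL1.trans_lt (ENNReal.mul_lt_top (by norm_num)
    ((lintegral_mono' Measure.restrict_le_self le_rfl).trans_lt hf.2))⟩
  refine ⟨β, cen, Ω, Ω', hΩm, hΩ'm, ?_, hβint, hcen_meas, hβ0, ?_, ?_, hβL1, ?_, ?_⟩
  · refine hEU.subset.trans ?_
    exact iUnion_mono fun c => Metric.closedBall_subset_closedBall (by linarith [hrpos c.1 c.2])
  · intro z hz y hy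
    obtain ⟨c, hc⟩ := mem_iUnion.1 hy
    rw [hcenE c y hc]
    have h1 := hEB c hc
    rw [mem_closedBall_iff_norm] at h1
    have h2 : z ∉ Metric.closedBall c.1 (10 * r c.1) := fun h => hz (mem_iUnion.2 ⟨c, h⟩)
    rw [mem_closedBall_iff_norm, not_le] at h2
    refine ⟨by linarith, fun h => ?_⟩
    rw [h, sub_self, norm_zero] at h2
    linarith [hrpos c.1 c.2]
  · rintro ψ hψ ⟨D, hD⟩
    have hint : Integrable fun y => ψ (cen y) * β y :=
      hβint.bdd_mul (c := D) (hψ.comp hcen_meas).aestronglyMeasurable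
        (Eventually.of_forall fun y => hD _)
    rw [← setIntegral_eq_integral_of_forall_compl_eq_zero (s := Ω)
      (fun y hy => by rw [hβ0 y hy, mul_zero]), hΩ,
      integral_iUnion hEm hEd hint.integrableOn]
    refine (tsum_congr fun c => ?_).trans tsum_zero
    rw [setIntegral_congr_fun (g := fun y => ψ c.1 * (f y - avg c)) (hEm c) (fun y hy => by
      simp only [hcenE c y hy, hβE c y hy]), integral_const_mul,
      integral_sub hf.integrableOn (integrableOn_const (hEfin c)), setIntegral_const,
      smul_eq_mul, mul_comm _ (avg c), havg_mul c, sub_self, mul_zero]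
  · calc volume Ω' ≤ ∑' c : u, volume (Metric.closedBall c.1 (10 * r c.1)) :=
          measure_iUnion_le _
      _ ≤ ∑' c : u, ENNReal.ofReal (10 ^ n) * (ENNReal.ofReal l)⁻¹ * ∫⁻ y in E c, ‖f y‖ₑ := by
          refine ENNReal.tsum_le_tsum fun c => ?_
          rw [volume_closedBall_mul _ (hrpos c.1 c.2).le (by norm_num), mul_assoc]
          refine mul_le_mul_right ?_ _
          rw [mul_comm, ← div_eq_mul_inv, ENNReal.le_div_iff_mul_le (Or.inl hl')
            (Or.inl ENNReal.ofReal_ne_top), mul_comm]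
          refine (hlow c.1 c.2).trans ?_
          rw [hνS _ Metric.isClosed_closedBall.measurableSet]
          exact lintegral_mono_set (hBE c)
      _ = _ := by rw [ENNReal.tsum_mul_left, hΩ, lintegral_iUnion hEm hEd]
  · have hleb := IsUnifLocDoublingMeasure.ae_tendsto_average
      (volume : Measure (EuclideanSpace ℝ (Fin n))) hf.abs.locallyIntegrable 1
    filter_upwards [hleb] with y hy
    by_cases hyΩ : y ∈ Ω
    · obtain ⟨c, hc⟩ := mem_iUnion.1 hyΩ
      rw [hβE c y hc, sub_sub_cancel]
      exact havg_bound c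
    · rw [hβ0 y hyΩ, sub_zero]
      have h1 := hy (fun _ : ℝ => y) (fun ε => ε) tendsto_id (by
        filter_upwards [self_mem_nhdsWithin] with ε (hε : 0 < ε)
        simp [hε.le])
      -- Off `Ω` every ball about `y` has density at most `l`, and the averages of `|f|` converge to
      -- `|f y|`.
      have h2 : |f y| ≤ l := by
        refine le_of_tendsto h1 ?_
        filter_upwards [self_mem_nhdsWithin] with ε (hε : 0 < ε)
        have h3 := hout y (fun c hc hyc => hyΩ
          (hEU.superset (mem_iUnion.2 ⟨⟨c, hc⟩, hyc⟩))) ε hε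
        rw [hνS _ Metric.isClosed_closedBall.measurableSet] at h3
        have hv : 0 < volume.real (Metric.closedBall y ε) :=
          ENNReal.toReal_pos (Metric.measure_closedBall_pos volume y hε).ne'
            measure_closedBall_lt_top.ne
        rw [setAverage_eq, smul_eq_mul, inv_mul_le_iff₀ hv, mul_comm]
        have h4 := ENNReal.toReal_mono (ENNReal.mul_ne_top ENNReal.ofReal_ne_top
          measure_closedBall_lt_top.ne) h3
        rw [ENNReal.toReal_mul, ENNReal.toReal_ofReal hl.le] at h4
        refine le_trans (le_of_eq ?_) h4
        exact integral_norm_eq_lintegral_enorm hf.1.restrict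
      refine h2.trans (le_mul_of_one_le_left hl.le (one_le_pow₀ (by norm_num)))

lemma mul_le_of_reciprocal_bounds {v G w w' c₁ c₂ I L D η : ℝ≥0∞} (h₁ : v ≤ c₁ * w * L)
    (h₂ : G ≤ c₂ * w' * I) (hw : w * w' = 1) (hD : c₁ * (c₂ * I) ≤ D) (hη : D * L ≤ η) :
    v * G ≤ η := by
  calc v * G ≤ (c₁ * w * L) * (c₂ * w' * I) := mul_le_mul' h₁ h₂
    _ = (w * w') * (c₁ * (c₂ * I) * L) := by ring
    _ = c₁ * (c₂ * I) * L := by rw [hw, one_mul]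
    _ ≤ D * L := mul_le_mul_left hD L
    _ ≤ η := hη

/-- A Calderón-Zygmund decomposition whose bad part is as small as desired. -/
lemma exists_CZ_small (hn : 1 ≤ n) {f : EuclideanSpace ℝ (Fin n) → ℝ} (hf : Integrable f)
    {η : ℝ≥0∞} (hη : 0 < η) :
    ∃ (β : EuclideanSpace ℝ (Fin n) → ℝ) (cen : EuclideanSpace ℝ (Fin n) → EuclideanSpace ℝ (Fin n))
      (Ω Ω' : Set (EuclideanSpace ℝ (Fin n))),
      MeasurableSet Ω ∧ MeasurableSet Ω' ∧ Ω ⊆ Ω' ∧ Integrable β ∧ Measurable cen ∧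
      (∀ y ∉ Ω, β y = 0) ∧
      (∀ z ∉ Ω', ∀ y ∈ Ω, 2 * ‖y - cen y‖ ≤ ‖z - cen y‖ ∧ z ≠ cen y) ∧
      (∀ ψ : EuclideanSpace ℝ (Fin n) → ℝ, Measurable ψ → (∃ D, ∀ c, |ψ c| ≤ D) →
        ∫ y, ψ (cen y) * β y = 0) ∧
      ∫⁻ y, ‖β y‖ₑ ≤ η ∧ volume Ω' ≤ η ∧ MemLp (fun y => f y - β y) 2 ∧
      volume Ω' * eLpNorm (fun y => f y - β y) 2 ^ 2 ≤ η := by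
  set I := ∫⁻ y, ‖f y‖ₑ with hI
  have hItop : I ≠ ∞ := hf.2.ne
  obtain ⟨c₁, hc₁⟩ : ∃ c, c = ENNReal.ofReal (10 ^ n) := ⟨_, rfl⟩
  obtain ⟨c₂, hc₂⟩ : ∃ c, c = ENNReal.ofReal (5 ^ n) := ⟨_, rfl⟩
  have hc₁t : c₁ ≠ ∞ := hc₁ ▸ ENNReal.ofReal_ne_top
  have hc₂t : c₂ ≠ ∞ := hc₂ ▸ ENNReal.ofReal_ne_top
  -- The three summands serve the three bounds, on `‖β‖₁`, on `volume Ω'` and on its product with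
  -- `‖g‖₂²`, each at most `D` times the mass of `f` on `Ω`.
  obtain ⟨D, hD⟩ : ∃ D, D = 2 + c₁ + c₁ * (c₂ * (3 * I)) := ⟨_, rfl⟩
  have hDt : D ≠ ∞ := by rw [hD]; finiteness
  have hD0 : D ≠ 0 := by simp [hD]
  have hη' : η / D ≠ 0 := (ENNReal.div_pos hη.ne' hDt).ne'
  -- Absolute continuity of the integral: a large height makes `Ω` small in measure, hence `∫_Ω |f|`
  -- small.
  obtain ⟨δ, hδ, hsmall⟩ := exists_pos_setLIntegral_lt_of_measure_lt hItop hη'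
  have hlarge : ∃ l : ℝ, 1 ≤ l ∧ c₁ * (ENNReal.ofReal l)⁻¹ * I < δ := by
    have h1 : Tendsto (fun k : ℕ => c₁ * (ENNReal.ofReal ((k : ℝ) + 1))⁻¹ * I) atTop (𝓝 0) := by
      have h2 : Tendsto (fun k : ℕ => (ENNReal.ofReal ((k : ℝ) + 1))⁻¹) atTop (𝓝 0) := by
        have : ∀ k : ℕ, ENNReal.ofReal ((k : ℝ) + 1) = ((k + 1 : ℕ) : ℝ≥0∞) := fun k => by
          rw [← ENNReal.ofReal_natCast]; push_cast; rfl
        simp_rw [this]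
        exact (tendsto_add_atTop_iff_nat 1).2 ENNReal.tendsto_inv_nat_nhds_zero
      have h3 := ENNReal.Tendsto.mul_const (ENNReal.Tendsto.const_mul h2 (Or.inr hc₁t))
        (Or.inr hItop)
      simpa using h3
    obtain ⟨k, hk⟩ := (h1.eventually_lt_const hδ).exists
    exact ⟨k + 1, by linarith [(Nat.cast_nonneg k : (0 : ℝ) ≤ k)], hk⟩
  obtain ⟨l, hl1, hlδ⟩ := hlarge
  have hl : 0 < l := one_pos.trans_le hl1
  obtain ⟨β, cen, Ω, Ω', hΩ, hΩ', hsub, hβ, hcen, hβ0, hdist, hmean, hβ1, hvol, hg⟩ :=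
    exists_CZ_at_height hn hf hl
  rw [← hc₁] at hvol
  set L := ∫⁻ y in Ω, ‖f y‖ₑ with hL
  have hLI : L ≤ I := lintegral_mono' Measure.restrict_le_self le_rfl
  have hLsmall : L ≤ η / D := by
    refine (hsmall Ω ?_).le
    refine (measure_mono hsub).trans_lt (hvol.trans_lt (lt_of_le_of_lt ?_ hlδ))
    gcongr
  have hDL : D * L ≤ η := by
    calc D * L ≤ D * (η / D) := by gcongr
      _ = η := ENNReal.mul_div_cancel hD0 hDt
  have hinv : (ENNReal.ofReal l)⁻¹ ≤ 1 := by
    rw [ENNReal.inv_le_one, ← ENNReal.ofReal_one]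
    exact ENNReal.ofReal_le_ofReal hl1
  set g : EuclideanSpace ℝ (Fin n) → ℝ := fun y => f y - β y with hgdef
  have hgint : Integrable g := hf.sub hβ
  have hg1 : ∫⁻ y, ‖g y‖ₑ ≤ 3 * I := by
    calc ∫⁻ y, ‖g y‖ₑ ≤ ∫⁻ y, (‖f y‖ₑ + ‖β y‖ₑ) := lintegral_mono fun y => enorm_sub_le
      _ = I + ∫⁻ y, ‖β y‖ₑ := lintegral_add_left' hf.1.enorm _
      _ ≤ I + 2 * I := by gcongr; exact hβ1.trans (by gcongr)
      _ = 3 * I := by ring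
  have hg2 : eLpNorm g 2 ^ 2 ≤ c₂ * ENNReal.ofReal l * (3 * I) := by
    have h1 : eLpNorm g 2 ^ 2 = ∫⁻ y, ‖g y‖ₑ ^ 2 := by
      rw [eLpNorm_eq_lintegral_rpow_enorm_toReal two_ne_zero ENNReal.ofNat_ne_top,
        ← ENNReal.rpow_natCast, ← ENNReal.rpow_mul]
      simp
    rw [h1]
    calc ∫⁻ y, ‖g y‖ₑ ^ 2 ≤ ∫⁻ y, c₂ * ENNReal.ofReal l * ‖g y‖ₑ := by
          refine lintegral_mono_ae ?_
          filter_upwards [hg] with y hy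
          rw [pow_two]
          gcongr
          rw [hc₂, ← ENNReal.ofReal_mul (by positivity), ← ofReal_norm]
          exact ENNReal.ofReal_le_ofReal hy
      _ = c₂ * ENNReal.ofReal l * ∫⁻ y, ‖g y‖ₑ :=
          lintegral_const_mul' _ _ (ENNReal.mul_ne_top hc₂t ENNReal.ofReal_ne_top)
      _ ≤ _ := by gcongr
  refine ⟨β, cen, Ω, Ω', hΩ, hΩ', hsub, hβ, hcen, hβ0, hdist, hmean, ?_, ?_, ⟨hgint.1, ?_⟩, ?_⟩
  · refine hβ1.trans (le_trans ?_ hDL)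
    gcongr
    rw [hD, add_assoc]
    exact le_self_add
  · refine hvol.trans (le_trans ?_ hDL)
    gcongr
    calc c₁ * (ENNReal.ofReal l)⁻¹ ≤ c₁ * 1 := by gcongr
      _ = c₁ := mul_one _
      _ ≤ D := by rw [hD, add_comm 2 c₁, add_assoc]; exact le_self_add
  · have : eLpNorm g 2 ^ 2 < ∞ := hg2.trans_lt (by finiteness)
    by_contra h
    rw [not_lt, top_le_iff] at h
    rw [h] at this
    simp at this
  · have hll : (ENNReal.ofReal l)⁻¹ * ENNReal.ofReal l = 1 :=
      ENNReal.inv_mul_cancel (ENNReal.ofReal_pos.2 hl).ne' ENNReal.ofReal_ne_top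
    exact mul_le_of_reciprocal_bounds hvol hg2 hll (hD ▸ le_add_self) hDL

end Decomposition

/-! ### The singular integral of the bad part -/

section BadPart

variable {n d : ℕ} {P : MvPolynomial (Fin n) ℝ}

lemma exists_cutKernel_bound (hP : P.IsHomogeneous d) :
    ∃ A : ℝ, 0 ≤ A ∧ ∀ ε > 0, ∀ w, |cutKernel d P ε w| ≤ A * (ε ^ n)⁻¹ := by
  obtain ⟨A, hA, hK⟩ := exists_kernel_bound hP
  refine ⟨A, hA, fun ε hε w => ?_⟩
  unfold cutKernel
  split_ifs with h
  · refine (hK w).trans ?_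
    gcongr
  · rw [abs_zero]; positivity

lemma tendsto_mul_nhdsGT_zero {c : ℝ} (hc : 0 < c) :
    Tendsto (fun δ : ℝ => c * δ) (𝓝[>] 0) (𝓝[>] 0) := by
  refine tendsto_nhdsWithin_iff.2 ⟨?_, ?_⟩
  · have : Tendsto (fun δ : ℝ => c * δ) (𝓝 0) (𝓝 (c * 0)) := tendsto_id.const_mul c
    rw [mul_zero] at this
    exact this.mono_left nhdsWithin_le_nhds
  · filter_upwards [self_mem_nhdsWithin] with δ (hδ : 0 < δ)
    exact mul_pos hc hδ

/-- An integrable function supported in `Ω`, with mean zero on every piece of `Ω`, the pieces being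
the fibres of `cen` and being far from the complement of `Ω'`. -/
structure IsBadPart (β : EuclideanSpace ℝ (Fin n) → ℝ)
    (cen : EuclideanSpace ℝ (Fin n) → EuclideanSpace ℝ (Fin n))
    (Ω Ω' : Set (EuclideanSpace ℝ (Fin n))) : Prop where
  measurableSet : MeasurableSet Ω
  measurableSet' : MeasurableSet Ω'
  subset : Ω ⊆ Ω'
  integrable : Integrable β
  measurable_cen : Measurable cen
  eq_zero : ∀ y ∉ Ω, β y = 0
  far : ∀ z ∉ Ω', ∀ y ∈ Ω, 2 * ‖y - cen y‖ ≤ ‖z - cen y‖ ∧ z ≠ cen y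
  mean_zero : ∀ ψ : EuclideanSpace ℝ (Fin n) → ℝ, Measurable ψ → (∃ D, ∀ c, |ψ c| ≤ D) →
    ∫ y, ψ (cen y) * β y = 0

variable {β : EuclideanSpace ℝ (Fin n) → ℝ}
  {cen : EuclideanSpace ℝ (Fin n) → EuclideanSpace ℝ (Fin n)}
  {Ω Ω' : Set (EuclideanSpace ℝ (Fin n))}

/-- The mass of the bad part weighted with the tails of its pieces. -/
def badTail (β : EuclideanSpace ℝ (Fin n) → ℝ)
    (cen : EuclideanSpace ℝ (Fin n) → EuclideanSpace ℝ (Fin n))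
    (z : EuclideanSpace ℝ (Fin n)) : ℝ≥0∞ :=
  ∫⁻ y, ENNReal.ofReal (tailKernel ‖y - cen y‖ (z - cen y)) * ‖β y‖ₑ

lemma IsBadPart.aemeasurable_tail (h : IsBadPart β cen Ω Ω') :
    AEMeasurable (Function.uncurry fun z y : EuclideanSpace ℝ (Fin n) =>
      ENNReal.ofReal (tailKernel ‖y - cen y‖ (z - cen y)) * ‖β y‖ₑ) (volume.prod volume) := by
  have hc : Measurable fun q : EuclideanSpace ℝ (Fin n) × EuclideanSpace ℝ (Fin n) => cen q.2 :=
    h.measurable_cen.comp measurable_snd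
  have h1 : Measurable fun q : EuclideanSpace ℝ (Fin n) × EuclideanSpace ℝ (Fin n) =>
      ((‖q.2 - cen q.2‖, q.1 - cen q.2) : ℝ × EuclideanSpace ℝ (Fin n)) :=
    ((measurable_snd.sub hc).norm).prodMk (measurable_fst.sub hc)
  have h2 : AEMeasurable (fun q : EuclideanSpace ℝ (Fin n) × EuclideanSpace ℝ (Fin n) =>
      ‖β q.2‖ₑ) (volume.prod volume) := (h.integrable.1.comp_snd).enorm
  exact ((measurable_tailKernel.comp h1).ennreal_ofReal.aemeasurable).mul h2

lemma IsBadPart.aemeasurable_badTail (h : IsBadPart β cen Ω Ω') :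
    AEMeasurable (badTail β cen) :=
  h.aemeasurable_tail.lintegral_prod_right'

/-- Tonelli, with the scale-independent bound on the integral of the tail kernel. -/
lemma exists_lintegral_badTail_le : ∃ C : ℝ≥0, ∀ (β : EuclideanSpace ℝ (Fin n) → ℝ)
    (cen : EuclideanSpace ℝ (Fin n) → EuclideanSpace ℝ (Fin n))
    (Ω Ω' : Set (EuclideanSpace ℝ (Fin n))), IsBadPart β cen Ω Ω' →
    ∫⁻ z, badTail β cen z ≤ C * ∫⁻ y, ‖β y‖ₑ := by
  obtain ⟨C, hC⟩ := lintegral_tailKernel_le (n := n)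
  refine ⟨C, fun β cen Ω Ω' h => ?_⟩
  unfold badTail
  rw [lintegral_lintegral_swap h.aemeasurable_tail, ← lintegral_const_mul' _ _ ENNReal.coe_ne_top]
  refine lintegral_mono fun y => ?_
  rw [lintegral_mul_const' _ _ enorm_ne_top,
    lintegral_sub_right_eq_self (fun z => ENNReal.ofReal (tailKernel ‖y - cen y‖ z)) (cen y)]
  gcongr
  exact hC _ (norm_nonneg _)

/-- The integrand whose integral is the singular integral of the bad part. -/
def badDiff (d : ℕ) (P : MvPolynomial (Fin n) ℝ) (β : EuclideanSpace ℝ (Fin n) → ℝ)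
    (cen : EuclideanSpace ℝ (Fin n) → EuclideanSpace ℝ (Fin n))
    (z y : EuclideanSpace ℝ (Fin n)) : ℝ :=
  (kernel d P (z - y) - kernel d P (z - cen y)) * β y

lemma IsBadPart.exists_enorm_badDiff_le (hP : P.IsHomogeneous d) :
    ∃ A : ℝ≥0, ∀ (β : EuclideanSpace ℝ (Fin n) → ℝ)
    (cen : EuclideanSpace ℝ (Fin n) → EuclideanSpace ℝ (Fin n))
    (Ω Ω' : Set (EuclideanSpace ℝ (Fin n))), IsBadPart β cen Ω Ω' → ∀ z ∉ Ω', ∀ y,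
    ‖badDiff d P β cen z y‖ₑ ≤
      A * (ENNReal.ofReal (tailKernel ‖y - cen y‖ (z - cen y)) * ‖β y‖ₑ) := by
  obtain ⟨A, hA, hK⟩ := exists_kernel_lipschitz hP
  refine ⟨⟨A, hA⟩, fun β cen Ω Ω' h z hz y => ?_⟩
  unfold badDiff
  by_cases hy : y ∈ Ω
  · obtain ⟨h1, -⟩ := h.far z hz y hy
    have e : ‖(z - y) - (z - cen y)‖ = ‖y - cen y‖ := by
      rw [sub_sub_sub_cancel_left, norm_sub_rev]
    have h2 := hK (z - y) (z - cen y) (by rwa [e])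
    rw [e] at h2
    rw [enorm_mul, ← mul_assoc]
    gcongr
    rw [tailKernel, if_pos h1, ← ofReal_norm, Real.norm_eq_abs]
    refine (ENNReal.ofReal_le_ofReal h2).trans ?_
    rw [ENNReal.ofReal_mul hA, ENNReal.ofReal_eq_coe_nnreal hA]
    exact le_rfl
  · simp [h.eq_zero y hy]

lemma IsBadPart.integrable_badDiff (hP : P.IsHomogeneous d) (h : IsBadPart β cen Ω Ω')
    {z : EuclideanSpace ℝ (Fin n)} (hz : z ∉ Ω') (hfin : badTail β cen z ≠ ∞) :
    Integrable (badDiff d P β cen z) := by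
  obtain ⟨A, hA⟩ := IsBadPart.exists_enorm_badDiff_le hP
  have hm : Measurable fun y => kernel d P (z - y) - kernel d P (z - cen y) :=
    ((measurable_kernel d P).comp (measurable_const.sub measurable_id)).sub
      ((measurable_kernel d P).comp (measurable_const.sub h.measurable_cen))
  refine ⟨hm.aestronglyMeasurable.mul h.integrable.1, ?_⟩
  refine (lintegral_mono (hA β cen Ω Ω' h z hz)).trans_lt ?_
  rw [lintegral_const_mul' _ _ ENNReal.coe_ne_top]
  exact ENNReal.mul_lt_top ENNReal.coe_lt_top hfin.lt_top

/-- Replacing a truncation about `y` by a truncation about `cen y` changes the kernel only in a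
ball comparable with the truncation. -/
lemma IsBadPart.exists_truncation_error (hP : P.IsHomogeneous d) :
    ∃ A : ℝ, 0 ≤ A ∧ ∀ (β : EuclideanSpace ℝ (Fin n) → ℝ)
    (cen : EuclideanSpace ℝ (Fin n) → EuclideanSpace ℝ (Fin n))
    (Ω Ω' : Set (EuclideanSpace ℝ (Fin n))), IsBadPart β cen Ω Ω' → ∀ z ∉ Ω', ∀ δ > 0, ∀ y,
    |(cutKernel d P δ (z - y) - cutKernel d P δ (z - cen y)) * β y -
      (if δ < ‖z - cen y‖ then badDiff d P β cen z y else 0)| ≤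
      A * ((2 * δ) ^ n)⁻¹ * (Metric.closedBall z (2 * δ)).indicator (fun y => |β y|) y := by
  obtain ⟨A, hA, hK⟩ := exists_kernel_bound hP
  refine ⟨A * 4 ^ n, by positivity, fun β cen Ω Ω' h z hz δ hδ y => ?_⟩
  have hR : 0 ≤ A * 4 ^ n * ((2 * δ) ^ n)⁻¹ *
      (Metric.closedBall z (2 * δ)).indicator (fun y => |β y|) y :=
    mul_nonneg (by positivity) (indicator_nonneg (fun _ _ => abs_nonneg _) _)
  by_cases hy : y ∈ Ω
  swap
  · have : β y = 0 := h.eq_zero y hy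
    simpa [badDiff, this] using hR
  obtain ⟨h1, -⟩ := h.far z hz y hy
  have t1 : ‖z - y‖ ≤ ‖z - cen y‖ + ‖y - cen y‖ := by
    have := norm_sub_le (z - cen y) (y - cen y)
    rwa [sub_sub_sub_cancel_right] at this
  have t2 : ‖z - cen y‖ ≤ ‖z - y‖ + ‖y - cen y‖ := by
    have := norm_add_le (z - y) (y - cen y)
    rwa [sub_add_sub_cancel] at this
  have main : δ / 2 ≤ ‖z - y‖ → ‖z - y‖ ≤ 2 * δ → |kernel d P (z - y) * β y| ≤
      A * 4 ^ n * ((2 * δ) ^ n)⁻¹ *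
      (Metric.closedBall z (2 * δ)).indicator (fun y => |β y|) y := by
    intro h2 h3
    rw [indicator_of_mem (by rwa [Metric.mem_closedBall, dist_comm, dist_eq_norm]), abs_mul]
    refine mul_le_mul_of_nonneg_right ((hK _).trans ?_) (abs_nonneg _)
    have : (‖z - y‖ ^ n)⁻¹ ≤ ((δ / 2) ^ n)⁻¹ := by gcongr
    refine (mul_le_mul_of_nonneg_left this hA).trans (le_of_eq ?_)
    rw [mul_assoc]
    congr 1
    have : (4 : ℝ) ^ n * (δ / 2) ^ n = (2 * δ) ^ n := by rw [← mul_pow]; ring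
    rw [← this]
    field_simp
  unfold cutKernel badDiff
  by_cases ha : δ < ‖z - y‖ <;> by_cases hb : δ < ‖z - cen y‖
  · rw [if_pos ha, if_pos hb, if_pos hb, sub_self, abs_zero]; exact hR
  · rw [if_pos ha, if_neg hb, if_neg hb, sub_zero, sub_zero]
    exact main (by linarith) (by linarith)
  · rw [if_neg ha, if_pos hb, if_pos hb]
    have := main (by linarith) (by linarith)
    rw [← abs_neg] at this
    convert this using 2
    ring
  · rw [if_neg ha, if_neg hb, if_neg hb]; simpa using hR

/-- Mean zero permits subtracting the kernel frozen at the centre of each piece. The difference is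
integrable off `Ω'`, and the mismatch between the two truncations is an average of `|β|` over `B(z,
2δ)`. -/
lemma IsBadPart.hasPrincipalValue (hP : P.IsHomogeneous d) (h : IsBadPart β cen Ω Ω') :
    ∀ᵐ z, z ∉ Ω' → HasPrincipalValue d P β z (∫ y, badDiff d P β cen z y) := by
  have hfin : ∀ᵐ z, badTail β cen z < ∞ := by
    obtain ⟨C, hC⟩ := exists_lintegral_badTail_le (n := n)
    exact ae_lt_top' h.aemeasurable_badTail
      ((hC β cen Ω Ω' h).trans_lt (ENNReal.mul_lt_top ENNReal.coe_lt_top h.integrable.2)).ne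
  obtain ⟨A, hA, herr⟩ := IsBadPart.exists_truncation_error hP
  obtain ⟨A', hA', hcut⟩ := exists_cutKernel_bound hP
  filter_upwards [hfin, ae_tendsto_scaled_integral h.integrable.locallyIntegrable]
    with z hz hleb hzΩ
  -- At a Lebesgue point where `β` vanishes the averages of `|β|` tend to zero, which disposes of
  -- the truncation error.
  have hβz : β z = 0 := h.eq_zero z fun hz' => hzΩ (h.subset hz')
  simp only [hβz, sub_zero] at hleb
  have hD : Integrable (badDiff d P β cen z) := h.integrable_badDiff hP hzΩ hz.ne
  have hmeas : ∀ δ : ℝ, MeasurableSet {y | δ < ‖z - cen y‖} := fun δ =>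
    measurableSet_lt measurable_const (measurable_const.sub h.measurable_cen).norm
  -- the main term
  have hmain : Tendsto (fun δ : ℝ => ∫ y, if δ < ‖z - cen y‖ then badDiff d P β cen z y else 0)
      (𝓝[>] 0) (𝓝 (∫ y, badDiff d P β cen z y)) := by
    refine tendsto_integral_filter_of_dominated_convergence (fun y => ‖badDiff d P β cen z y‖)
      (Eventually.of_forall fun δ => ?_) (Eventually.of_forall fun δ =>
        Eventually.of_forall fun y => ?_) hD.norm (Eventually.of_forall fun y => ?_)
    · exact (hD.1.indicator (hmeas δ))
    · split_ifs <;> simp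
    · by_cases hy : y ∈ Ω
      · have hpos : 0 < ‖z - cen y‖ := norm_pos_iff.2 (sub_ne_zero.2 (h.far z hzΩ y hy).2)
        refine tendsto_const_nhds.congr' ?_
        filter_upwards [nhdsWithin_le_nhds (Iio_mem_nhds hpos)] with δ (hδ : δ < _)
        rw [if_pos hδ]
      · simp [badDiff, h.eq_zero y hy]
  -- the error term
  have herr0 : Tendsto (fun δ : ℝ => truncated d P δ β z -
      ∫ y, if δ < ‖z - cen y‖ then badDiff d P β cen z y else 0) (𝓝[>] 0) (𝓝 0) := by
    have hlim : Tendsto (fun δ : ℝ => A * (((2 * δ) ^ n)⁻¹ *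
        ∫ y in Metric.closedBall z (2 * δ), |β y|)) (𝓝[>] 0) (𝓝 0) := by
      have := (hleb.comp (tendsto_mul_nhdsGT_zero two_pos)).const_mul A
      simpa using this
    refine squeeze_zero_norm' ?_ hlim
    filter_upwards [self_mem_nhdsWithin] with δ (hδ : 0 < δ)
    have hm1 : Measurable fun y => cutKernel d P δ (z - y) :=
      (measurable_cutKernel d P δ).comp (measurable_const.sub measurable_id)
    have hmc : Measurable fun c => cutKernel d P δ (z - c) := hm1
    have hi1 : Integrable fun y => cutKernel d P δ (z - y) * β y :=
      h.integrable.bdd_mul (c := A' * (δ ^ n)⁻¹) hm1.aestronglyMeasurable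
        (Eventually.of_forall fun y => hcut δ hδ _)
    have hi2 : Integrable fun y => cutKernel d P δ (z - cen y) * β y :=
      h.integrable.bdd_mul (c := A' * (δ ^ n)⁻¹)
        (hmc.comp h.measurable_cen).aestronglyMeasurable
        (Eventually.of_forall fun y => hcut δ hδ _)
    have hi3 : Integrable fun y => if δ < ‖z - cen y‖ then badDiff d P β cen z y else 0 :=
      hD.indicator (hmeas δ)
    have e1 : truncated d P δ β z =
        ∫ y, (cutKernel d P δ (z - y) - cutKernel d P δ (z - cen y)) * β y := by
      simp_rw [sub_mul]
      -- The mean zero property is used with the truncated kernel as test function; unlike `K`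
      -- itself, it is bounded.
      rw [integral_sub hi1 hi2, h.mean_zero (fun c => cutKernel d P δ (z - c)) hmc
        ⟨A' * (δ ^ n)⁻¹, fun c => hcut δ hδ _⟩, sub_zero, truncated_eq]
      rfl
    have hi12 : Integrable fun y =>
        (cutKernel d P δ (z - y) - cutKernel d P δ (z - cen y)) * β y := by
      simp_rw [sub_mul]; exact hi1.sub hi2
    rw [e1, ← integral_sub hi12 hi3]
    have hi4 : Integrable fun y => A * ((2 * δ) ^ n)⁻¹ *
        (Metric.closedBall z (2 * δ)).indicator (fun y => |β y|) y :=
      (h.integrable.abs.indicator Metric.isClosed_closedBall.measurableSet).const_mul _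
    refine (norm_integral_le_of_norm_le hi4 (Eventually.of_forall fun y =>
      herr β cen Ω Ω' h z hzΩ δ hδ y)).trans (le_of_eq ?_)
    rw [integral_const_mul, integral_indicator Metric.isClosed_closedBall.measurableSet, mul_assoc]
  have := herr0.add hmain
  simpa [HasPrincipalValue] using this

/-- The singular integral of the bad part exists almost everywhere off `Ω'`, and is controlled
there by the bad part in `L¹`. -/
lemma exists_badPart_transform (hP : P.IsHomogeneous d) : ∃ C : ℝ≥0,
    ∀ (β : EuclideanSpace ℝ (Fin n) → ℝ)
    (cen : EuclideanSpace ℝ (Fin n) → EuclideanSpace ℝ (Fin n))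
    (Ω Ω' : Set (EuclideanSpace ℝ (Fin n))), IsBadPart β cen Ω Ω' →
    ∃ h : EuclideanSpace ℝ (Fin n) → ℝ, (∀ᵐ z, z ∉ Ω' → HasPrincipalValue d P β z (h z)) ∧
      ∫⁻ z in Ω'ᶜ, ‖h z‖ₑ ≤ C * ∫⁻ y, ‖β y‖ₑ := by
  obtain ⟨C, hC⟩ := exists_lintegral_badTail_le (n := n)
  obtain ⟨A, hA⟩ := IsBadPart.exists_enorm_badDiff_le (n := n) hP
  refine ⟨A * C, fun β cen Ω Ω' h => ⟨_, h.hasPrincipalValue hP, ?_⟩⟩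
  calc ∫⁻ z in Ω'ᶜ, ‖∫ y, badDiff d P β cen z y‖ₑ
      ≤ ∫⁻ z in Ω'ᶜ, A * badTail β cen z := by
        refine setLIntegral_mono_ae' h.measurableSet'.compl (Eventually.of_forall fun z hz => ?_)
        refine (enorm_integral_le_lintegral_enorm _).trans ?_
        rw [badTail, ← lintegral_const_mul' _ _ ENNReal.coe_ne_top]
        exact lintegral_mono (hA β cen Ω Ω' h z hz)
    _ ≤ ∫⁻ z, A * badTail β cen z := lintegral_mono' Measure.restrict_le_self le_rfl
    _ = A * ∫⁻ z, badTail β cen z := lintegral_const_mul' _ _ ENNReal.coe_ne_top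
    _ ≤ A * (C * ∫⁻ y, ‖β y‖ₑ) := by gcongr; exact hC β cen Ω Ω' h
    _ = _ := by rw [ENNReal.coe_mul, mul_assoc]

end BadPart

/-! ### Functions with absolutely convergent truncations -/

section Tame

variable {n d : ℕ} {P : MvPolynomial (Fin n) ℝ} {f g : EuclideanSpace ℝ (Fin n) → ℝ}

/-- Integrability against the weight `(1 + |x|)⁻ⁿ`. -/
def IsTame (f : EuclideanSpace ℝ (Fin n) → ℝ) : Prop := Integrable fun y => weight y * f y

lemma IsTame.aestronglyMeasurable (hf : IsTame f) : AEStronglyMeasurable f := by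
  have h := (measurable_weight (n := n)).inv.aestronglyMeasurable.mul hf.1
  refine h.congr (Eventually.of_forall fun y => ?_)
  simp only [Pi.mul_apply, Pi.inv_apply]
  rw [inv_mul_cancel_left₀ (weight_pos y).ne']

lemma IsTame.add (hf : IsTame f) (hg : IsTame g) : IsTame fun y => f y + g y := by
  unfold IsTame
  simp_rw [mul_add]
  exact Integrable.add hf hg

lemma IsTame.indicator (hf : IsTame f) {s : Set (EuclideanSpace ℝ (Fin n))}
    (hs : MeasurableSet s) : IsTame (s.indicator f) := by
  have := Integrable.indicator hf hs
  refine this.congr (Eventually.of_forall fun y => ?_)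
  by_cases hy : y ∈ s
  · simp only [indicator_of_mem hy]
  · simp only [indicator_of_notMem hy, mul_zero]

lemma IsTame.of_integrable (hf : Integrable f) : IsTame f :=
  hf.bdd_mul (c := 1) measurable_weight.aestronglyMeasurable (Eventually.of_forall fun y => by
    rw [Real.norm_of_nonneg (weight_pos y).le]; exact weight_le_one y)

/-- Hölder: the conjugate exponent of a finite `p` exceeds `1`, where `weight` is integrable. -/
lemma IsTame.of_memLp (hn : 1 ≤ n) {p : ℝ≥0∞} (hp : 1 ≤ p) (hp' : p ≠ ∞) (hf : MemLp f p) :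
    IsTame f := by
  have h1 : p.HolderConjugate p.conjExponent := ENNReal.HolderConjugate.conjExponent hp
  have h2 : 1 < p.conjExponent := by
    rw [ENNReal.conjExponent]
    refine ENNReal.lt_add_right ENNReal.one_ne_top (ENNReal.inv_ne_zero.2 ?_)
    exact ENNReal.sub_ne_top hp'
  have h3 : p.conjExponent.HolderConjugate p := ENNReal.HolderConjugate.symm
  exact (memLp_weight hn h2).integrable_mul hf

lemma IsTame.integrableOn_ball (hf : IsTame f) (x : EuclideanSpace ℝ (Fin n)) (R : ℝ) :
    IntegrableOn f (Metric.ball x R) := by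
  have h := (Integrable.integrableOn hf (s := Metric.ball x R)).norm.const_mul
    ((1 + (‖x‖ + R)) ^ n)
  refine Integrable.mono' h hf.aestronglyMeasurable.restrict ?_
  refine (ae_restrict_iff' measurableSet_ball).2 (Eventually.of_forall fun y hy => ?_)
  rw [mem_ball_iff_norm] at hy
  have h1 : ‖y‖ ≤ ‖x‖ + R := by
    have := norm_add_le x (y - x)
    rw [add_sub_cancel] at this
    linarith
  rw [norm_mul, Real.norm_of_nonneg (weight_pos y).le, ← mul_assoc]
  refine le_mul_of_one_le_left (norm_nonneg _) ?_
  rw [weight, ← div_eq_mul_inv, one_le_div (by positivity)]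
  gcongr

lemma exists_cutKernel_le_weight (hP : P.IsHomogeneous d) :
    ∃ A : ℝ, 0 ≤ A ∧ ∀ ε > 0, ∀ x y,
      |cutKernel d P ε (x - y)| ≤ A * (ε ^ n)⁻¹ * (1 + ‖x‖ + ε) ^ n * weight y := by
  obtain ⟨A, hA, hK⟩ := exists_kernel_bound hP
  refine ⟨A * 2 ^ n, by positivity, fun ε hε x y => ?_⟩
  have h1 : ∀ w, |cutKernel d P 1 w| ≤ A * 2 ^ n * weight w := by
    intro w
    unfold cutKernel
    split_ifs with hw
    · refine (hK w).trans ?_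
      rw [mul_assoc]
      refine mul_le_mul_of_nonneg_left ?_ hA
      rw [weight, ← div_eq_mul_inv, ← div_pow, ← inv_pow]
      refine pow_le_pow_left₀ (by positivity) ?_ n
      rw [inv_eq_one_div, div_le_div_iff₀ (by linarith) (by linarith)]
      linarith
    · rw [abs_zero]
      have := weight_pos w
      positivity
  rw [cutKernel_scale hP hε, abs_mul, abs_of_pos (by positivity)]
  calc (ε ^ n)⁻¹ * |cutKernel d P 1 (ε⁻¹ • (x - y))|
      ≤ (ε ^ n)⁻¹ * (A * 2 ^ n * ((1 + ‖x‖ + ε) ^ n * weight y)) := by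
        gcongr
        exact (h1 _).trans (by gcongr; exact weight_affine_le x y hε)
    _ = _ := by ring

lemma exists_enorm_cutKernel_mul_le (hP : P.IsHomogeneous d) :
    ∃ A : ℝ, 0 ≤ A ∧ ∀ (f : EuclideanSpace ℝ (Fin n) → ℝ), ∀ ε > 0, ∀ x y,
      ‖cutKernel d P ε (x - y) * f y‖ₑ ≤
        ENNReal.ofReal (A * (ε ^ n)⁻¹ * (1 + ‖x‖ + ε) ^ n) * ‖weight y * f y‖ₑ := by
  obtain ⟨A, hA, hK⟩ := exists_cutKernel_le_weight hP
  refine ⟨A, hA, fun f ε hε x y => ?_⟩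
  rw [enorm_mul, enorm_mul, ← mul_assoc]
  gcongr
  rw [← ofReal_norm, ← ofReal_norm, Real.norm_of_nonneg (weight_pos y).le,
    ← ENNReal.ofReal_mul (by positivity)]
  exact ENNReal.ofReal_le_ofReal (hK ε hε x y)

lemma IsTame.integrable_cutKernel_mul (hP : P.IsHomogeneous d) (hf : IsTame f) {ε : ℝ}
    (hε : 0 < ε) (x : EuclideanSpace ℝ (Fin n)) :
    Integrable fun y => cutKernel d P ε (x - y) * f y := by
  obtain ⟨A, hA, hK⟩ := exists_enorm_cutKernel_mul_le hP
  refine ⟨((measurable_cutKernel d P ε).comp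
    (measurable_const.sub measurable_id)).aestronglyMeasurable.mul hf.aestronglyMeasurable, ?_⟩
  refine (lintegral_mono (hK f ε hε x)).trans_lt ?_
  rw [lintegral_const_mul' _ _ ENNReal.ofReal_ne_top]
  exact ENNReal.mul_lt_top ENNReal.ofReal_lt_top hf.2

lemma IsTame.truncated_add (hP : P.IsHomogeneous d) (hf : IsTame f) (hg : IsTame g) {ε : ℝ}
    (hε : 0 < ε) (x : EuclideanSpace ℝ (Fin n)) :
    truncated d P ε (fun y => f y + g y) x = truncated d P ε f x + truncated d P ε g x := by
  rw [truncated_eq, truncated_eq, truncated_eq]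
  simp only [smul_eq_mul]
  rw [← integral_add (hf.integrable_cutKernel_mul hP hε x) (hg.integrable_cutKernel_mul hP hε x)]
  simp_rw [mul_add]

lemma exists_lintegral_compl_ball_le {u : EuclideanSpace ℝ (Fin n) → ℝ≥0∞} (hu : AEMeasurable u)
    (hfin : ∫⁻ y, u y ≠ ∞) (x : EuclideanSpace ℝ (Fin n)) (R₀ : ℝ) {η : ℝ≥0∞} (hη : 0 < η) :
    ∃ R ≥ R₀, ∫⁻ y, (Metric.ball x R)ᶜ.indicator u y ≤ η := by
  have h : Tendsto (fun k : ℕ => ∫⁻ y, (Metric.ball x (k : ℝ))ᶜ.indicator u y) atTop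
      (𝓝 (∫⁻ _ : EuclideanSpace ℝ (Fin n), 0)) := by
    refine tendsto_lintegral_of_dominated_convergence' u
      (fun k => hu.indicator measurableSet_ball.compl)
      (fun k => Eventually.of_forall fun y => indicator_le_self _ _ _) hfin
      (Eventually.of_forall fun y => ?_)
    refine tendsto_const_nhds.congr' ?_
    obtain ⟨k₀, hk₀⟩ := exists_nat_gt (dist y x)
    filter_upwards [eventually_ge_atTop k₀] with k hk
    rw [indicator_of_notMem]
    rw [mem_compl_iff, not_not, Metric.mem_ball]
    exact hk₀.trans_le (by exact_mod_cast hk)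
  rw [lintegral_zero] at h
  obtain ⟨k₀, hk₀⟩ := exists_nat_ge R₀
  obtain ⟨k, hk, hk'⟩ := ((h.eventually_lt_const hη).and (eventually_ge_atTop k₀)).exists
  exact ⟨k, hk₀.trans (by exact_mod_cast hk'), hk.le⟩

/-- Approximation of a tame function on a ball by square integrable functions, up to a small
exceptional set. -/
theorem IsTame.exists_approx (hn : 1 ≤ n) (hP : P.IsHomogeneous d) (hf : IsTame f)
    (x₀ : EuclideanSpace ℝ (Fin n)) {ε : ℝ} (hε : 0 < ε) :
    ∃ D : ℝ≥0, ∀ η : ℝ≥0∞, 0 < η →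
      ∃ (g : EuclideanSpace ℝ (Fin n) → ℝ) (S : Set (EuclideanSpace ℝ (Fin n)))
        (h : EuclideanSpace ℝ (Fin n) → ℝ),
        MemLp g 2 ∧ MeasurableSet S ∧
        ‖truncated d P ε f x₀ - truncated d P ε g x₀‖ₑ ≤ D * η ∧
        volume S ≤ η ∧ volume S * eLpNorm g 2 ^ 2 ≤ η ∧
        (∀ᵐ z, z ∈ Metric.ball x₀ ε → z ∉ S → ∀ v, HasPrincipalValue d P g z v →
          HasPrincipalValue d P f z (v + h z)) ∧
        ∫⁻ z in Metric.ball x₀ ε \ S, ‖h z‖ₑ ≤ D * η := by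
  obtain ⟨A, hA, hK⟩ := exists_enorm_cutKernel_mul_le (n := n) hP
  obtain ⟨A', hA', hcut⟩ := exists_cutKernel_bound (n := n) hP
  obtain ⟨C, hC⟩ := exists_badPart_transform (n := n) hP
  set M : ℝ≥0∞ := ENNReal.ofReal (A * (ε ^ n)⁻¹ * (1 + (‖x₀‖ + ε) + ε) ^ n) with hM
  have hMt : M ≠ ∞ := ENNReal.ofReal_ne_top
  clear_value M
  set Q : ℝ≥0∞ := ENNReal.ofReal (A' * (ε ^ n)⁻¹) with hQ
  have hQt : Q ≠ ∞ := ENNReal.ofReal_ne_top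
  set V : ℝ≥0∞ := volume (Metric.ball x₀ ε) with hV
  have hVt : V ≠ ∞ := measure_ball_lt_top.ne
  have hDt : Q + M + C + M * V ≠ ∞ := by finiteness
  refine ⟨(Q + M + C + M * V).toNNReal, fun η hη => ?_⟩
  rw [ENNReal.coe_toNNReal hDt]
  -- Besides smallness of the tail, `R ≥ 2ε` keeps the support of `f₂` at distance more than `ε`
  -- from `B(x₀, ε)`. On that ball the truncations of `f₂` are therefore constant for `δ ≤ ε`.
  obtain ⟨R, hR, hτ⟩ := exists_lintegral_compl_ball_le hf.1.enorm hf.2.ne x₀ (2 * ε) hη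
  set f₁ : EuclideanSpace ℝ (Fin n) → ℝ := (Metric.ball x₀ R).indicator f with hf₁
  set f₂ : EuclideanSpace ℝ (Fin n) → ℝ := (Metric.ball x₀ R)ᶜ.indicator f with hf₂
  have hf₁int : Integrable f₁ :=
    (integrable_indicator_iff measurableSet_ball).2 (hf.integrableOn_ball x₀ R)
  have hf₂tame : IsTame f₂ := hf.indicator measurableSet_ball.compl
  obtain ⟨β, cen, Ω, S, hΩ, hS, hsub, hβ, hcen, hβ0, hfar, hmean, hβ1, hvol, hg, hvg⟩ :=
    exists_CZ_small hn hf₁int hη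
  have hbad : IsBadPart β cen Ω S := ⟨hΩ, hS, hsub, hβ, hcen, hβ0, hfar, hmean⟩
  obtain ⟨hb, hbpv, hbint⟩ := hC β cen Ω S hbad
  set g : EuclideanSpace ℝ (Fin n) → ℝ := fun y => f₁ y - β y with hgdef
  have hgtame : IsTame g := IsTame.of_memLp hn (by norm_num) (by norm_num) hg
  have hβtame : IsTame β := IsTame.of_integrable hβ
  have hsplit : f = fun y => g y + (β y + f₂ y) := by
    funext y
    have := congrFun (indicator_self_add_compl (Metric.ball x₀ R) f) y
    simp only [Pi.add_apply] at this
    rw [hgdef]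
    simp only
    rw [← this]; ring
  have htr : ∀ δ > 0, ∀ z, truncated d P δ f z =
      truncated d P δ g z + (truncated d P δ β z + truncated d P δ f₂ z) := by
    intro δ hδ z
    rw [← hβtame.truncated_add hP hf₂tame hδ, ← hgtame.truncated_add hP (hβtame.add hf₂tame) hδ,
      ← hsplit]
  -- the tail
  have htail : ∀ z ∈ Metric.ball x₀ ε, ‖truncated d P ε f₂ z‖ₑ ≤ M * η := by
    intro z hz
    rw [truncated_eq]
    refine (enorm_integral_le_lintegral_enorm _).trans ?_
    refine (lintegral_mono (hK f₂ ε hε z)).trans ?_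
    rw [lintegral_const_mul' _ _ ENNReal.ofReal_ne_top, hM]
    have hz' : ‖z‖ ≤ ‖x₀‖ + ε := by
      rw [mem_ball_iff_norm] at hz
      have := norm_add_le x₀ (z - x₀)
      rw [add_sub_cancel] at this
      linarith
    refine mul_le_mul' (ENNReal.ofReal_le_ofReal (by gcongr)) (le_trans (le_of_eq ?_) hτ)
    refine lintegral_congr fun y => ?_
    by_cases hy : y ∈ (Metric.ball x₀ R)ᶜ
    · rw [hf₂, indicator_of_mem hy, indicator_of_mem hy]
    · rw [hf₂, indicator_of_notMem hy, indicator_of_notMem hy, mul_zero, enorm_zero]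
  have htailpv : ∀ z ∈ Metric.ball x₀ ε,
      HasPrincipalValue d P f₂ z (truncated d P ε f₂ z) := by
    intro z hz
    refine tendsto_const_nhds.congr' ?_
    filter_upwards [nhdsWithin_le_nhds (Iio_mem_nhds hε)] with δ (hδ : δ < ε)
    rw [truncated_eq, truncated_eq]
    refine integral_congr_ae (Eventually.of_forall fun y => ?_)
    by_cases hy : y ∈ (Metric.ball x₀ R)ᶜ
    · have h1 : ε < ‖z - y‖ := by
        rw [mem_compl_iff, Metric.mem_ball, not_lt] at hy
        rw [Metric.mem_ball] at hz
        have := dist_triangle_left y x₀ z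
        rw [← dist_eq_norm]
        linarith
      simp only [cutKernel, if_pos h1, if_pos (hδ.trans h1)]
    · simp only [hf₂, indicator_of_notMem hy, smul_zero]
  have hbadtr : ‖truncated d P ε β x₀‖ₑ ≤ Q * η := by
    rw [truncated_eq]
    refine (enorm_integral_le_lintegral_enorm _).trans ?_
    calc ∫⁻ y, ‖cutKernel d P ε (x₀ - y) • β y‖ₑ ≤ ∫⁻ y, Q * ‖β y‖ₑ := by
          refine lintegral_mono fun y => ?_
          rw [smul_eq_mul, enorm_mul]
          gcongr
          rw [hQ, ← ofReal_norm]
          exact ENNReal.ofReal_le_ofReal (hcut ε hε _)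
      _ = Q * ∫⁻ y, ‖β y‖ₑ := lintegral_const_mul' _ _ hQt
      _ ≤ _ := by gcongr
  refine ⟨g, S, fun z => hb z + truncated d P ε f₂ z, hg, hS, ?_, hvol, hvg, ?_, ?_⟩
  · rw [htr ε hε, add_sub_cancel_left]
    calc _ ≤ ‖truncated d P ε β x₀‖ₑ + ‖truncated d P ε f₂ x₀‖ₑ := enorm_add_le _ _
      _ ≤ Q * η + M * η := add_le_add hbadtr (htail x₀ (Metric.mem_ball_self hε))
      _ = (Q + M) * η := (add_mul _ _ _).symm
      _ ≤ _ := by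
        refine mul_le_mul_left ?_ η
        rw [add_assoc (Q + M)]
        exact le_self_add
  · filter_upwards [hbpv] with z hz hzball hzS v hv
    have := hv.add ((hz hzS).add (htailpv z hzball))
    refine this.congr' ?_
    filter_upwards [self_mem_nhdsWithin] with δ (hδ : 0 < δ)
    exact (htr δ hδ z).symm
  · calc ∫⁻ z in Metric.ball x₀ ε \ S, ‖hb z + truncated d P ε f₂ z‖ₑ
        ≤ ∫⁻ z in Metric.ball x₀ ε \ S, (‖hb z‖ₑ + M * η) := by
          refine setLIntegral_mono_ae' (measurableSet_ball.diff hS)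
            (Eventually.of_forall fun z hz => ?_)
          exact (enorm_add_le _ _).trans (by gcongr; exact htail z hz.1)
      _ = (∫⁻ z in Metric.ball x₀ ε \ S, ‖hb z‖ₑ) + M * η * volume (Metric.ball x₀ ε \ S) := by
          rw [lintegral_add_right _ measurable_const, setLIntegral_const]
      _ ≤ C * η + M * η * V := by
          refine add_le_add ?_ (by rw [hV]; gcongr; exact sdiff_subset)
          refine (lintegral_mono_set (fun z hz => hz.2)).trans (hbint.trans ?_)
          gcongr
      _ = (C + M * V) * η := by ring
      _ ≤ _ := by
        refine mul_le_mul_left ?_ η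
        rw [add_assoc (Q + M)]
        exact le_add_self

end Tame

/-! ### Principal values and the maximal inequality -/

section Maximal

variable {n d : ℕ} {P : MvPolynomial (Fin n) ℝ} {f : EuclideanSpace ℝ (Fin n) → ℝ}

/-- On a fixed ball the principal value can fail only inside the exceptional set, up to a null set,
and that set can be made arbitrarily small. -/
theorem IsTame.ae_exists_principalValue (hn : 1 ≤ n) (hP : P.IsHomogeneous d)
    (hL2 : ∀ g : EuclideanSpace ℝ (Fin n) → ℝ, MemLp g 2 →
      ∀ᵐ x, ∃ v, HasPrincipalValue d P g x v) (hf : IsTame f) :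
    ∀ᵐ x, ∃ v, HasPrincipalValue d P f x v := by
  have key : ∀ k : ℕ, ∀ᵐ x, x ∈ Metric.ball (0 : EuclideanSpace ℝ (Fin n)) ((k : ℝ) + 1) →
      ∃ v, HasPrincipalValue d P f x v := by
    intro k
    obtain ⟨D, hD⟩ := hf.exists_approx hn hP 0 (by positivity : (0 : ℝ) < (k : ℝ) + 1)
    rw [ae_iff, ← nonpos_iff_eq_zero]
    refine le_of_forall_gt_imp_ge_of_dense fun η hη => ?_
    obtain ⟨g, S, h, hg, -, -, hS, -, hpv, -⟩ := hD η hη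
    refine (measure_mono_ae ?_).trans hS
    filter_upwards [hpv, hL2 g hg] with x h1 ⟨v, hv⟩ hx
    by_contra hxS
    exact hx fun hball => ⟨_, h1 hball hxS v hv⟩
  filter_upwards [ae_all_iff.2 key] with x hx
  obtain ⟨k, hk⟩ := exists_nat_gt ‖x‖
  exact hx k (by rw [mem_ball_zero_iff]; linarith)

/-- The Cauchy-Schwarz inequality, in the form matching the product bound of `exists_CZ_small`. -/
lemma setLIntegral_enorm_le_sqrt {h : EuclideanSpace ℝ (Fin n) → ℝ} (hh : AEStronglyMeasurable h)
    (S : Set (EuclideanSpace ℝ (Fin n))) :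
    ∫⁻ z in S, ‖h z‖ₑ ≤ (volume S * eLpNorm h 2 ^ 2) ^ (1 / 2 : ℝ) := by
  have h1 := eLpNorm_le_eLpNorm_mul_rpow_measure_univ (p := 1) (q := 2)
    (μ := volume.restrict S) (by norm_num) hh.restrict
  rw [eLpNorm_one_eq_lintegral_enorm, Measure.restrict_apply_univ] at h1
  refine h1.trans ?_
  have h2 : (1 : ℝ) / (1 : ℝ≥0∞).toReal - 1 / (2 : ℝ≥0∞).toReal = 1 / 2 := by norm_num
  have h3 : ((2 : ℕ) : ℝ) * (1 / 2) = 1 := by norm_num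
  rw [ENNReal.mul_rpow_of_nonneg _ _ (by norm_num), ← ENNReal.rpow_natCast, ← ENNReal.rpow_mul,
    mul_comm, h2, h3, ENNReal.rpow_one]
  exact mul_le_mul' le_rfl (eLpNorm_mono_measure h Measure.restrict_le_self)

lemma IsTransform.setLIntegral_enorm_le {N : ℕ} {b g u : EuclideanSpace ℝ (Fin n) → ℝ} {A : ℝ≥0}
    (hu : IsTransform N P b A g u) {S : Set (EuclideanSpace ℝ (Fin n))} {η : ℝ≥0∞}
    (hS : volume S * eLpNorm g 2 ^ 2 ≤ η) : ∫⁻ z in S, ‖u z‖ₑ ≤ A * η ^ (1 / 2 : ℝ) := by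
  refine (setLIntegral_enorm_le_sqrt hu.memLp.1 S).trans ?_
  have h1 : volume S * eLpNorm u 2 ^ 2 ≤ (A : ℝ≥0∞) ^ 2 * η := by
    refine (mul_le_mul_right (pow_le_pow_left' hu.bound 2) _).trans ?_
    rw [mul_pow, mul_left_comm]
    exact mul_le_mul_right hS _
  refine (ENNReal.rpow_le_rpow h1 (by norm_num)).trans (le_of_eq ?_)
  have h3 : ((2 : ℕ) : ℝ) * (1 / 2) = 1 := by norm_num
  rw [ENNReal.mul_rpow_of_nonneg _ _ (by norm_num), ← ENNReal.rpow_natCast,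
    ← ENNReal.rpow_mul, h3, ENNReal.rpow_one]

/-- The truncated singular integral is controlled by the average of the principal values. -/
theorem IsTame.enorm_truncated_le (hn : 1 ≤ n) {N : ℕ} (hP : P.IsHomogeneous (2 * N))
    {b : EuclideanSpace ℝ (Fin n) → ℝ} {B : ℝ} (hB : ∀ x, |b x| ≤ B)
    (hsupp : Function.support b ⊆ Metric.ball 0 1) {A : ℝ≥0}
    (hT : ∀ g, MemLp g 2 → ∃ h, IsTransform N P b A g h ∧
      ∀ᵐ x, HasPrincipalValue (2 * N) P g x (h x))
    (hf : IsTame f) {v : EuclideanSpace ℝ (Fin n) → ℝ} (hvm : AEStronglyMeasurable v)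
    (hv : ∀ᵐ x, HasPrincipalValue (2 * N) P f x (v x)) (x : EuclideanSpace ℝ (Fin n)) {ε : ℝ}
    (hε : 0 < ε) :
    ‖truncated (2 * N) P ε f x‖ₑ ≤
      ENNReal.ofReal ((ε ^ n)⁻¹ * B) * ∫⁻ z in Metric.ball x ε, ‖v z‖ₑ := by
  obtain ⟨D, hD⟩ := hf.exists_approx hn hP x hε
  have hB0 : 0 ≤ B := (abs_nonneg _).trans (hB 0)
  obtain ⟨K, hK⟩ : ∃ K, K = ENNReal.ofReal ((ε ^ n)⁻¹ * B) := ⟨_, rfl⟩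
  have hKt : K ≠ ∞ := hK ▸ ENNReal.ofReal_ne_top
  rw [← hK]
  obtain ⟨I, hI⟩ : ∃ I, I = ∫⁻ z in Metric.ball x ε, ‖v z‖ₑ := ⟨_, rfl⟩
  rw [← hI]
  have key : ∀ η : ℝ≥0∞, 0 < η → ‖truncated (2 * N) P ε f x‖ₑ ≤
      K * I + ((D + K * D) * η + K * A * η ^ (1 / 2 : ℝ)) := by
    intro η hη
    obtain ⟨g, S, h, hg, hSm, hfg, hS, hSg, hpv, hh⟩ := hD η hη
    obtain ⟨u, hu, hupv⟩ := hT g hg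
    have h1 : ‖truncated (2 * N) P ε g x‖ₑ ≤ K * ∫⁻ z in Metric.ball x ε, ‖u z‖ₑ := by
      rw [hu.rep x ε hε, enorm_mul]
      calc ‖(ε ^ n)⁻¹‖ₑ * ‖∫ y, b (ε⁻¹ • (x - y)) * u y‖ₑ
          ≤ ‖(ε ^ n)⁻¹‖ₑ * ∫⁻ y in Metric.ball x ε, ENNReal.ofReal B * ‖u y‖ₑ := by
            gcongr
            refine (enorm_integral_le_lintegral_enorm _).trans ?_
            rw [← lintegral_indicator measurableSet_ball]
            refine lintegral_mono fun y => ?_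
            by_cases hy : y ∈ Metric.ball x ε
            · rw [indicator_of_mem hy, enorm_mul]
              gcongr
              rw [← ofReal_norm]
              exact ENNReal.ofReal_le_ofReal (hB _)
            · rw [affine_eq_zero hsupp x y hε hy, zero_mul, enorm_zero]
              exact zero_le
        _ = _ := by
          rw [lintegral_const_mul' _ _ ENNReal.ofReal_ne_top, ← mul_assoc, hK,
            ENNReal.ofReal_mul (by positivity), Real.enorm_eq_ofReal (by positivity)]
    -- On the exceptional set only the `L²` bound for the transform `u` of `g` is available; off it,
    -- `u` is compared with `v` through `v = u + h`.
    have h2 : ∫⁻ z in Metric.ball x ε ∩ S, ‖u z‖ₑ ≤ A * η ^ (1 / 2 : ℝ) := by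
      exact (lintegral_mono_set inter_subset_right).trans (hu.setLIntegral_enorm_le hSg)
    have h4 : ∫⁻ z in Metric.ball x ε \ S, ‖u z‖ₑ ≤ I + D * η := by
      calc ∫⁻ z in Metric.ball x ε \ S, ‖u z‖ₑ
          ≤ ∫⁻ z in Metric.ball x ε \ S, (‖v z‖ₑ + ‖h z‖ₑ) := by
            refine setLIntegral_mono_ae' (measurableSet_ball.diff hSm) ?_
            filter_upwards [hpv, hupv, hv] with z hz1 hz2 hz3 hz
            have : v z = u z + h z := tendsto_nhds_unique hz3 (hz1 hz.1 hz.2 _ hz2)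
            have e : u z = v z - h z := by rw [this, add_sub_cancel_right]
            rw [e]
            exact enorm_sub_le
        _ = (∫⁻ z in Metric.ball x ε \ S, ‖v z‖ₑ) + ∫⁻ z in Metric.ball x ε \ S, ‖h z‖ₑ :=
            lintegral_add_left' hvm.restrict.enorm _
        _ ≤ _ := add_le_add (hI ▸ lintegral_mono_set sdiff_subset) hh
    have h5 : ∫⁻ z in Metric.ball x ε, ‖u z‖ₑ ≤ A * η ^ (1 / 2 : ℝ) + (I + D * η) := by
      rw [← lintegral_inter_add_sdiff _ _ hSm]
      exact add_le_add h2 h4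
    calc ‖truncated (2 * N) P ε f x‖ₑ
        ≤ ‖truncated (2 * N) P ε f x - truncated (2 * N) P ε g x‖ₑ +
          ‖truncated (2 * N) P ε g x‖ₑ := by
          have := enorm_add_le (truncated (2 * N) P ε f x - truncated (2 * N) P ε g x)
            (truncated (2 * N) P ε g x)
          rwa [sub_add_cancel] at this
      _ ≤ D * η + K * (A * η ^ (1 / 2 : ℝ) + (I + D * η)) :=
          add_le_add hfg (h1.trans (mul_le_mul_right h5 K))
      _ = _ := by ring
  have hlim : Tendsto (fun k : ℕ => K * I + ((D + K * D) * (k : ℝ≥0∞)⁻¹ +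
      K * A * ((k : ℝ≥0∞)⁻¹) ^ (1 / 2 : ℝ))) atTop (𝓝 (K * I)) := by
    have h1 := ENNReal.tendsto_inv_nat_nhds_zero
    have h2 : Tendsto (fun k : ℕ => ((k : ℝ≥0∞)⁻¹) ^ (1 / 2 : ℝ)) atTop (𝓝 0) := by
      have := (ENNReal.continuous_rpow_const (y := (1 / 2 : ℝ))).tendsto (0 : ℝ≥0∞)
      rw [ENNReal.zero_rpow_of_pos (by norm_num)] at this
      exact this.comp h1
    have h3 := ENNReal.Tendsto.const_mul (a := (D : ℝ≥0∞) + K * D) h1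
      (Or.inr (by finiteness))
    have h4 := ENNReal.Tendsto.const_mul (a := K * (A : ℝ≥0∞)) h2 (Or.inr (by finiteness))
    have h5 := (tendsto_const_nhds (x := K * I)).add (h3.add h4)
    simpa using h5
  exact ge_of_tendsto' hlim fun k => key _ (ENNReal.inv_pos.2 (ENNReal.natCast_ne_top k))

/-- Pointwise control of the truncations by the maximal function of the transform. -/
theorem IsTame.enorm_truncated_le_hardyLittlewood (hn : 1 ≤ n) {N : ℕ}
    (hP : P.IsHomogeneous (2 * N)) {b : EuclideanSpace ℝ (Fin n) → ℝ} {B : ℝ}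
    (hB : ∀ x, |b x| ≤ B) (hsupp : Function.support b ⊆ Metric.ball 0 1) {A : ℝ≥0}
    (hT : ∀ g, MemLp g 2 → ∃ h, IsTransform N P b A g h ∧
      ∀ᵐ x, HasPrincipalValue (2 * N) P g x (h x))
    (hf : IsTame f) {v : EuclideanSpace ℝ (Fin n) → ℝ} (hvm : AEStronglyMeasurable v)
    (hv : ∀ᵐ x, HasPrincipalValue (2 * N) P f x (v x)) (x : EuclideanSpace ℝ (Fin n)) {ε : ℝ}
    (hε : 0 < ε) :
    ‖truncated (2 * N) P ε f x‖ₑ ≤ ENNReal.ofReal B *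
      volume (Metric.ball (0 : EuclideanSpace ℝ (Fin n)) 1) * hardyLittlewood v x := by
  refine (hf.enorm_truncated_le hn hP hB hsupp hT hvm hv x hε).trans ?_
  have h1 : (volume (Metric.ball x ε))⁻¹ * ∫⁻ y in Metric.ball x ε, ‖v y‖ₑ ≤
      hardyLittlewood v x :=
    le_iSup₂ (f := fun (r : ℝ) (_ : 0 < r) =>
      (volume (Metric.ball x r))⁻¹ * ∫⁻ y in Metric.ball x r, ‖v y‖ₑ) ε hε
  refine le_trans (le_of_eq ?_) (mul_le_mul_right h1 _)
  rw [Measure.addHaar_ball_of_pos _ _ hε, finrank_euclideanSpace_fin,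
    ENNReal.mul_inv (Or.inr measure_ball_lt_top.ne) (Or.inl ENNReal.ofReal_ne_top),
    ENNReal.ofReal_mul (by positivity), ENNReal.ofReal_inv_of_pos (by positivity)]
  have h2 : volume (Metric.ball (0 : EuclideanSpace ℝ (Fin n)) 1) *
      (volume (Metric.ball (0 : EuclideanSpace ℝ (Fin n)) 1))⁻¹ = 1 :=
    ENNReal.mul_inv_cancel (Metric.measure_ball_pos volume 0 one_pos).ne' measure_ball_lt_top.ne
  calc _ = ENNReal.ofReal B * (ENNReal.ofReal (ε ^ n))⁻¹ * 1 *
        ∫⁻ z in Metric.ball x ε, ‖v z‖ₑ := by ring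
    _ = _ := by rw [← h2]; ring

/-- The weak type `(1,1)` inequality for the Hardy-Littlewood maximal function. -/
theorem volume_lt_hardyLittlewood_le {F : Type*} [NormedAddCommGroup F] (hn : 1 ≤ n)
    (v : EuclideanSpace ℝ (Fin n) → F) {l : ℝ≥0∞} (hl : l ≠ 0) (hl' : l ≠ ∞) :
    volume {x | l < hardyLittlewood v x} ≤ ENNReal.ofReal (5 ^ n) * (l⁻¹ * ∫⁻ y, ‖v y‖ₑ) := by
  have : Nontrivial (EuclideanSpace ℝ (Fin n)) :=
    Module.nontrivial_of_finrank_pos (R := ℝ) (by rw [finrank_euclideanSpace_fin]; omega)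
  by_cases hfin : ∫⁻ y, ‖v y‖ₑ = ∞
  · rw [hfin, ENNReal.mul_top (ENNReal.inv_ne_zero.2 hl'),
      ENNReal.mul_top (ENNReal.ofReal_pos.2 (by positivity)).ne']
    exact le_top
  set ν : Measure (EuclideanSpace ℝ (Fin n)) := volume.withDensity fun y => ‖v y‖ₑ with hν
  have hνS : ∀ S, MeasurableSet S → ν S = ∫⁻ y in S, ‖v y‖ₑ := fun S hS => withDensity_apply _ hS
  have hνuniv : ν univ = ∫⁻ y, ‖v y‖ₑ := by
    rw [hνS _ MeasurableSet.univ, Measure.restrict_univ]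
  obtain ⟨u, r, hu, hr, hdisj, hlow, -, hout⟩ :=
    exists_vitali_balls hn ν (by rwa [hνuniv]) hl
  have hsub : {x | l < hardyLittlewood v x} ⊆ ⋃ c ∈ u, Metric.closedBall c (5 * r c) := by
    intro x hx
    by_contra hxu
    simp only [mem_iUnion, not_exists] at hxu
    refine absurd (show hardyLittlewood v x ≤ l from iSup₂_le fun s hs => ?_) (not_le.2 hx)
    have h1 := hout x hxu s hs
    -- The selection uses closed balls and the maximal function open ones; they have the same volume
    -- because `n ≥ 1`.
    rw [Measure.addHaar_closedBall_eq_addHaar_ball volume x s, mul_comm] at h1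
    have h2 : ∫⁻ y in Metric.ball x s, ‖v y‖ₑ ≤ volume (Metric.ball x s) * l := by
      rw [← hνS _ measurableSet_ball]
      exact (measure_mono Metric.ball_subset_closedBall).trans h1
    rw [mul_comm, ← div_eq_mul_inv]
    exact ENNReal.div_le_of_le_mul' h2
  calc volume {x | l < hardyLittlewood v x}
      ≤ volume (⋃ c ∈ u, Metric.closedBall c (5 * r c)) := measure_mono hsub
    _ ≤ ∑' c : u, volume (Metric.closedBall c.1 (5 * r c.1)) := measure_biUnion_le _ hu _
    _ ≤ ∑' c : u, ENNReal.ofReal (5 ^ n) * (l⁻¹ * ν (Metric.closedBall c.1 (r c.1))) := by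
        refine ENNReal.tsum_le_tsum fun c => ?_
        rw [volume_closedBall_mul _ (hr c.1 c.2).le (by norm_num)]
        refine mul_le_mul_right ?_ _
        rw [mul_comm, ← div_eq_mul_inv, ENNReal.le_div_iff_mul_le (Or.inl hl) (Or.inl hl'),
          mul_comm]
        exact hlow c.1 c.2
    _ = ENNReal.ofReal (5 ^ n) * (l⁻¹ * ν (⋃ c ∈ u, Metric.closedBall c (r c))) := by
        rw [ENNReal.tsum_mul_left, ENNReal.tsum_mul_left, measure_biUnion hu hdisj
          fun c _ => Metric.isClosed_closedBall.measurableSet]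
    _ ≤ _ := by
        rw [← hνuniv]
        gcongr
        exact subset_univ _

end Maximal

/-! ### Real and imaginary parts -/

section Scalars

variable {n d : ℕ} {P : MvPolynomial (Fin n) ℝ} {𝕜 : Type*} [RCLike 𝕜]
  {f : EuclideanSpace ℝ (Fin n) → 𝕜}

lemma truncated_re_im (hP : P.IsHomogeneous d) (hre : IsTame fun y => RCLike.re (f y))
    (him : IsTame fun y => RCLike.im (f y)) {ε : ℝ} (hε : 0 < ε)
    (x : EuclideanSpace ℝ (Fin n)) :
    RCLike.re (truncated d P ε f x) = truncated d P ε (fun y => RCLike.re (f y)) x ∧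
      RCLike.im (truncated d P ε f x) = truncated d P ε (fun y => RCLike.im (f y)) x := by
  have hint : Integrable fun y => cutKernel d P ε (x - y) • f y := by
    rw [← Integrable.re_im_iff]
    refine ⟨(hre.integrable_cutKernel_mul hP hε x).congr (Eventually.of_forall fun y => ?_),
      (him.integrable_cutKernel_mul hP hε x).congr (Eventually.of_forall fun y => ?_)⟩
    · simp [RCLike.smul_re]
    · simp [RCLike.smul_im]
  simp only [truncated_eq]
  rw [← integral_re hint, ← integral_im hint]
  simp only [RCLike.smul_re, RCLike.smul_im, smul_eq_mul, and_self]

lemma aestronglyMeasurable_truncated (hf : AEStronglyMeasurable f) (ε : ℝ) :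
    AEStronglyMeasurable (truncated d P ε f) := by
  have h1 : (truncated d P ε f) = fun x => ∫ y, cutKernel d P ε (x - y) • f y :=
    funext fun x => truncated_eq d P ε f x
  rw [h1]
  have h2 : AEStronglyMeasurable (fun q : EuclideanSpace ℝ (Fin n) × EuclideanSpace ℝ (Fin n) =>
      cutKernel d P ε (q.1 - q.2) • f q.2) (volume.prod volume) :=
    ((measurable_cutKernel d P ε).comp
      (measurable_fst.sub measurable_snd)).aestronglyMeasurable.smul hf.comp_snd
  exact h2.integral_prod_right'

/-- A principal value is an almost everywhere limit along a sequence `ε → 0+` of measurable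
truncations. -/
lemma aestronglyMeasurable_of_principalValue (hf : AEStronglyMeasurable f)
    {v : EuclideanSpace ℝ (Fin n) → 𝕜} (hv : ∀ᵐ x, HasPrincipalValue d P f x (v x)) :
    AEStronglyMeasurable v := by
  obtain ⟨u, -, hu0, hu⟩ := exists_seq_strictAnti_tendsto (0 : ℝ)
  refine aestronglyMeasurable_of_tendsto_ae atTop
    (fun k : ℕ => aestronglyMeasurable_truncated (d := d) (P := P) hf (u k)) ?_
  filter_upwards [hv] with x hx
  exact hx.comp (tendsto_nhdsWithin_iff.2 ⟨hu, Eventually.of_forall hu0⟩)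

lemma hardyLittlewood_mono {F G : Type*} [NormedAddCommGroup F] [NormedAddCommGroup G]
    {u : EuclideanSpace ℝ (Fin n) → F} {v : EuclideanSpace ℝ (Fin n) → G}
    (h : ∀ x, ‖u x‖ ≤ ‖v x‖) (x : EuclideanSpace ℝ (Fin n)) :
    hardyLittlewood u x ≤ hardyLittlewood v x := by
  refine iSup₂_mono fun r hr => mul_le_mul_right (lintegral_mono fun y => ?_) _
  rw [← ofReal_norm, ← ofReal_norm]
  exact ENNReal.ofReal_le_ofReal (h y)

lemma kernel_eq_zero (h : ∀ x : EuclideanSpace ℝ (Fin n), polyEval P x = 0) :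
    kernel d P = 0 := by
  funext x
  rw [kernel_eq, h x, zero_div, Pi.zero_apply]

lemma truncated_eq_zero (h : ∀ x : EuclideanSpace ℝ (Fin n), polyEval P x = 0) {F : Type*}
    [NormedAddCommGroup F] [NormedSpace ℝ F] (ε : ℝ) (f : EuclideanSpace ℝ (Fin n) → F)
    (x : EuclideanSpace ℝ (Fin n)) : truncated d P ε f x = 0 := by
  simp [truncated, kernel_eq_zero h]

end Scalars

/-! ### The maximal inequality for real or complex functions -/

section Main

variable {n : ℕ} {P : MvPolynomial (Fin n) ℝ} {𝕜 : Type*} [RCLike 𝕜]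
  {f : EuclideanSpace ℝ (Fin n) → 𝕜}

lemma HasPrincipalValue.rieszTransform_eq {d : ℕ} {x : EuclideanSpace ℝ (Fin n)} {v : 𝕜}
    (h : HasPrincipalValue d P f x v) : rieszTransform d P f x = v :=
  Tendsto.limUnder_eq h

/-- Existence of principal values, together with the pointwise maximal inequality. -/
theorem principalValue_and_maximalRiesz_le (hn : 1 ≤ n) {N : ℕ} (hP : P.IsHomogeneous (2 * N))
    {b : EuclideanSpace ℝ (Fin n) → ℝ} {B : ℝ} (hB : ∀ x, |b x| ≤ B)
    (hsupp : Function.support b ⊆ Metric.ball 0 1) {A : ℝ≥0}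
    (hT : ∀ g, MemLp g 2 → ∃ h, IsTransform N P b A g h ∧
      ∀ᵐ x, HasPrincipalValue (2 * N) P g x (h x))
    {p : ℝ≥0∞} (hp : 1 ≤ p) (hp' : p ≠ ∞) (hf : MemLp f p) :
    (∀ᵐ x, ∃ v, HasPrincipalValue (2 * N) P f x v) ∧
    ∀ x, maximalRiesz (2 * N) P f x ≤ 2 * (ENNReal.ofReal B *
      volume (Metric.ball (0 : EuclideanSpace ℝ (Fin n)) 1)) *
        hardyLittlewood (rieszTransform (2 * N) P f) x := by
  have hre : IsTame fun y => RCLike.re (f y) := IsTame.of_memLp hn hp hp' hf.re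
  have him : IsTame fun y => RCLike.im (f y) := IsTame.of_memLp hn hp hp' hf.im
  have hL2 : ∀ g : EuclideanSpace ℝ (Fin n) → ℝ, MemLp g 2 →
      ∀ᵐ x, ∃ v, HasPrincipalValue (2 * N) P g x v := fun g hg => by
    obtain ⟨h, -, hh⟩ := hT g hg
    filter_upwards [hh] with x hx using ⟨_, hx⟩
  have hpv : ∀ᵐ x, ∃ v, HasPrincipalValue (2 * N) P f x v := by
    filter_upwards [hre.ae_exists_principalValue hn hP hL2,
      him.ae_exists_principalValue hn hP hL2] with x ⟨r, hr⟩ ⟨i, hi⟩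
    refine ⟨(r : 𝕜) + i * RCLike.I, ?_⟩
    have h1 := ((RCLike.continuous_ofReal (K := 𝕜)).tendsto r).comp hr
    have h2 := ((RCLike.continuous_ofReal (K := 𝕜)).tendsto i).comp hi
    refine (h1.add (h2.mul_const RCLike.I)).congr' ?_
    filter_upwards [self_mem_nhdsWithin] with ε (hε : 0 < ε)
    obtain ⟨h3, h4⟩ := truncated_re_im hP hre him hε x
    simp only [Function.comp_apply]
    rw [← h3, ← h4, RCLike.re_add_im]
  refine ⟨hpv, fun x => iSup₂_le fun ε hε => ?_⟩
  set T := rieszTransform (2 * N) P f with hTdef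
  have hTpv : ∀ᵐ x, HasPrincipalValue (2 * N) P f x (T x) := by
    filter_upwards [hpv] with x ⟨v, hv⟩
    rwa [hTdef, hv.rieszTransform_eq]
  have hTm : AEStronglyMeasurable T := aestronglyMeasurable_of_principalValue hf.1 hTpv
  have hrepv : ∀ᵐ x, HasPrincipalValue (2 * N) P (fun y => RCLike.re (f y)) x (RCLike.re (T x)) := by
    filter_upwards [hTpv] with x hx
    refine (((RCLike.continuous_re (K := 𝕜)).tendsto _).comp hx).congr' ?_
    filter_upwards [self_mem_nhdsWithin] with ε (hε : 0 < ε)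
    exact (truncated_re_im hP hre him hε x).1
  have himpv : ∀ᵐ x, HasPrincipalValue (2 * N) P (fun y => RCLike.im (f y)) x (RCLike.im (T x)) := by
    filter_upwards [hTpv] with x hx
    refine (((RCLike.continuous_im (K := 𝕜)).tendsto _).comp hx).congr' ?_
    filter_upwards [self_mem_nhdsWithin] with ε (hε : 0 < ε)
    exact (truncated_re_im hP hre him hε x).2
  obtain ⟨h1, h2⟩ := truncated_re_im hP hre him hε x
  have hbre := hre.enorm_truncated_le_hardyLittlewood hn hP hB hsupp hT
    (RCLike.continuous_re.comp_aestronglyMeasurable hTm) hrepv x hε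
  have hbim := him.enorm_truncated_le_hardyLittlewood hn hP hB hsupp hT
    (RCLike.continuous_im.comp_aestronglyMeasurable hTm) himpv x hε
  have hmre : hardyLittlewood (fun y => RCLike.re (T y)) x ≤ hardyLittlewood T x :=
    hardyLittlewood_mono (fun y => RCLike.norm_re_le_norm _) x
  have hmim : hardyLittlewood (fun y => RCLike.im (T y)) x ≤ hardyLittlewood T x :=
    hardyLittlewood_mono (fun y => RCLike.norm_im_le_norm _) x
  have hsum : ‖truncated (2 * N) P ε f x‖ₑ ≤
      ‖truncated (2 * N) P ε (fun y => RCLike.re (f y)) x‖ₑ +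
      ‖truncated (2 * N) P ε (fun y => RCLike.im (f y)) x‖ₑ := by
    rw [← h1, ← h2, ← ofReal_norm, ← ofReal_norm, ← ofReal_norm,
      ← ENNReal.ofReal_add (norm_nonneg _) (norm_nonneg _)]
    refine ENNReal.ofReal_le_ofReal (abs_le_of_sq_le_sq' ?_ (by positivity)).2
    rw [RCLike.norm_sq_eq_def, Real.norm_eq_abs, Real.norm_eq_abs, add_sq, sq_abs, sq_abs]
    nlinarith [mul_nonneg (abs_nonneg (RCLike.re (truncated (2 * N) P ε f x)))
      (abs_nonneg (RCLike.im (truncated (2 * N) P ε f x)))]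
  refine hsum.trans ((add_le_add (hbre.trans (mul_le_mul_right hmre _))
    (hbim.trans (mul_le_mul_right hmim _))).trans (le_of_eq ?_))
  rw [← two_mul, mul_assoc 2]

/-- A pointwise bound by the maximal function gives a weak type bound. -/
lemma weakL1Norm_le {F : Type*} [NormedAddCommGroup F] (hn : 1 ≤ n)
    {G : EuclideanSpace ℝ (Fin n) → ℝ≥0∞} {v : EuclideanSpace ℝ (Fin n) → F} {C : ℝ≥0∞}
    (hC : C ≠ 0) (hC' : C ≠ ∞) (h : ∀ x, G x ≤ C * hardyLittlewood v x) :
    weakL1Norm G ≤ ENNReal.ofReal (5 ^ n) * C * eLpNorm v 1 := by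
  rw [eLpNorm_one_eq_lintegral_enorm]
  refine iSup₂_le fun t ht => ?_
  have ht0 : (t : ℝ≥0∞) ≠ 0 := by exact_mod_cast ht.ne'
  have hsub : {x | (t : ℝ≥0∞) < G x} ⊆ {x | (t : ℝ≥0∞) / C < hardyLittlewood v x} := by
    intro x hx
    exact ENNReal.div_lt_of_lt_mul' (lt_of_lt_of_le hx (h x))
  calc (t : ℝ≥0∞) * volume {x | (t : ℝ≥0∞) < G x}
      ≤ t * (ENNReal.ofReal (5 ^ n) * (((t : ℝ≥0∞) / C)⁻¹ * ∫⁻ y, ‖v y‖ₑ)) := by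
        refine mul_le_mul_right ((measure_mono hsub).trans ?_) _
        exact volume_lt_hardyLittlewood_le hn v (ENNReal.div_pos ht0 hC').ne'
          (ENNReal.div_ne_top ENNReal.coe_ne_top hC)
    _ = (t * (t : ℝ≥0∞)⁻¹) * (ENNReal.ofReal (5 ^ n) * C * ∫⁻ y, ‖v y‖ₑ) := by
        rw [ENNReal.inv_div (Or.inl hC') (Or.inl hC), div_eq_mul_inv]
        ring
    _ = _ := by rw [ENNReal.mul_inv_cancel ht0 ENNReal.coe_ne_top, one_mul]

lemma one_le_of_polyEval_ne_zero {d : ℕ} (hd : d ≠ 0) (hP : P.IsHomogeneous d)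
    {x : EuclideanSpace ℝ (Fin n)} (hx : polyEval P x ≠ 0) : 1 ≤ n := by
  rcases Nat.eq_zero_or_pos n with rfl | h
  · refine absurd ?_ hx
    rw [Subsingleton.elim x ((0 : ℝ) • x), polyEval_smul hP, zero_pow hd, zero_mul]
  · exact h

end Main

end HigherRiesz

end

/-! ### The theorem -/

theorem mainTheorem2 {𝕜 : Type*} [RCLike 𝕜] (n d : ℕ) (hd : 2 ≤ d) (hd_even : Even d)
    (P : MvPolynomial (Fin n) ℝ) (hP : P.IsHomogeneous d)
    (hP_harm : HigherRiesz.IsHarmonicPoly P) :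
    (∃ b : EuclideanSpace ℝ (Fin n) → ℝ,
      Measurable b ∧ (∃ A : ℝ, ∀ x, |b x| ≤ A) ∧
      Function.support b ⊆ Metric.ball 0 1 ∧
      ∀ᵐ x, HigherRiesz.HasPrincipalValue d P b x
        ((Metric.closedBall (0 : EuclideanSpace ℝ (Fin n)) 1)ᶜ.indicator
          (HigherRiesz.kernel d P) x)) ∧
    ∃ C : ℝ≥0, ∀ p : ℝ≥0∞, 1 ≤ p → p ≠ ∞ →
      ∀ f : EuclideanSpace ℝ (Fin n) → 𝕜, MemLp f p volume →
        (∀ᵐ x, ∃ v : 𝕜, HigherRiesz.HasPrincipalValue d P f x v) ∧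
        (∀ x, HigherRiesz.maximalRiesz d P f x ≤
          C * HigherRiesz.hardyLittlewood (HigherRiesz.rieszTransform d P f) x) ∧
        HigherRiesz.weakL1Norm (HigherRiesz.maximalRiesz d P f) ≤
          C * eLpNorm (HigherRiesz.rieszTransform d P f) 1 volume := by
  -- When `P` vanishes identically everything is zero and `b = 0` serves; otherwise homogeneity of
  -- positive degree forces `n ≥ 1`.
  by_cases h0 : ∀ x : EuclideanSpace ℝ (Fin n), HigherRiesz.polyEval P x = 0
  · have hmax : ∀ f : EuclideanSpace ℝ (Fin n) → 𝕜, ∀ x, HigherRiesz.maximalRiesz d P f x = 0 :=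
      fun f x => by simp [HigherRiesz.maximalRiesz, HigherRiesz.truncated_eq_zero h0]
    refine ⟨⟨0, measurable_const, ⟨0, fun x => by simp⟩, by simp, Eventually.of_forall fun x => ?_⟩,
      0, fun p _ _ f _ => ⟨Eventually.of_forall fun x => ⟨0, ?_⟩, fun x => by simp [hmax], ?_⟩⟩
    · simp [HigherRiesz.HasPrincipalValue, HigherRiesz.truncated_eq_zero h0,
        HigherRiesz.kernel_eq_zero h0]
    · simp [HigherRiesz.HasPrincipalValue, HigherRiesz.truncated_eq_zero h0]
    · simp [HigherRiesz.weakL1Norm, hmax]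
  push Not at h0
  obtain ⟨x₀, hx₀⟩ := h0
  have hn : 1 ≤ n := HigherRiesz.one_le_of_polyEval_ne_zero (by omega) hP hx₀
  obtain ⟨N, rfl⟩ := hd_even.two_dvd
  obtain ⟨b, hbm, ⟨B, hB⟩, hsupp, A, hT, hTb⟩ :=
    HigherRiesz.exists_bump hn (by omega) hP hP_harm hx₀
  refine ⟨⟨b, hbm, ⟨B, hB⟩, hsupp, ?_⟩, ?_⟩
  · filter_upwards [hTb] with x hx
    convert hx using 1
    by_cases h : 1 < ‖x‖
    · rw [HigherRiesz.cutKernel, if_pos h, indicator_of_mem (by simpa using h)]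
    · rw [HigherRiesz.cutKernel, if_neg h, indicator_of_notMem (by simpa using h)]
  -- The `2` accounts for real and imaginary parts. Below, `C₁ + 1` replaces `C₁` because
  -- `weakL1Norm_le` divides by the constant, and the factor `5ⁿ ≥ 1` of the weak type bound lets
  -- one constant serve both inequalities.
  set C₁ : ℝ≥0∞ := 2 * (ENNReal.ofReal B *
    volume (Metric.ball (0 : EuclideanSpace ℝ (Fin n)) 1)) with hC₁
  have hC₁t : C₁ ≠ ∞ := ENNReal.mul_ne_top (by norm_num)
    (ENNReal.mul_ne_top ENNReal.ofReal_ne_top measure_ball_lt_top.ne)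
  have hC₁t' : C₁ + 1 ≠ ∞ := ENNReal.add_ne_top.2 ⟨hC₁t, ENNReal.one_ne_top⟩
  have hCt : ENNReal.ofReal (5 ^ n) * (C₁ + 1) ≠ ∞ :=
    ENNReal.mul_ne_top ENNReal.ofReal_ne_top hC₁t'
  refine ⟨(ENNReal.ofReal (5 ^ n) * (C₁ + 1)).toNNReal, fun p hp hp' f hf => ?_⟩
  rw [ENNReal.coe_toNNReal hCt]
  obtain ⟨hpv, hmax⟩ :=
    HigherRiesz.principalValue_and_maximalRiesz_le hn hP hB hsupp hT hp hp' hf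
  have hmax' : ∀ x, HigherRiesz.maximalRiesz (2 * N) P f x ≤
      (C₁ + 1) * HigherRiesz.hardyLittlewood (HigherRiesz.rieszTransform (2 * N) P f) x :=
    fun x => (hmax x).trans (mul_le_mul_left le_self_add _)
  refine ⟨hpv, fun x => (hmax' x).trans (mul_le_mul_left ?_ _),
    HigherRiesz.weakL1Norm_le hn (by simp) hC₁t' hmax'⟩
  refine le_mul_of_one_le_left' ?_
  rw [← ENNReal.ofReal_one]
  exact ENNReal.ofReal_le_ofReal (one_le_pow₀ (by norm_num))
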